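/- Let $\mathbf k$ be a field, let $V_5=\mathbf k^5$, and let $B$ be a Cohen--Macaulay scheme over $\mathbf k$. Write $\mathbf P(V)$ for the projective space of lines in $V$. Let $\mathscr R\subset \bigwedge^2V_5^\vee\otimes\mathscr O_B$ be a rank-3 subbundle (the quotient is locally free of rank 7), set $\mathscr R^\perp:=\operatorname{Ker}(\bigwedge^2V_5\otimes\mathscr O_B\to\mathscr R^\vee)$ and $$\mathscr M:=\mathbf P_B(\mathscr R^\perp)\times_{\mathbf P(\bigwedge^2V_5)}\mathrm{Gr}(2,V_5)\to B,$$ where $\mathrm{Gr}(2,V_5)\subset\mathbf P(\bigwedge^2V_5)$ is the Plücker embedding. Let $\mathscr U\subset V_5\otimes\mathscr O_{\mathscr M}$ be the pullback of the tautological rank-2 subbundle on $\mathrm{Gr}(2,V_5)$, let $f:\mathbf P_{\mathscr M}(\mathscr U)\to B\times\mathbf P(V_5)$ be the natural map, and let $$\varphi:\mathscr R\hookrightarrow\textstyle\bigwedge^2V_5^\vee\otimes\mathscr O_{B\times\mathbf P(V_5)}\twoheadrightarrow\Omega_{\mathbf P(V_5)}(2)$$ be the composition on $B\times\mathbf P(V_5)$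 (pullbacks omitted) whose second map, at a point $v\in\mathbf P(V_5)$, is the contraction $\bigwedge^2V_5^\vee\to v^\perp$ with $v$. For $k\ge 0$ let $D_k(\varphi)\subset B\times\mathbf P(V_5)$ be the closed subscheme where $\varphi$ has corank $\ge k$ (i.e. rank $\le 3-k$), defined by the minors of order $4-k$ of $\varphi$; it is empty for $k\ge4$. Assume that $\operatorname{codim}D_k(\varphi)\ge k+1$ for all $k\ge1$ (the empty set has codimension $\infty$). Then $f$ is the blow up of $D_1(\varphi)$ in $B\times\mathbf P(V_5)$, and for every $k\ge0$ the base change of $f$ to the locally closed subscheme $D_k(\varphi)\smallsetminus D_{k+1}(\varphi)$ is a $\mathbf P^k$-fibration, that is, Zariski locally on the base isomorphic to the projection from the product with $\mathbf P^k$. -/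

import Mathlib

open CategoryTheory CategoryTheory.Limits AlgebraicGeometry

universe u

noncomputable section

namespace QuinticFibration

/-! ### Linear algebra of `V₅ = A⁵`, `⋀² V₅` and `⋀² V₅ᵛ` in coordinates -/

/-- The index set `{(i, j) : i < j}` of the standard bases of `⋀² V₅` and of `⋀² V₅ᵛ`. -/
abbrev Pair : Type := {p : Fin 5 × Fin 5 // p.1 < p.2}

section LinearAlgebra

variable {A : Type u} [CommRing A]

/-- The skew-symmetric `5 × 5` matrix with the given entries above the diagonal. -/
def skew (p : Pair → A) (i j : Fin 5) : A :=
  if h : i < j then p ⟨(i, j), h⟩ else if h : j < i then -p ⟨(j, i), h⟩ else 0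

/-- The duality pairing `⋀² V₅ᵛ × ⋀² V₅ → A`. -/
def pairing (r p : Pair → A) : A := ∑ a, r a * p a

/-- The contraction of the two-form `r` with the vector `v`: the linear form `r(v, ·)`, in
coordinates. -/
def contract (r : Pair → A) (v : Fin 5 → A) (j : Fin 5) : A := ∑ i, skew r i j * v i

/-- The coordinates of `v ∧ p ∈ ⋀³ V₅` for `v ∈ V₅` and `p ∈ ⋀² V₅`. -/
def wedge (v : Fin 5 → A) (p : Pair → A) (i j l : Fin 5) : A :=
  v i * skew p j l - v j * skew p i l + v l * skew p i j

/-- The quadratic Plücker expressions in `p ∈ ⋀² V₅` (the coordinates of "one half of `p ∧ p`"). -/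
def plucker (p : Pair → A) (i j l m : Fin 5) : A :=
  skew p i j * skew p l m - skew p i l * skew p j m + skew p i m * skew p j l

end LinearAlgebra

/-! ### Cohen–Macaulay schemes, codimension, blow ups -/

/-- A Cohen–Macaulay local ring: a Noetherian local ring with a regular sequence of length equal to
its dimension in the maximal ideal. -/
structure IsCohenMacaulayLocalRing (A : Type u) [CommRing A] : Prop where
  isLocalRing : IsLocalRing A
  isNoetherianRing : IsNoetherianRing A
  exists_regular : ∃ rs : List A, (∀ a ∈ rs, a ∈ IsLocalRing.maximalIdeal A) ∧
    RingTheory.Sequence.IsRegular A rs ∧ (rs.length : WithBot ℕ∞) = ringKrullDim A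

/-- A Cohen–Macaulay scheme: locally Noetherian with Cohen–Macaulay local rings. -/
structure IsCohenMacaulay (X : Scheme.{u}) : Prop where
  isLocallyNoetherian : IsLocallyNoetherian X
  stalk : ∀ x : X, IsCohenMacaulayLocalRing (X.presheaf.stalk x)

/-- The codimension of a closed subset `Z` of `X`: the infimum over `x ∈ Z` of the dimension of the
local ring of `X` at `x` (and `∞` if `Z` is empty). -/
def codim {X : Scheme.{u}} (Z : TopologicalSpace.Closeds X) : WithBot ℕ∞ :=
  ⨅ x ∈ Z, ringKrullDim (X.presheaf.stalk x)

/-- The ideal sheaf `I` is invertible, i.e. it defines an effective Cartier divisor. -/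
def IsCartier {X : Scheme.{u}} (I : X.IdealSheafData) : Prop :=
  ∀ x : X, ∃ W : X.affineOpens, x ∈ W.1 ∧
    ∃ a ∈ nonZeroDivisors Γ(X, W), I.ideal W = Ideal.span {a}

/-- `f : Y ⟶ X` is the blow up of the closed subscheme of `X` with ideal sheaf `I`: the inverse image
of this subscheme is an effective Cartier divisor, and `f` is universal with this property. -/
structure IsBlowUp {X Y : Scheme.{u}} (f : Y ⟶ X) (I : X.IdealSheafData) : Prop where
  isCartier : IsCartier (I.comap f)
  existsUnique_lift : ∀ ⦃T : Scheme.{u}⦄ (g : T ⟶ X), IsCartier (I.comap g) →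
    ∃! h : T ⟶ Y, h ≫ f = g

/-! ### Projective spaces -/

section Proj

attribute [local instance] MvPolynomial.gradedAlgebra

variable (ι : Type) (𝕜 : Type u) [Field 𝕜]

/-- The projective space of lines in `𝕜^ι`. -/
abbrev PP : Scheme.{u} := Proj (MvPolynomial.homogeneousSubmodule ι 𝕜)

/-- The structure morphism of projective space. -/
def PP.toSpec : PP ι 𝕜 ⟶ Spec (.of 𝕜) :=
  Proj.toSpecZero (MvPolynomial.homogeneousSubmodule ι 𝕜) ≫
    Spec.map (CommRingCat.ofHom (algebraMap 𝕜 (MvPolynomial.homogeneousSubmodule ι 𝕜 0)))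

variable {ι}

/-- The open subset of projective space where the `i`-th homogeneous coordinate is invertible. -/
abbrev PP.chart (i : ι) : (PP ι 𝕜).Opens :=
  Proj.basicOpen (MvPolynomial.homogeneousSubmodule ι 𝕜) (MvPolynomial.X i)

/-- The regular function `x_j / x_i` where `x_i` is invertible. -/
def PP.ratio (i j : ι) : Γ(PP ι 𝕜, PP.chart 𝕜 i) :=
  (Proj.awayToSection (MvPolynomial.homogeneousSubmodule ι 𝕜) (MvPolynomial.X i)).hom
    (HomogeneousLocalization.Away.mk (MvPolynomial.homogeneousSubmodule ι 𝕜)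
      ((MvPolynomial.mem_homogeneousSubmodule 1 _).2 (MvPolynomial.isHomogeneous_X 𝕜 i)) 1
      (MvPolynomial.X j)
      ((MvPolynomial.mem_homogeneousSubmodule _ _).2
        (by simpa using MvPolynomial.isHomogeneous_X 𝕜 j)))

end Proj

section Families

variable {𝕜 : Type u} [Field 𝕜]

/-- For a morphism `g` from `Y` to a projective space, the sections over `W` of the pullback of
the tautological line subbundle `𝒪(-1) ⊆ 𝒪^ι`: those `s` with `s_j = s_i (x_j / x_i)`
wherever `x_i` is invertible. -/
def tautLine {ι : Type} {Y : Scheme.{u}} (g : Y ⟶ PP ι 𝕜) (W : Y.Opens) :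
    Submodule Γ(Y, W) (ι → Γ(Y, W)) where
  carrier := {s | ∀ i j,
    (Y.presheaf.map (homOfLE (inf_le_left : W ⊓ g ⁻¹ᵁ PP.chart 𝕜 i ≤ W)).op).hom (s j) =
    (Y.presheaf.map (homOfLE (inf_le_left : W ⊓ g ⁻¹ᵁ PP.chart 𝕜 i ≤ W)).op).hom (s i) *
      (g.appLE (PP.chart 𝕜 i) (W ⊓ g ⁻¹ᵁ PP.chart 𝕜 i) inf_le_right).hom (PP.ratio 𝕜 i j)}
  add_mem' {s t} hs ht i j := by
    simp only [Pi.add_apply, map_add, hs i j, ht i j, add_mul]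
  zero_mem' i j := by simp
  smul_mem' c s hs i j := by
    simp only [Pi.smul_apply, smul_eq_mul, map_mul, hs i j, mul_assoc]

/-- The sections over `W` of the tautological rank-2 subbundle `𝒰 ⊆ V₅ ⊗ 𝒪_Y`, for a morphism `q` from
`Y` to `ℙ(⋀² V₅)` with values in the Grassmannian: it is the kernel of the map
`V₅ ⊗ 𝒪_Y → ⋀³ V₅ ⊗ 𝒪_Y(1)` given by the wedge product with the tautological bivector. -/
def tautBundle {Y : Scheme.{u}} (q : Y ⟶ PP Pair 𝕜) (W : Y.affineOpens) :
    Submodule Γ(Y, W) (Fin 5 → Γ(Y, W)) where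
  carrier := {v | ∀ p ∈ tautLine q W.1, ∀ i j l, wedge v p i j l = 0}
  add_mem' {s t} hs ht p hp i j l := by
    have h₁ := hs p hp i j l
    have h₂ := ht p hp i j l
    simp only [wedge, Pi.add_apply] at h₁ h₂ ⊢
    linear_combination h₁ + h₂
  zero_mem' p hp i j l := by simp [wedge]
  smul_mem' c s hs p hp i j l := by
    have h₁ := hs p hp i j l
    simp only [wedge, Pi.smul_apply, smul_eq_mul] at h₁ ⊢
    linear_combination c * h₁

/-- A rank-3 subbundle `ℛ` of the trivial bundle `⋀² V₅ᵛ ⊗ 𝒪_B` of rank 10, given by its sections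
over the affine open subsets: the quotient is locally free of rank 7. -/
structure Subbundle (B : Scheme.{u}) where
  sections : ∀ W : B.affineOpens, Module.Grassmannian Γ(B, W) (Pair → Γ(B, W)) 7
  restrict : ∀ (W W' : B.affineOpens) (h : W' ≤ W),
    (sections W').toSubmodule = Submodule.span Γ(B, W')
      ((fun s a ↦ (B.presheaf.map (homOfLE h).op).hom (s a)) ''
        ((sections W).toSubmodule : Set (Pair → Γ(B, W))))

variable {B : Scheme.{u}} (R : Subbundle B)

/-- The pullback to `W ⊆ Y` of a two-form with coefficients in `Γ(B, W')`. -/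
def pullForm {Y : Scheme.{u}} (b : Y ⟶ B) {W' : B.Opens} {W : Y.Opens} (h : W ≤ b ⁻¹ᵁ W')
    (r : Pair → Γ(B, W')) : Pair → Γ(Y, W) :=
  fun a ↦ (b.appLE W' W h).hom (r a)

/-- The tautological line in `⋀² V₅ ⊗ 𝒪_Y` given by `q` is contained in the pullback by `b`
of `ℛ^⊥ = Ker(⋀² V₅ ⊗ 𝒪_B → ℛᵛ)`. -/
def LineInPerp {Y : Scheme.{u}} (b : Y ⟶ B) (q : Y ⟶ PP Pair 𝕜) : Prop :=
  ∀ (W' : B.affineOpens) (W : Y.affineOpens) (h : W.1 ≤ b ⁻¹ᵁ W'.1),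
    ∀ r ∈ (R.sections W').toSubmodule, ∀ p ∈ tautLine q W.1, pairing (pullForm b h r) p = 0

/-- The tautological bivector given by `q` satisfies the Plücker relations. -/
def LineDecomposable {Y : Scheme.{u}} (q : Y ⟶ PP Pair 𝕜) : Prop :=
  ∀ W : Y.affineOpens, ∀ p ∈ tautLine q W.1, ∀ i j l m, plucker p i j l m = 0

/-- The tautological line in `V₅ ⊗ 𝒪_Y` given by `v` is contained in the bundle `𝒰` given by `q`. -/
def LineInBundle {Y : Scheme.{u}} (v : Y ⟶ PP (Fin 5) 𝕜) (q : Y ⟶ PP Pair 𝕜) : Prop :=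
  ∀ W : Y.affineOpens, tautLine v W.1 ≤ tautBundle q W

variable (𝕜) in
/-- The ideal sheaf of the Grassmannian in `ℙ(⋀² V₅)`: the largest closed subscheme on which the
Plücker relations hold. -/
def grassmannianIdeal : (PP Pair 𝕜).IdealSheafData :=
  sInf {J | LineDecomposable J.subschemeι}

variable (𝕜) in
/-- The Grassmannian `Gr(2, V₅)`. -/
abbrev Gr : Scheme.{u} := (grassmannianIdeal 𝕜).subscheme

variable (𝕜) in
/-- The Plücker embedding. -/
abbrev Gr.ι : Gr 𝕜 ⟶ PP Pair 𝕜 := (grassmannianIdeal 𝕜).subschemeι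

variable (s : B ⟶ Spec (.of 𝕜))

/-- The ideal sheaf of `ℙ_B(ℛ^⊥)` in `B × ℙ(⋀² V₅)`: the largest closed subscheme on which the
tautological line is contained in `ℛ^⊥`. -/
def perpIdeal : (pullback s (PP.toSpec Pair 𝕜)).IdealSheafData :=
  sInf {J | LineInPerp R (J.subschemeι ≫ pullback.fst _ _) (J.subschemeι ≫ pullback.snd _ _)}

/-- The projective bundle `ℙ_B(ℛ^⊥)`. -/
abbrev PPerp : Scheme.{u} := (perpIdeal R s).subscheme

/-- The projection `ℙ_B(ℛ^⊥) ⟶ B`. -/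
abbrev PPerp.toB : PPerp R s ⟶ B := (perpIdeal R s).subschemeι ≫ pullback.fst _ _

/-- The map `ℙ_B(ℛ^⊥) ⟶ ℙ(⋀² V₅)`. -/
abbrev PPerp.toPP : PPerp R s ⟶ PP Pair 𝕜 := (perpIdeal R s).subschemeι ≫ pullback.snd _ _

/-- The family of linear sections `ℳ = ℙ_B(ℛ^⊥) ×_{ℙ(⋀² V₅)} Gr(2, V₅)`. -/
abbrev MM : Scheme.{u} := pullback (PPerp.toPP R s) (Gr.ι 𝕜)

/-- The projection `ℳ ⟶ B`. -/
abbrev MM.toB : MM R s ⟶ B := pullback.fst _ _ ≫ PPerp.toB R s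

/-- The composition `ℳ ⟶ Gr(2, V₅) ⟶ ℙ(⋀² V₅)`. -/
abbrev MM.toPP : MM R s ⟶ PP Pair 𝕜 := pullback.snd _ _ ≫ Gr.ι 𝕜

/-- The ideal sheaf of `ℙ_ℳ(𝒰)` in `ℳ × ℙ(V₅) = ℙ_ℳ(V₅ ⊗ 𝒪)`: the largest closed subscheme on which
the tautological line is contained in `𝒰`. -/
def flagIdeal : (pullback (MM.toB R s ≫ s) (PP.toSpec (Fin 5) 𝕜)).IdealSheafData :=
  sInf {J | LineInBundle (J.subschemeι ≫ pullback.snd _ _)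
    (J.subschemeι ≫ pullback.fst _ _ ≫ MM.toPP R s)}

/-- The projectivization `ℙ_ℳ(𝒰)`. -/
abbrev PMU : Scheme.{u} := (flagIdeal R s).subscheme

/-- The product `B × ℙ(V₅)`. -/
abbrev BxP : Scheme.{u} := pullback s (PP.toSpec (Fin 5) 𝕜)

/-- The projection `B × ℙ(V₅) ⟶ B`. -/
abbrev BxP.toB : BxP s ⟶ B := pullback.fst _ _

/-- The projection `B × ℙ(V₅) ⟶ ℙ(V₅)`. -/
abbrev BxP.toPP : BxP s ⟶ PP (Fin 5) 𝕜 := pullback.snd _ _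

/-- The natural map `f : ℙ_ℳ(𝒰) ⟶ B × ℙ(V₅)`. -/
def mapF : PMU R s ⟶ BxP s :=
  pullback.lift ((flagIdeal R s).subschemeι ≫ pullback.fst _ _ ≫ MM.toB R s)
    ((flagIdeal R s).subschemeι ≫ pullback.snd _ _)
    (by
      have h := pullback.condition (f := MM.toB R s ≫ s) (g := PP.toSpec (Fin 5) 𝕜)
      simpa only [Category.assoc] using congrArg (fun h ↦ (flagIdeal R s).subschemeι ≫ h) h)

/-- The ideal sheaf of the degeneracy locus `D_k(φ) ⊆ B × ℙ(V₅)` of corank `≥ k` (i.e. rank `≤ 3 - k`)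
of `φ : ℛ → Ω_{ℙ(V₅)}(2)`: it is generated by the minors of `φ` of order `4 - k`. Here
`Ω_{ℙ(V₅)}(2)` is the subbundle `v^⊥ ⊗ 𝒪(1)` of `V₅ᵛ ⊗ 𝒪(1)`, with dual the quotient
`(V₅ ⊗ 𝒪 / 𝒪(-1)) ⊗ 𝒪(-1)` of `V₅ ⊗ 𝒪(-1)`, and `φ` maps `r` to the contraction `r(v, ·)`, where
`v` is a section of the tautological line `𝒪(-1)`; so the minors are locally the determinants of the
matrices `(r_a(v, w_c))` with `r_a` in `ℛ` and `w_c` in `V₅ ⊗ 𝒪`. For `k ≥ 4` the only minor is the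
empty one, `1`, and `D_k(φ)` is empty. -/
def degeneracyIdeal (k : ℕ) : (BxP s).IdealSheafData :=
  sInf {J | ∀ (W' : B.affineOpens) (W : (BxP s).affineOpens) (h : W.1 ≤ BxP.toB s ⁻¹ᵁ W'.1),
    ∀ v ∈ tautLine (BxP.toPP s) W.1,
    ∀ r : Fin (4 - k) → (Pair → Γ(B, W')), (∀ a, r a ∈ (R.sections W').toSubmodule) →
    ∀ w : Fin (4 - k) → (Fin 5 → Γ(BxP s, W)),
      (Matrix.of fun a c ↦ ∑ j, contract (pullForm (BxP.toB s) h (r a)) v j * w c j).det ∈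
        J.ideal W}

/-- The locally closed subscheme `D_k(φ) ∖ D_{k+1}(φ)`: an open subscheme of the scheme `D_k(φ)`. -/
def stratumOpens (k : ℕ) : (degeneracyIdeal R s k).subscheme.Opens :=
  (degeneracyIdeal R s k).subschemeι ⁻¹ᵁ (degeneracyIdeal R s (k + 1)).support.compl

/-- The scheme `D_k(φ) ∖ D_{k+1}(φ)`. -/
abbrev Stratum (k : ℕ) : Scheme.{u} := (stratumOpens R s k).toScheme

/-- The immersion of `D_k(φ) ∖ D_{k+1}(φ)` in `B × ℙ(V₅)`. -/
abbrev Stratum.ι (k : ℕ) : Stratum R s k ⟶ BxP s :=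
  (stratumOpens R s k).ι ≫ (degeneracyIdeal R s k).subschemeι

/-- A morphism `g : E ⟶ S` of schemes, with `S` over the field `𝕜`, is a `ℙᵏ`-fibration: Zariski
locally on `S`, it is isomorphic to the projection `S × ℙᵏ ⟶ S`. -/
def IsProjectiveFibration (k : ℕ) {E S : Scheme.{u}} (g : E ⟶ S) (t : S ⟶ Spec (.of 𝕜)) : Prop :=
  ∀ x : S, ∃ W : S.Opens, x ∈ W ∧
    ∃ e : (g ⁻¹ᵁ W).toScheme ≅ pullback (W.ι ≫ t) (PP.toSpec (Fin (k + 1)) 𝕜),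
      e.hom ≫ pullback.fst _ _ = g ∣_ W

end Families

end QuinticFibration

end

noncomputable section

namespace QuinticFibration

/-! ### The coordinate ring of a standard chart of projective space -/

section ProjectiveCoordinates

attribute [local instance] MvPolynomial.gradedAlgebra

variable {ι : Type} {𝕜 : Type u} [Field 𝕜]

/-! Work locally on `B × ℙ(V₅)`, where the point of `ℙ(V₅)` is given by a vector `x` with `x_i = 1`
and `ℛ` is spanned by three forms `r_a`. A bivector `p` with `x ∧ p = 0` is `x ∧ u` for a unique `u`
with `u_i = 0`. It is then decomposable, and it is orthogonal to `ℛ` exactly when `N u = 0`, where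
`N = (r_a(x, e_l))`, `l ≠ i`, is the `3 × 4` matrix of the dual of `φ`. So `ℙ_ℳ(𝒰)` is locally the
projectivized kernel of `N` (`PMU.hom_ext`, `exists_PMU`, `isAffineOpen_PMU_chart`), while `D_k(φ)`
is cut out by the minors of `N` of order `4 - k`.

Let `m` be the vector of signed maximal minors of `N`; its entries generate the ideal of `D_1(φ)`.
Laplace expansion gives `N m = 0` (`sum_mul_signedMinor`), and Cramer's rule gives `m_j w_l = m_l
w_j` whenever `N w = 0` (`signedMinor_mul_comm`). If the inverse image of `D_1(φ)` in `T` is a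
Cartier divisor, then locally on `T` one has `m = a u` with `a` a nonzerodivisor and some entry of
`u` a unit. Cancelling `a` shows that `N u = 0`, so `u` defines a lift of `T` to `ℙ_ℳ(𝒰)`, and that
the vector of any other lift is a multiple of `u`. This is the universal property
(`existsUnique_lift_of_cartier`).

It remains to see that the inverse image of `D_1(φ)` in `ℙ_ℳ(𝒰)` is Cartier. On the chart `u_{l₀} =
1` the relations read `m_l = m_{l₀} u_l`, so the ideal is generated by `m_{l₀}`. The chart is the
spectrum of `A[X₁, X₂, X₃] / I` with `A` Cohen–Macaulay and `I` generated by three linear forms, and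
`m_{l₀}` has to be a nonzerodivisor there. Let `Q` be a prime containing `I`, lying over `q ⊆ A`,
and let `ρ` be the rank of `N` at `Q`. The forms account for height at least `ρ` in the fiber over
`q`, and if `ρ ≤ 2` the codimension assumption gives `q` height at least `4 - ρ`. Hence `Q` has
height at least `3`, and at least `4` if `m_{l₀} ∈ Q` (`height_of_linForm_mem`). Since `A[X₁, X₂,
X₃]` is Cohen–Macaulay, the three forms are locally a regular sequence and `I` has no associated
primes of height above `3`, so none of them contains `m_{l₀}` (`mem_span_linForm`).

On `D_k(φ) ∖ D_{k+1}(φ)` the minors of order `4 - k` vanish and locally one of order `3 - k` is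
invertible. The kernel of `N` is then free of rank `k + 1` and a direct summand
(`exists_kernel_matrices`), and its projectivization is the product with `ℙᵏ`
(`KernelFrame.exists_iso`). This half needs no assumption on codimension or singularities.

The argument is carried out on points with values in arbitrary schemes. The ideal sheaves defined as
infima represent the conditions defining them (`IsClosedLocus`), and maps to projective space are
locally vectors with an invertible entry (`Coord`). -/

theorem X_mem (i : ι) : (MvPolynomial.X i : MvPolynomial ι 𝕜) ∈ (MvPolynomial.homogeneousSubmodule
    ι 𝕜) 1 :=
  (MvPolynomial.mem_homogeneousSubmodule 1 _).2 (MvPolynomial.isHomogeneous_X 𝕜 i)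

/-- The element `x_j / x_i` of the homogeneous localization. -/
def awayRatio (i j : ι) : HomogeneousLocalization.Away (MvPolynomial.homogeneousSubmodule ι 𝕜)
    (MvPolynomial.X i) :=
  HomogeneousLocalization.Away.mk (MvPolynomial.homogeneousSubmodule ι 𝕜)
      ((MvPolynomial.mem_homogeneousSubmodule 1 _).2 (MvPolynomial.isHomogeneous_X 𝕜 i)) 1
      (MvPolynomial.X j)
      ((MvPolynomial.mem_homogeneousSubmodule _ _).2
        (by simpa using MvPolynomial.isHomogeneous_X 𝕜 j))

theorem ratio_eq (i j : ι) : PP.ratio 𝕜 i j =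
    (Proj.awayToSection (MvPolynomial.homogeneousSubmodule ι 𝕜) (MvPolynomial.X i)).hom (awayRatio
        i j) := rfl

/-- Constants in the homogeneous localization. -/
def awayConst (i : ι) : 𝕜 →+* HomogeneousLocalization.Away (MvPolynomial.homogeneousSubmodule ι 𝕜)
    (MvPolynomial.X i) :=
  (HomogeneousLocalization.fromZeroRingHom (MvPolynomial.homogeneousSubmodule ι 𝕜) _).comp
      (algebraMap 𝕜 ((MvPolynomial.homogeneousSubmodule ι 𝕜) 0))

theorem awayConst_val (i : ι) (c : 𝕜) : (awayConst i c).val =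
    algebraMap (MvPolynomial ι 𝕜) (Localization.Away (MvPolynomial.X i)) (MvPolynomial.C c) := by
  simp only [awayConst, RingHom.comp_apply, HomogeneousLocalization.fromZeroRingHom]
  erw [HomogeneousLocalization.val_mk]
  simp
  rfl

theorem awayRatio_val (i j : ι) : (awayRatio (𝕜 := 𝕜) i j).val =
    Localization.mk (MvPolynomial.X j) ⟨MvPolynomial.X i, Submonoid.mem_powers _⟩ := by
  rw [awayRatio, HomogeneousLocalization.Away.val_mk]
  congr 2
  simp

theorem X_mul_awayRatio_val (i j : ι) :
    algebraMap (MvPolynomial ι 𝕜) (Localization.Away (MvPolynomial.X i : MvPolynomial ι 𝕜))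
        (MvPolynomial.X i) * (awayRatio (𝕜 := 𝕜) i j).val =
      algebraMap (MvPolynomial ι 𝕜) _ (MvPolynomial.X j) := by
  rw [awayRatio_val, ← Localization.mk_one_eq_algebraMap, Localization.mk_mul,
    ← Localization.mk_one_eq_algebraMap, Localization.mk_eq_mk_iff, Localization.r_iff_exists]
  exact ⟨1, by simp⟩

/-- Two ring homomorphisms from the homogeneous localization agreeing on constants and on the
ratios are equal. -/
theorem away_hom_ext {S : Type*} [CommRing S] (i : ι)
    {f g : HomogeneousLocalization.Away (MvPolynomial.homogeneousSubmodule ι 𝕜) (MvPolynomial.X i)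
        →+* S}
    (h₀ : f.comp (awayConst i) = g.comp (awayConst i))
    (h : ∀ j, f (awayRatio i j) = g (awayRatio i j)) : f = g := by
  let φ : MvPolynomial ι 𝕜 →+* HomogeneousLocalization.Away (MvPolynomial.homogeneousSubmodule ι 𝕜)
      (MvPolynomial.X i) :=
    MvPolynomial.eval₂Hom (awayConst i) (awayRatio i)
  have key : f.comp φ = g.comp φ := by
    apply MvPolynomial.ringHom_ext
    · intro c; simpa [φ] using congr($h₀ c)
    · intro j; simpa [φ] using h j
  -- In a polynomial homogeneous of degree `n` each monomial absorbs exactly `n` factors `x_i`, so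
  -- `x_i ^ n p(x_j / x_i) = p`. Thus every fraction `p / x_i ^ n` is a polynomial in the ratios.
  have hφ : ∀ (n : ℕ) (p : MvPolynomial ι 𝕜), p.IsHomogeneous n →
      algebraMap (MvPolynomial ι 𝕜) (Localization.Away (MvPolynomial.X i)) (MvPolynomial.X i) ^ n *
        (φ p).val = algebraMap _ (Localization.Away (MvPolynomial.X i)) p := by
    intro n p hp
    have e1 : (φ p).val = p.eval₂ ((algebraMap (MvPolynomial ι 𝕜)
        (Localization.Away (MvPolynomial.X i))).comp MvPolynomial.C)
        (fun j ↦ (awayRatio (𝕜 := 𝕜) i j).val) := by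
      have : (algebraMap (HomogeneousLocalization.Away (MvPolynomial.homogeneousSubmodule ι 𝕜)
          (MvPolynomial.X i))
        (Localization.Away (MvPolynomial.X i))).comp φ = MvPolynomial.eval₂Hom
          ((algebraMap (MvPolynomial ι 𝕜) (Localization.Away (MvPolynomial.X i))).comp
            MvPolynomial.C) (fun j ↦ (awayRatio (𝕜 := 𝕜) i j).val) := by
        apply MvPolynomial.ringHom_ext
        · intro c
          simp [φ, HomogeneousLocalization.algebraMap_apply, awayConst_val]
        · intro j; simp [φ, HomogeneousLocalization.algebraMap_apply]
      exact congr($this p)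
    rw [e1, MvPolynomial.eval₂_eq, Finset.mul_sum]
    conv_rhs => rw [MvPolynomial.as_sum p, map_sum]
    refine Finset.sum_congr rfl fun d hd ↦ ?_
    have hdeg : d.degree = n := by
      by_contra hne
      exact (MvPolynomial.mem_support_iff.1 hd) (hp.coeff_eq_zero hne)
    rw [MvPolynomial.monomial_eq, map_mul, Finsupp.prod, map_prod, RingHom.comp_apply,
      mul_left_comm]
    congr 1
    rw [← hdeg, Finsupp.degree_apply, ← Finset.prod_pow_eq_pow_sum, ← Finset.prod_mul_distrib]
    refine Finset.prod_congr rfl fun j _ ↦ ?_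
    rw [← mul_pow, X_mul_awayRatio_val, map_pow]
  ext x
  obtain ⟨n, p, hp, rfl⟩ := HomogeneousLocalization.Away.mk_surjective
      (MvPolynomial.homogeneousSubmodule ι 𝕜) (X_mem i) x
  have : HomogeneousLocalization.Away.mk (MvPolynomial.homogeneousSubmodule ι 𝕜) (X_mem i) n p hp =
      φ p := by
    apply HomogeneousLocalization.val_injective
    have h1 := hφ n p (by simpa using (MvPolynomial.mem_homogeneousSubmodule _ _).1 hp)
    rw [HomogeneousLocalization.Away.val_mk, Localization.mk_eq_mk',
        IsLocalization.mk'_eq_iff_eq_mul,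
      mul_comm, ← h1, map_pow]
  rw [this]
  exact congr($key p)

/-- The ring homomorphism from the homogeneous localization given by the values of the ratios. -/
theorem exists_away_hom {S : Type*} [CommRing S] (i : ι) (c : 𝕜 →+* S) (s : ι → S) (hs : s i = 1) :
    ∃ f : HomogeneousLocalization.Away (MvPolynomial.homogeneousSubmodule ι 𝕜) (MvPolynomial.X i)
        →+* S,
      f.comp (awayConst i) = c ∧ ∀ j, f (awayRatio i j) = s j := by
  let e := MvPolynomial.eval₂Hom c s
  let l : Localization.Away (MvPolynomial.X i : MvPolynomial ι 𝕜) →+* S :=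
    IsLocalization.Away.lift (MvPolynomial.X i) (g := e) (by simp [e, hs])
  refine ⟨l.comp (algebraMap (HomogeneousLocalization.Away (MvPolynomial.homogeneousSubmodule ι 𝕜)
      (MvPolynomial.X i)) _), ?_, ?_⟩
  · ext x
    simp [HomogeneousLocalization.algebraMap_apply, awayConst_val, l, e]
  · intro j
    have := congr(l $(X_mul_awayRatio_val i j))
    simpa [HomogeneousLocalization.algebraMap_apply, l, e, hs] using this

end ProjectiveCoordinates

/-! ### Global sections under composition, and maps to affine schemes -/

section Sections

variable {X Y Z : Scheme.{u}}

theorem top_le_comp {g : Y ⟶ Z} (f : X ⟶ Y) {U : Z.Opens} (h : ⊤ ≤ g ⁻¹ᵁ U) :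
    ⊤ ≤ (f ≫ g) ⁻¹ᵁ U := fun x _ ↦ h (x := f x) trivial

theorem appTop_eq_appLE (f : X ⟶ Y) (h : ⊤ ≤ f ⁻¹ᵁ ⊤) : f.appTop = f.appLE ⊤ ⊤ h :=
  f.app_eq_appLE

theorem appLE_comp_appTop (f : X ⟶ Y) (g : Y ⟶ Z) (U : Z.Opens) (h : ⊤ ≤ g ⁻¹ᵁ U)
    (h' : ⊤ ≤ (f ≫ g) ⁻¹ᵁ U) :
    g.appLE U ⊤ h ≫ f.appTop = (f ≫ g).appLE U ⊤ h' := by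
  have hf : ⊤ ≤ f ⁻¹ᵁ ⊤ := fun _ _ ↦ trivial
  rw [appTop_eq_appLE f hf, Scheme.Hom.appLE_comp_appLE]

theorem appTop_appLE_apply (f : X ⟶ Y) (g : Y ⟶ Z) (U : Z.Opens) (h : ⊤ ≤ g ⁻¹ᵁ U)
    (h' : ⊤ ≤ (f ≫ g) ⁻¹ᵁ U) (x : Γ(Z, U)) :
    f.appTop.hom ((g.appLE U ⊤ h).hom x) = ((f ≫ g).appLE U ⊤ h').hom x :=
  congr(($(appLE_comp_appTop f g U h h')).hom x)

theorem toSpecΓ_specMap_appTop {R : CommRingCat.{u}} (l : X ⟶ Spec R) :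
    X.toSpecΓ ≫ Spec.map ((Scheme.ΓSpecIso R).inv ≫ l.appTop) = l := by
  rw [Spec.map_comp, ← Scheme.toSpecΓ_naturality_assoc, toSpecΓ_SpecMap_ΓSpecIso_inv,
    Category.comp_id]

theorem appTop_toSpecΓ_specMap {R : CommRingCat.{u}} (φ : R ⟶ Γ(X, ⊤)) :
    (Scheme.ΓSpecIso R).inv ≫ (X.toSpecΓ ≫ Spec.map φ).appTop = φ := by
  rw [Scheme.Hom.comp_appTop, Scheme.toSpecΓ_appTop, ← Scheme.ΓSpecIso_inv_naturality_assoc,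
    Iso.inv_hom_id, Category.comp_id]

end Sections

/-! ### Morphisms into a chart of projective space -/

section ProjectivePoints

attribute [local instance] MvPolynomial.gradedAlgebra

variable {ι : Type} {𝕜 : Type u} [Field 𝕜]

/-- The affine chart of projective space where the `i`-th coordinate is invertible. -/
abbrev PP.awayι (i : ι) :
    Spec (.of (HomogeneousLocalization.Away (MvPolynomial.homogeneousSubmodule ι 𝕜)
      (MvPolynomial.X i))) ⟶ PP ι 𝕜 :=
  Proj.awayι (MvPolynomial.homogeneousSubmodule ι 𝕜) (MvPolynomial.X i) (X_mem i) one_pos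

theorem PP.opensRange_awayι (i : ι) : (PP.awayι (𝕜 := 𝕜) i).opensRange = PP.chart 𝕜 i :=
  Proj.opensRange_awayι _ _ _ _

theorem PP.top_le_awayι (i : ι) : ⊤ ≤ PP.awayι (𝕜 := 𝕜) i ⁻¹ᵁ PP.chart 𝕜 i := by
  rw [← PP.opensRange_awayι]
  simp

/-- Matches the two descriptions of functions on a chart: sections of the sheaf on `Proj`, in which
`PP.ratio` is written, and elements of the homogeneous localization, out of which ring maps are
built. -/
theorem PP.awayToSection_appLE (i : ι) :
    Proj.awayToSection (MvPolynomial.homogeneousSubmodule ι 𝕜) (MvPolynomial.X i) ≫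
      (PP.awayι (𝕜 := 𝕜) i).appLE (PP.chart 𝕜 i) ⊤ (PP.top_le_awayι i) =
    (Scheme.ΓSpecIso _).inv := by
  let e := Proj.basicOpenIsoSpec (MvPolynomial.homogeneousSubmodule ι 𝕜) (MvPolynomial.X i)
    (X_mem i) one_pos
  have he : e.hom.appTop = (Scheme.ΓSpecIso _).hom ≫
      Proj.awayToSection (MvPolynomial.homogeneousSubmodule ι 𝕜) (MvPolynomial.X i) ≫
      (PP.chart 𝕜 i).topIso.inv :=
    Proj.basicOpenToSpec_app_top (MvPolynomial.homogeneousSubmodule ι 𝕜) (MvPolynomial.X i)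
  have : IsIso e.hom.appTop := inferInstanceAs (IsIso (e.hom.app ⊤))
  rw [← cancel_mono e.hom.appTop]
  have h1 : (PP.awayι (𝕜 := 𝕜) i).appLE (PP.chart 𝕜 i) ⊤ (PP.top_le_awayι i) ≫ e.hom.appTop =
      (PP.chart 𝕜 i).topIso.inv := by
    rw [appLE_comp_appTop _ _ _ _ (top_le_comp _ (PP.top_le_awayι i))]
    have : e.hom ≫ PP.awayι i = (PP.chart 𝕜 i).ι := by
      simp [e, PP.awayι, Proj.awayι]
    simp only [this]
    rw [Scheme.Opens.ι_appLE]
    rfl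
  rw [Category.assoc, h1, he]
  simp

/-- The structure of a morphism to projective space landing in a chart. -/
theorem PP.exists_ringHom {Y : Scheme.{u}} (g : Y ⟶ PP ι 𝕜) (i : ι)
    (h : ⊤ ≤ g ⁻¹ᵁ PP.chart 𝕜 i) :
    ∃ φ : HomogeneousLocalization.Away (MvPolynomial.homogeneousSubmodule ι 𝕜)
      (MvPolynomial.X i) →+* Γ(Y, ⊤), g = Y.toSpecΓ ≫ Spec.map (CommRingCat.ofHom φ) ≫ PP.awayι i
          := by
  let l : Y ⟶ _ := IsOpenImmersion.lift (PP.awayι i) g (by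
    rw [← Scheme.Hom.coe_opensRange (PP.awayι i), PP.opensRange_awayι]
    rintro _ ⟨y, rfl⟩
    exact h (Set.mem_univ y))
  have hl : l ≫ PP.awayι i = g := IsOpenImmersion.lift_fac _ _ _
  refine ⟨((Scheme.ΓSpecIso _).inv ≫ l.appTop).hom, ?_⟩
  rw [← hl, CommRingCat.ofHom_hom, ← Category.assoc, toSpecΓ_specMap_appTop]

theorem PP.ofRingHom_toSpec {Y : Scheme.{u}} (i : ι)
    (φ : HomogeneousLocalization.Away (MvPolynomial.homogeneousSubmodule ι 𝕜)
      (MvPolynomial.X i) →+* Γ(Y, ⊤)) :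
    (Y.toSpecΓ ≫ Spec.map (CommRingCat.ofHom φ) ≫ PP.awayι i) ≫ PP.toSpec ι 𝕜 =
      Y.toSpecΓ ≫ Spec.map (CommRingCat.ofHom (φ.comp (awayConst i))) := by
  simp only [PP.toSpec, Category.assoc, PP.awayι, Proj.awayι_toSpecZero_assoc, awayConst,
    CommRingCat.ofHom_comp, Spec.map_comp]

theorem PP.top_le_ofRingHom {Y : Scheme.{u}} (i : ι)
    (φ : HomogeneousLocalization.Away (MvPolynomial.homogeneousSubmodule ι 𝕜)
      (MvPolynomial.X i) →+* Γ(Y, ⊤)) :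
    ⊤ ≤ (Y.toSpecΓ ≫ Spec.map (CommRingCat.ofHom φ) ≫ PP.awayι i) ⁻¹ᵁ PP.chart 𝕜 i := by
  rw [← Category.assoc]
  exact top_le_comp _ (PP.top_le_awayι i)

theorem PP.ofRingHom_ratio {Y : Scheme.{u}} (i j : ι)
    (φ : HomogeneousLocalization.Away (MvPolynomial.homogeneousSubmodule ι 𝕜)
      (MvPolynomial.X i) →+* Γ(Y, ⊤))
    (h : ⊤ ≤ (Y.toSpecΓ ≫ Spec.map (CommRingCat.ofHom φ) ≫ PP.awayι i) ⁻¹ᵁ PP.chart 𝕜 i) :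
    ((Y.toSpecΓ ≫ Spec.map (CommRingCat.ofHom φ) ≫ PP.awayι i).appLE (PP.chart 𝕜 i) ⊤ h).hom
      (PP.ratio 𝕜 i j) = φ (awayRatio i j) := by
  have h1 : (Y.toSpecΓ ≫ Spec.map (CommRingCat.ofHom φ) ≫ PP.awayι i).appLE (PP.chart 𝕜 i) ⊤ h =
      (PP.awayι (𝕜 := 𝕜) i).appLE (PP.chart 𝕜 i) ⊤ (PP.top_le_awayι i) ≫
        (Y.toSpecΓ ≫ Spec.map (CommRingCat.ofHom φ)).appTop := by
    rw [appLE_comp_appTop _ _ _ _ (by simpa using h)]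
    simp
  have h2 : Proj.awayToSection (MvPolynomial.homogeneousSubmodule ι 𝕜) (MvPolynomial.X i) ≫
      (Y.toSpecΓ ≫ Spec.map (CommRingCat.ofHom φ) ≫ PP.awayι i).appLE (PP.chart 𝕜 i) ⊤ h =
      CommRingCat.ofHom φ := by
    rw [h1, reassoc_of% (PP.awayToSection_appLE (𝕜 := 𝕜) i),
      appTop_toSpecΓ_specMap]
  rw [ratio_eq]
  exact congr(($h2).hom (awayRatio i j))

/-- Such a morphism is a ring map out of the homogeneous localization, and `away_hom_ext` says that
this is determined by its values on scalars and ratios. -/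
theorem PP.hom_ext {Y : Scheme.{u}} {g g' : Y ⟶ PP ι 𝕜} (i : ι) (h : ⊤ ≤ g ⁻¹ᵁ PP.chart 𝕜 i)
    (h' : ⊤ ≤ g' ⁻¹ᵁ PP.chart 𝕜 i) (h₀ : g ≫ PP.toSpec ι 𝕜 = g' ≫ PP.toSpec ι 𝕜)
    (H : ∀ j, (g.appLE (PP.chart 𝕜 i) ⊤ h).hom (PP.ratio 𝕜 i j) =
      (g'.appLE (PP.chart 𝕜 i) ⊤ h').hom (PP.ratio 𝕜 i j)) : g = g' := by
  obtain ⟨φ, rfl⟩ := PP.exists_ringHom g i h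
  obtain ⟨φ', rfl⟩ := PP.exists_ringHom g' i h'
  simp only [PP.ofRingHom_ratio] at H
  simp only [PP.ofRingHom_toSpec] at h₀
  have : φ.comp (awayConst i) = φ'.comp (awayConst i) := by
    have := congr(((Scheme.ΓSpecIso _).inv ≫ ($h₀).appTop).hom)
    simpa only [appTop_toSpecΓ_specMap, CommRingCat.hom_ofHom] using this
  rw [away_hom_ext i this H]

theorem PP.exists_hom {Y : Scheme.{u}} (t : Y ⟶ Spec (.of 𝕜)) (i : ι) (s : ι → Γ(Y, ⊤))
    (hs : s i = 1) : ∃ g : Y ⟶ PP ι 𝕜, g ≫ PP.toSpec ι 𝕜 = t ∧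
      ∃ h : ⊤ ≤ g ⁻¹ᵁ PP.chart 𝕜 i,
        ∀ j, (g.appLE (PP.chart 𝕜 i) ⊤ h).hom (PP.ratio 𝕜 i j) = s j := by
  obtain ⟨φ, h1, h2⟩ := exists_away_hom i ((Scheme.ΓSpecIso (.of 𝕜)).inv ≫ t.appTop).hom s hs
  refine ⟨Y.toSpecΓ ≫ Spec.map (CommRingCat.ofHom φ) ≫ PP.awayι i, ?_, PP.top_le_ofRingHom i φ, ?_⟩
  · rw [PP.ofRingHom_toSpec, h1, CommRingCat.ofHom_hom, toSpecΓ_specMap_appTop]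
  · intro j
    rw [PP.ofRingHom_ratio, h2]

end ProjectivePoints

/-! ### The cover by charts and the cocycle of ratios -/

section ProjectiveRatios

attribute [local instance] MvPolynomial.gradedAlgebra

variable {ι : Type} {𝕜 : Type u} [Field 𝕜]

theorem PP.ratio_self (i : ι) : PP.ratio 𝕜 i i = 1 := by
  have : awayRatio (𝕜 := 𝕜) i i = 1 := by
    apply HomogeneousLocalization.val_injective
    rw [awayRatio_val, HomogeneousLocalization.val_one]
    exact Localization.mk_self (⟨MvPolynomial.X i, Submonoid.mem_powers _⟩ :
      Submonoid.powers (MvPolynomial.X i : MvPolynomial ι 𝕜))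
  rw [ratio_eq, this, map_one]

/-- The variables generate the polynomial ring as an algebra over its degree zero part, which is the
criterion for their basic open sets to cover `Proj`. -/
theorem PP.exists_mem_chart (x : PP ι 𝕜) : ∃ i, x ∈ PP.chart 𝕜 i := by
  have h := Proj.iSup_basicOpen_eq_top' (MvPolynomial.homogeneousSubmodule ι 𝕜)
    (fun i : ι ↦ (MvPolynomial.X i)) (fun i ↦ ⟨1, X_mem i⟩) (by
      rw [eq_top_iff]
      intro p _
      have hp : p ∈ Algebra.adjoin 𝕜 (Set.range fun i : ι ↦ (MvPolynomial.X i : MvPolynomial ι 𝕜))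
          := by
        have : Algebra.adjoin 𝕜 (Set.range fun i : ι ↦ (MvPolynomial.X i : MvPolynomial ι 𝕜)) = ⊤ :=
          MvPolynomial.adjoin_range_X
        rw [this]; trivial
      refine Algebra.adjoin_induction (fun x hx ↦ Algebra.subset_adjoin hx) (fun r ↦ ?_)
        (fun _ _ _ _ h h' ↦ add_mem h h') (fun _ _ _ _ h h' ↦ mul_mem h h') hp
      exact Subalgebra.algebraMap_mem _
        (algebraMap 𝕜 (MvPolynomial.homogeneousSubmodule ι 𝕜 0) r))
  have hx : x ∈ ⨆ i, PP.chart 𝕜 i := by rw [h]; trivial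
  exact TopologicalSpace.Opens.mem_iSup.1 hx

theorem PP.basicOpen_ratio_le (i j : ι) :
    (PP ι 𝕜).basicOpen (PP.ratio 𝕜 i j) ≤ PP.chart 𝕜 j := by
  intro x hx
  have hxi : x ∈ PP.chart 𝕜 i := (PP ι 𝕜).basicOpen_le _ hx
  have hxi' : x ∈ (PP.awayι (𝕜 := 𝕜) i).opensRange := by rwa [PP.opensRange_awayι]
  obtain ⟨z, rfl⟩ := hxi'
  have h := Proj.awayι_preimage_basicOpen (MvPolynomial.homogeneousSubmodule ι 𝕜) (X_mem i)
    one_pos (X_mem (𝕜 := 𝕜) j) one_pos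
  have hz : z ∈ PP.awayι (𝕜 := 𝕜) i ⁻¹ᵁ (PP ι 𝕜).basicOpen (PP.ratio 𝕜 i j) := hx
  have h1 : PP.awayι (𝕜 := 𝕜) i ⁻¹ᵁ (PP ι 𝕜).basicOpen (PP.ratio 𝕜 i j) =
      (Spec _).basicOpen (((PP.awayι (𝕜 := 𝕜) i).appLE (PP.chart 𝕜 i) ⊤ (PP.top_le_awayι i)).hom
        (PP.ratio 𝕜 i j)) := by
    rw [Scheme.basicOpen_appLE]
    simp
  have h2 := congr(($(PP.awayToSection_appLE (𝕜 := 𝕜) i)).hom (awayRatio i j))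
  rw [h1, ratio_eq] at hz
  erw [h2] at hz
  erw [basicOpen_eq_of_affine] at hz
  have hz' : z ∈ PP.awayι (𝕜 := 𝕜) i ⁻¹ᵁ PP.chart 𝕜 j := by
    erw [h]
    convert hz
    apply HomogeneousLocalization.val_injective
    rw [awayRatio_val]
    erw [HomogeneousLocalization.Away.val_mk]
    simp
  exact hz'

/-- Sections of the structure sheaf of `Proj` are functions on points with values in local rings of
fractions, so the identity can be checked pointwise on fractions. -/
theorem PP.ratio_mul_ratio (i i' j : ι) :
    ((PP ι 𝕜).presheaf.map (homOfLE (inf_le_left : PP.chart 𝕜 i ⊓ PP.chart 𝕜 i' ≤ _)).op).hom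
      (PP.ratio 𝕜 i j) =
    ((PP ι 𝕜).presheaf.map (homOfLE (inf_le_left : PP.chart 𝕜 i ⊓ PP.chart 𝕜 i' ≤ _)).op).hom
      (PP.ratio 𝕜 i i') *
    ((PP ι 𝕜).presheaf.map (homOfLE (inf_le_right : PP.chart 𝕜 i ⊓ PP.chart 𝕜 i' ≤ _)).op).hom
      (PP.ratio 𝕜 i' j) := by
  apply Subtype.ext
  funext ⟨x, hx⟩
  have hp : x.asHomogeneousIdeal.toIdeal.IsPrime := x.isPrime
  change HomogeneousLocalization.mapId _ (Submonoid.powers_le.mpr (show MvPolynomial.X i ∈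
      x.asHomogeneousIdeal.toIdeal.primeCompl from hx.1)) (awayRatio i j) =
    HomogeneousLocalization.mapId _ (Submonoid.powers_le.mpr (show MvPolynomial.X i ∈
      x.asHomogeneousIdeal.toIdeal.primeCompl from hx.1)) (awayRatio i i') *
    HomogeneousLocalization.mapId _ (Submonoid.powers_le.mpr (show MvPolynomial.X i' ∈
      x.asHomogeneousIdeal.toIdeal.primeCompl from hx.2)) (awayRatio i' j)
  apply HomogeneousLocalization.val_injective
  rw [HomogeneousLocalization.val_mul]
  change Localization.mk _ _ = Localization.mk _ _ * Localization.mk _ _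
  rw [Localization.mk_mul, Localization.mk_eq_mk_iff, Localization.r_iff_exists]
  refine ⟨1, ?_⟩
  simp only [OneMemClass.coe_one, one_mul, Submonoid.coe_mul, pow_one]
  ring

end ProjectiveRatios

/-! ### Equality of sections is local; restriction and pullback -/

section LocalSections

variable {X Y : Scheme.{u}}

theorem section_eq_of_locally {W : Y.Opens} {a b : Γ(Y, W)}
    (H : ∀ y ∈ W, ∃ (V : Y.Opens) (h : V ≤ W), y ∈ V ∧
      (Y.presheaf.map (homOfLE h).op).hom a = (Y.presheaf.map (homOfLE h).op).hom b) : a = b := by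
  apply Y.IsSheaf.section_ext
  intro y hy
  obtain ⟨V, h, hyV, e⟩ := H y hy
  exact ⟨V, h, hyV, e⟩

theorem section_eq_of_locally_top {a b : Γ(Y, ⊤)}
    (H : ∀ y, ∃ V : Y.Opens, y ∈ V ∧ V.ι.appTop.hom a = V.ι.appTop.hom b) : a = b := by
  apply section_eq_of_locally
  intro y _
  obtain ⟨V, hy, e⟩ := H y
  refine ⟨V, le_top, hy, ?_⟩
  have := congr((V.topIso.hom).hom $e)
  have h : V.ι.appTop ≫ V.topIso.hom = Y.presheaf.map (homOfLE (le_top : V ≤ ⊤)).op := by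
    rw [Scheme.Hom.appTop, Scheme.Opens.ι_app, Scheme.Opens.topIso_hom]
    exact (Functor.map_comp _ _ _).symm
  rw [← h]
  exact this

theorem map_appLE_apply (f : X ⟶ Y) {U U' : Y.Opens} {V : X.Opens} (e : V ≤ f ⁻¹ᵁ U)
    (i : U ≤ U') (e' : V ≤ f ⁻¹ᵁ U') (x : Γ(Y, U')) :
    (f.appLE U V e).hom ((Y.presheaf.map (homOfLE i).op).hom x) = (f.appLE U' V e').hom x :=
  congr(($(f.map_appLE e (homOfLE i).op)).hom x)

theorem appLE_map_apply (f : X ⟶ Y) {U : Y.Opens} {V V' : X.Opens} (e : V ≤ f ⁻¹ᵁ U)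
    (i : V' ≤ V) (e' : V' ≤ f ⁻¹ᵁ U) (x : Γ(Y, U)) :
    (X.presheaf.map (homOfLE i).op).hom ((f.appLE U V e).hom x) = (f.appLE U V' e').hom x :=
  congr(($(f.appLE_map e (homOfLE i).op)).hom x)

theorem appLE_appLE_apply {Z : Scheme.{u}} (f : X ⟶ Y) (g : Y ⟶ Z) {U : Z.Opens} {V : Y.Opens}
    {W : X.Opens} (e₁ : V ≤ g ⁻¹ᵁ U) (e₂ : W ≤ f ⁻¹ᵁ V) (e : W ≤ (f ≫ g) ⁻¹ᵁ U) (x : Γ(Z, U)) :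
    (f.appLE V W e₂).hom ((g.appLE U V e₁).hom x) = ((f ≫ g).appLE U W e).hom x :=
  congr(($(Scheme.Hom.appLE_comp_appLE f g U V W e₁ e₂)).hom x)

theorem map_map_apply {U V W : Y.Opens} (i : V ≤ U) (j : W ≤ V) (k : W ≤ U) (x : Γ(Y, U)) :
    (Y.presheaf.map (homOfLE j).op).hom ((Y.presheaf.map (homOfLE i).op).hom x) =
      (Y.presheaf.map (homOfLE k).op).hom x := by
  rw [← CommRingCat.comp_apply, ← Functor.map_comp]
  rfl

end LocalSections

/-! ### Homogeneous coordinates and the tautological line -/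

section TautLine

variable {ι : Type} {𝕜 : Type u} [Field 𝕜] {T Y : Scheme.{u}}

theorem tautLine_pullback (g : Y ⟶ PP ι 𝕜) (h : T ⟶ Y) {W : Y.Opens} {V : T.Opens}
    (e : V ≤ h ⁻¹ᵁ W) {s : ι → Γ(Y, W)} (hs : s ∈ tautLine g W) :
    (fun j ↦ (h.appLE W V e).hom (s j)) ∈ tautLine (h ≫ g) V := by
  intro i j
  have e' : V ⊓ (h ≫ g) ⁻¹ᵁ PP.chart 𝕜 i ≤ h ⁻¹ᵁ (W ⊓ g ⁻¹ᵁ PP.chart 𝕜 i) :=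
    fun t ht ↦ ⟨e ht.1, ht.2⟩
  have := congr((h.appLE _ _ e').hom $(hs i j))
  rw [map_mul, map_appLE_apply h e' inf_le_left (inf_le_left.trans e),
    map_appLE_apply h e' inf_le_left (inf_le_left.trans e),
    appLE_appLE_apply h g inf_le_right e' inf_le_right] at this
  rw [appLE_map_apply h e inf_le_left (inf_le_left.trans e),
    appLE_map_apply h e inf_le_left (inf_le_left.trans e), this]

theorem tautLine_restrict (g : Y ⟶ PP ι 𝕜) {W V : Y.Opens} (e : V ≤ W) {s : ι → Γ(Y, W)}
    (hs : s ∈ tautLine g W) :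
    (fun j ↦ (Y.presheaf.map (homOfLE e).op).hom (s j)) ∈ tautLine g V := by
  intro i j
  have := congr((Y.presheaf.map (homOfLE (inf_le_inf_right (g ⁻¹ᵁ PP.chart 𝕜 i) e)).op).hom
    $(hs i j))
  rw [map_mul, map_map_apply _ _ (inf_le_left.trans e), map_map_apply _ _ (inf_le_left.trans e),
    appLE_map_apply _ _ _ inf_le_right] at this
  rw [map_map_apply _ _ (inf_le_left.trans e), map_map_apply _ _ (inf_le_left.trans e), this]

theorem tautLine_apply (g : Y ⟶ PP ι 𝕜) {W : Y.Opens} {s : ι → Γ(Y, W)} (hs : s ∈ tautLine g W)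
    (i : ι) (h : W ≤ g ⁻¹ᵁ PP.chart 𝕜 i) (j : ι) :
    s j = s i * (g.appLE (PP.chart 𝕜 i) W h).hom (PP.ratio 𝕜 i j) := by
  have h1 : W ≤ W ⊓ g ⁻¹ᵁ PP.chart 𝕜 i := le_inf le_rfl h
  have := congr((Y.presheaf.map (homOfLE h1).op).hom $(hs i j))
  rw [map_mul, map_map_apply _ _ le_rfl, map_map_apply _ _ le_rfl,
    appLE_map_apply _ _ _ h] at this
  simpa using this

theorem ratio_mem_tautLine (g : Y ⟶ PP ι 𝕜) {W : Y.Opens} (i : ι)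
    (h : W ≤ g ⁻¹ᵁ PP.chart 𝕜 i) :
    (fun j ↦ (g.appLE (PP.chart 𝕜 i) W h).hom (PP.ratio 𝕜 i j)) ∈ tautLine g W := by
  intro i' j
  have e : W ⊓ g ⁻¹ᵁ PP.chart 𝕜 i' ≤ g ⁻¹ᵁ (PP.chart 𝕜 i ⊓ PP.chart 𝕜 i') :=
    fun y hy ↦ ⟨h hy.1, hy.2⟩
  have := congr((g.appLE _ _ e).hom $(PP.ratio_mul_ratio (𝕜 := 𝕜) i i' j))
  rw [map_mul, map_appLE_apply _ e _ (inf_le_left.trans h),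
    map_appLE_apply _ e _ (inf_le_left.trans h), map_appLE_apply _ e _ inf_le_right] at this
  rw [appLE_map_apply _ _ _ (inf_le_left.trans h), appLE_map_apply _ _ _ (inf_le_left.trans h),
    this]

/-- On each chart both vectors are multiples of the vector of ratios. -/
theorem tautLine_mul_comm (g : Y ⟶ PP ι 𝕜) {W : Y.Opens} {s s' : ι → Γ(Y, W)}
    (hs : s ∈ tautLine g W) (hs' : s' ∈ tautLine g W) (j l : ι) : s j * s' l = s l * s' j := by
  apply section_eq_of_locally
  intro y hy
  obtain ⟨i, hi⟩ := PP.exists_mem_chart (g y)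
  refine ⟨W ⊓ g ⁻¹ᵁ PP.chart 𝕜 i, inf_le_left, ⟨hy, hi⟩, ?_⟩
  simp only [map_mul]
  rw [hs i j, hs i l, hs' i j, hs' i l]
  ring

/-- The morphism `g` to projective space is given by the homogeneous coordinates `s`, of which the
`i`-th is invertible. -/
structure Coord (g : Y ⟶ PP ι 𝕜) (i : ι) (s : ι → Γ(Y, ⊤)) : Prop where
  isUnit : IsUnit (s i)
  mem : s ∈ tautLine g ⊤

namespace Coord

variable {g g' : Y ⟶ PP ι 𝕜} {i : ι} {s s' : ι → Γ(Y, ⊤)}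

/-- On the `j`-th chart the unit `s i` equals `s j` times the ratio `x_i / x_j`, so this ratio is
invertible and `PP.basicOpen_ratio_le` applies. -/
theorem top_le (h : Coord g i s) : ⊤ ≤ g ⁻¹ᵁ PP.chart 𝕜 i := by
  intro y _
  obtain ⟨j, hj⟩ := PP.exists_mem_chart (g y)
  have e := h.mem j i
  set V : Y.Opens := ⊤ ⊓ g ⁻¹ᵁ PP.chart 𝕜 j
  have hu := h.isUnit.map (Y.presheaf.map (homOfLE (inf_le_left : V ≤ ⊤)).op).hom
  rw [e] at hu
  have hu' := isUnit_of_mul_isUnit_right hu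
  have hV : V ≤ Y.basicOpen ((g.appLE (PP.chart 𝕜 j) V inf_le_right).hom (PP.ratio 𝕜 j i)) :=
    (Y.basicOpen_of_isUnit hu').ge
  have hy : y ∈ V := ⟨trivial, hj⟩
  have := hV hy
  rw [Scheme.basicOpen_appLE] at this
  exact PP.basicOpen_ratio_le j i this.2

theorem change (h : Coord g i s) {j : ι} (hj : IsUnit (s j)) : Coord g j s := ⟨hj, h.mem⟩

theorem smul (h : Coord g i s) {c : Γ(Y, ⊤)} (hc : IsUnit c) : Coord g i (c • s) :=
  ⟨hc.mul h.isUnit, (tautLine g ⊤).smul_mem c h.mem⟩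

theorem comp (h : Coord g i s) (f : T ⟶ Y) : Coord (f ≫ g) i (fun j ↦ f.appTop.hom (s j)) := by
  refine ⟨h.isUnit.map f.appTop.hom, ?_⟩
  have hf : ⊤ ≤ f ⁻¹ᵁ ⊤ := fun _ _ ↦ trivial
  rw [appTop_eq_appLE f hf]
  exact tautLine_pullback g f hf h.mem

theorem hom_ext (h : Coord g i s) (h' : Coord g' i s)
    (h₀ : g ≫ PP.toSpec ι 𝕜 = g' ≫ PP.toSpec ι 𝕜) : g = g' := by
  refine PP.hom_ext i h.top_le h'.top_le h₀ fun j ↦ ?_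
  have e := tautLine_apply g h.mem i h.top_le j
  rw [tautLine_apply g' h'.mem i h'.top_le j] at e
  exact (h.isUnit.mul_left_cancel e).symm

theorem mul_comm (h : Coord g i s) (h' : s' ∈ tautLine g ⊤) (j l : ι) : s j * s' l = s l * s' j :=
  tautLine_mul_comm g h.mem h' j l

/-- A vector proportional to the coordinates is in the tautological line. -/
theorem mem_of_mul_comm (h : Coord g i s) (h' : ∀ j, s i * s' j = s j * s' i) :
    s' ∈ tautLine g ⊤ := by
  obtain ⟨c, hc⟩ := h.isUnit.exists_left_inv
  have : s' = (c * s' i) • s := by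
    funext j
    simp only [Pi.smul_apply, smul_eq_mul]
    linear_combination (-s' j) * hc + c * h' j
  rw [this]
  exact Submodule.smul_mem _ _ h.mem

theorem of_mul_comm (h : Coord g i s) {j : ι} (hj : IsUnit (s' j))
    (h' : ∀ j, s i * s' j = s j * s' i) : Coord g j s' :=
  ⟨hj, h.mem_of_mul_comm h'⟩

/-- The form in which points are compared later: proportional coordinate vectors give the same
morphism, whichever entries are known to be units. -/
theorem hom_ext' {i' : ι} (h : Coord g i s) (h' : Coord g' i' s')
    (h₀ : g ≫ PP.toSpec ι 𝕜 = g' ≫ PP.toSpec ι 𝕜)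
    (H : ∀ j, s i * s' j = s j * s' i) : g = g' :=
  (h.of_mul_comm h'.isUnit H).hom_ext h' h₀

end Coord

theorem exists_coord (t : Y ⟶ Spec (.of 𝕜)) (i : ι) (s : ι → Γ(Y, ⊤)) (hs : IsUnit (s i)) :
    ∃ g : Y ⟶ PP ι 𝕜, g ≫ PP.toSpec ι 𝕜 = t ∧ Coord g i s := by
  obtain ⟨c, hc⟩ := hs.exists_left_inv
  obtain ⟨g, hg, h, e⟩ := PP.exists_hom t i (c • s) (by simpa using hc)
  refine ⟨g, hg, hs, ?_⟩
  have := ratio_mem_tautLine g i h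
  simp only [e] at this
  have h2 := (tautLine g ⊤).smul_mem (s i) this
  convert h2 using 1
  funext j
  simp only [Pi.smul_apply, smul_eq_mul]
  linear_combination (-s j) * hc

theorem coord_of_top_le (g : Y ⟶ PP ι 𝕜) {i : ι} (h : ⊤ ≤ g ⁻¹ᵁ PP.chart 𝕜 i) :
    ∃ s, s i = 1 ∧ Coord g i s := by
  have hi : (g.appLE (PP.chart 𝕜 i) ⊤ h).hom (PP.ratio 𝕜 i i) = 1 := by
    rw [PP.ratio_self, map_one]
  exact ⟨_, hi, by rw [hi]; exact isUnit_one, ratio_mem_tautLine g i h⟩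

theorem ι_top_le {g : Y ⟶ T} {U : T.Opens} {V : Y.Opens} (h : V ≤ g ⁻¹ᵁ U) :
    ⊤ ≤ (V.ι ≫ g) ⁻¹ᵁ U := fun y _ ↦ h y.2

theorem exists_coord_of_le (g : Y ⟶ PP ι 𝕜) {i : ι} {V : Y.Opens} (h : V ≤ g ⁻¹ᵁ PP.chart 𝕜 i) :
    ∃ s, s i = 1 ∧ Coord (V.ι ≫ g) i s :=
  coord_of_top_le _ (ι_top_le h)

end TautLine

/-! ### Gluing morphisms -/

section Gluing

/-- Morphisms characterized by a property which is stable under base change and determines them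
can be glued. -/
theorem exists_glue {T G : Scheme.{u}} (Q : ∀ ⦃T' : Scheme.{u}⦄, (T' ⟶ T) → (T' ⟶ G) → Prop)
    (hcomp : ∀ ⦃T' T'' : Scheme.{u}⦄ (k : T'' ⟶ T') [IsOpenImmersion k] (j : T' ⟶ T) (y : T' ⟶ G),
      Q j y → Q (k ≫ j) (k ≫ y))
    (huniq : ∀ ⦃T' : Scheme.{u}⦄ (j : T' ⟶ T) [IsOpenImmersion j] (y y' : T' ⟶ G), Q j y → Q j y' →
        y = y')
    (hloc : ∀ t : T, ∃ V : T.Opens, t ∈ V ∧ ∃ y : V.toScheme ⟶ G, Q V.ι y) :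
    ∃ y : T ⟶ G, ∀ t : T, ∃ V : T.Opens, t ∈ V ∧ Q V.ι (V.ι ≫ y) := by
  choose V hV y hy using hloc
  have hcov : TopologicalSpace.IsOpenCover V := by
    rw [TopologicalSpace.IsOpenCover, eq_top_iff]
    intro t _
    exact TopologicalSpace.Opens.mem_iSup.2 ⟨t, hV t⟩
  let 𝒰 := T.openCoverOfIsOpenCover V hcov
  have hglue : ∀ a b : T, pullback.fst (V a).ι (V b).ι ≫ y a = pullback.snd _ _ ≫ y b := by
    intro a b
    refine huniq (pullback.fst (V a).ι (V b).ι ≫ (V a).ι) _ _ (hcomp _ _ _ (hy a)) ?_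
    rw [pullback.condition]
    exact hcomp _ _ _ (hy b)
  refine ⟨𝒰.glueMorphisms y hglue, fun t ↦ ⟨V t, hV t, ?_⟩⟩
  have : (V t).ι ≫ 𝒰.glueMorphisms y hglue = y t := 𝒰.ι_glueMorphisms y hglue t
  rw [this]
  exact hy t

theorem hom_ext_of_locally {T G : Scheme.{u}} {f g : T ⟶ G}
    (h : ∀ t : T, ∃ V : T.Opens, t ∈ V ∧ V.ι ≫ f = V.ι ≫ g) : f = g := by
  choose V hV e using h
  have hcov : TopologicalSpace.IsOpenCover V := by
    rw [TopologicalSpace.IsOpenCover, eq_top_iff]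
    intro t _
    exact TopologicalSpace.Opens.mem_iSup.2 ⟨t, hV t⟩
  exact (T.openCoverOfIsOpenCover V hcov).hom_ext _ _ e

end Gluing

/-! ### Sections over basic open subsets of an affine open -/

section Localization

variable {Z : Scheme.{u}}

theorem exists_affine_le {U : Z.Opens} {z : Z} (hz : z ∈ U) :
    ∃ W : Z.Opens, IsAffineOpen W ∧ z ∈ W ∧ W ≤ U := by
  obtain ⟨_, ⟨W, hW, rfl⟩, hzW, hle⟩ := Z.isBasis_affineOpens.exists_subset_of_mem_open
    (SetLike.mem_coe.2 hz) U.isOpen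
  exact ⟨W, hW, hzW, hle⟩

theorem exists_pow_mul_mem {U : Z.Opens} (hU : IsAffineOpen U) (f : Γ(Z, U)) (I : Ideal Γ(Z, U))
    (z : Γ(Z, U)) (hz : (Z.presheaf.map (homOfLE (Z.basicOpen_le f)).op).hom z ∈
      I.map (Z.presheaf.map (homOfLE (Z.basicOpen_le f)).op).hom) : ∃ n : ℕ, f ^ n * z ∈ I := by
  have := hU.isLocalization_basicOpen f
  obtain ⟨⟨⟨a, ha⟩, ⟨_, n, rfl⟩⟩, e⟩ :=
    (IsLocalization.mem_map_algebraMap_iff (Submonoid.powers f) Γ(Z, Z.basicOpen f)).1 hz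
  change algebraMap _ Γ(Z, Z.basicOpen f) z * algebraMap _ _ (f ^ n) = algebraMap _ _ a at e
  rw [← map_mul, IsLocalization.eq_iff_exists (Submonoid.powers f)] at e
  obtain ⟨⟨_, m, rfl⟩, e⟩ := e
  refine ⟨m + n, ?_⟩
  have e' : f ^ (m + n) * z = f ^ m * a := by
    simp only at e
    rw [← e]; ring
  rw [e']
  exact I.mul_mem_left _ ha

theorem isUnit_res_basicOpen {U : Z.Opens} (f : Γ(Z, U)) :
    IsUnit ((Z.presheaf.map (homOfLE (Z.basicOpen_le f)).op).hom f) :=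
  RingedSpace.isUnit_res_basicOpen _ f

theorem exists_res_eq_pow_mul {U : Z.Opens} (hU : IsAffineOpen U) (f : Γ(Z, U))
    (x : Γ(Z, Z.basicOpen f)) : ∃ (n : ℕ) (z : Γ(Z, U)),
      (Z.presheaf.map (homOfLE (Z.basicOpen_le f)).op).hom z =
      (Z.presheaf.map (homOfLE (Z.basicOpen_le f)).op).hom f ^ n * x := by
  have := hU.isLocalization_basicOpen f
  obtain ⟨⟨z, ⟨_, n, rfl⟩⟩, e⟩ := IsLocalization.surj (Submonoid.powers f) x
  refine ⟨n, z, ?_⟩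
  change x * algebraMap _ Γ(Z, Z.basicOpen f) (f ^ n) = algebraMap _ _ z at e
  change algebraMap _ Γ(Z, Z.basicOpen f) z = algebraMap _ Γ(Z, Z.basicOpen f) f ^ n * x
  rw [← e, map_pow, mul_comm]

end Localization

/-! ### Closed conditions on morphisms and the ideal sheaves representing them -/

section ClosedLocus

variable {Z : Scheme.{u}} (P : ∀ ⦃T : Scheme.{u}⦄, (T ⟶ Z) → Prop)

/-- The ideal `I` of sections over the affine open `U` cuts out the locus where `P` holds. -/
def IsChartIdeal (U : Z.Opens) (I : Ideal Γ(Z, U)) : Prop :=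
  ∀ ⦃T : Scheme.{u}⦄ (h : T ⟶ Z) (e : ⊤ ≤ h ⁻¹ᵁ U), P h ↔ I ≤ RingHom.ker (h.appLE U ⊤ e).hom

/-- A property of morphisms to `Z` which is Zariski local and locally on `Z` means factoring through
a closed subscheme. -/
structure IsClosedLocus : Prop where
  comp : ∀ ⦃T T' : Scheme.{u}⦄ (k : T' ⟶ T) (h : T ⟶ Z), P h → P (k ≫ h)
  locally : ∀ ⦃T : Scheme.{u}⦄ (h : T ⟶ Z), (∀ t : T, ∃ V : T.Opens, t ∈ V ∧ P (V.ι ≫ h)) → P h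
  chart : ∀ z : Z, ∃ U : Z.Opens, IsAffineOpen U ∧ z ∈ U ∧ ∃ I, IsChartIdeal P U I

variable {P}

theorem IsChartIdeal.restrict {U V : Z.Opens} {I : Ideal Γ(Z, U)} (hI : IsChartIdeal P U I)
    (i : V ≤ U) : IsChartIdeal P V (I.map (Z.presheaf.map (homOfLE i).op).hom) := by
  intro T h e
  have e' : ⊤ ≤ h ⁻¹ᵁ U := fun t ht ↦ i (e ht)
  rw [hI h e', Ideal.map_le_iff_le_comap, RingHom.comap_ker, ← CommRingCat.hom_comp,
    Scheme.Hom.map_appLE]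

theorem fromSpec_appLE_self {U : Z.Opens} (hU : IsAffineOpen U) (e : ⊤ ≤ hU.fromSpec ⁻¹ᵁ U) :
    hU.fromSpec.appLE U ⊤ e = (Scheme.ΓSpecIso Γ(Z, U)).inv := by
  rw [Scheme.Hom.appLE, hU.fromSpec_app_self, Category.assoc, ← Functor.map_comp]
  convert Category.comp_id _
  exact (Spec Γ(Z, U)).presheaf.map_id _

/-- The spectrum of the quotient by `I` is the universal test object; testing on it makes chart
ideals unique. -/
theorem exists_hom_ker_eq {U : Z.Opens} (hU : IsAffineOpen U) (I : Ideal Γ(Z, U)) :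
    ∃ (T : Scheme.{u}) (h : T ⟶ Z) (e : ⊤ ≤ h ⁻¹ᵁ U),
      RingHom.ker (h.appLE U ⊤ e).hom = I := by
  have e₀ : ⊤ ≤ hU.fromSpec ⁻¹ᵁ U := hU.fromSpec_preimage_self.ge
  refine ⟨Spec (.of (Γ(Z, U) ⧸ I)), Spec.map (CommRingCat.ofHom (Ideal.Quotient.mk I)) ≫
    hU.fromSpec, top_le_comp _ e₀, ?_⟩
  rw [← appLE_comp_appTop _ _ _ e₀, fromSpec_appLE_self, ← Scheme.ΓSpecIso_inv_naturality,
    CommRingCat.hom_comp, CommRingCat.hom_ofHom]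
  ext x
  rw [RingHom.mem_ker, RingHom.comp_apply,
    map_eq_zero_iff _ ((ConcreteCategory.bijective_of_isIso (Scheme.ΓSpecIso _).inv).1),
    Ideal.Quotient.eq_zero_iff_mem]

theorem IsChartIdeal.unique {U : Z.Opens} (hU : IsAffineOpen U) {I I' : Ideal Γ(Z, U)} (hI :
    IsChartIdeal P U I)
    (hI' : IsChartIdeal P U I') : I = I' := by
  have key : ∀ {I I' : Ideal Γ(Z, U)}, IsChartIdeal P U I → IsChartIdeal P U I' → I ≤ I' := by
    intro I I' hI hI'
    obtain ⟨T, h, e, he⟩ := exists_hom_ker_eq hU I'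
    rw [← he]
    exact (hI h e).1 ((hI' h e).2 he.ge)
  exact le_antisymm (key hI hI') (key hI' hI)

variable (P) in
/-- The sections over `U` vanishing on the locus where `P` holds. -/
def locusIdeal (U : Z.Opens) : Ideal Γ(Z, U) where
  carrier := {x | ∀ (V : Z.Opens) (_ : IsAffineOpen V) (i : V ≤ U) (I : Ideal Γ(Z, V)),
      IsChartIdeal P V I →
    (Z.presheaf.map (homOfLE i).op).hom x ∈ I}
  add_mem' hx hy V hV i I hI := by rw [map_add]; exact add_mem (hx V hV i I hI) (hy V hV i I hI)
  zero_mem' V _ i I hI := by rw [map_zero]; exact zero_mem I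
  smul_mem' c x hx V hV i I hI := by
    rw [smul_eq_mul, map_mul]; exact I.mul_mem_left _ (hx V hV i I hI)

theorem IsChartIdeal.locusIdeal_eq {U : Z.Opens} (hU : IsAffineOpen U) {I : Ideal Γ(Z, U)}
    (hI : IsChartIdeal P U I) : locusIdeal P U = I := by
  apply le_antisymm
  · intro x hx
    simpa using hx U hU le_rfl I hI
  · intro x hx V hV i I' hI'
    rw [hI'.unique hV (hI.restrict i)]
    exact Ideal.mem_map_of_mem _ hx

/-- Quasi-coherence. After clearing denominators, a section over the basic open set of `f` comes
from `U`; finitely many smaller basic open sets, each with a chart ideal, cover `U`, so a single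
power of `f` brings the section into the ideal on all of them. -/
theorem IsClosedLocus.map_locusIdeal (H : IsClosedLocus P) {U : Z.Opens} (hU : IsAffineOpen U) (f :
    Γ(Z, U)) :
    (locusIdeal P U).map (Z.presheaf.map (homOfLE (Z.basicOpen_le f)).op).hom =
      locusIdeal P (Z.basicOpen f) := by
  apply le_antisymm
  · rw [Ideal.map_le_iff_le_comap]
    intro x hx V hV i I hI
    rw [map_map_apply (Z.basicOpen_le f) i (i.trans (Z.basicOpen_le f))]
    exact hx V hV _ I hI
  intro x hx
  -- a finite cover by basic opens over which the locus has an ideal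
  have hcov : ∀ z ∈ U, ∃ g : Γ(Z, U), z ∈ Z.basicOpen g ∧
      ∃ I, IsChartIdeal P (Z.basicOpen g) I := by
    intro z hz
    obtain ⟨U₁, hU₁, hz₁, I, hI⟩ := H.chart z
    obtain ⟨g, hg, hzg⟩ := hU.exists_basicOpen_le (V := U₁) ⟨z, hz₁⟩ hz
    exact ⟨g, hzg, _, hI.restrict (V := Z.basicOpen g) hg⟩
  let S : Set Γ(Z, U) := {g | ∃ I, IsChartIdeal P (Z.basicOpen g) I}
  have hS : Ideal.span S = ⊤ := by
    rw [← hU.iSup_basicOpen_eq_self_iff]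
    apply le_antisymm
    · exact iSup_le fun g ↦ Z.basicOpen_le _
    · intro z hz
      obtain ⟨g, hzg, hg⟩ := hcov z hz
      exact TopologicalSpace.Opens.mem_iSup.2 ⟨⟨g, hg⟩, hzg⟩
  obtain ⟨S', hS'S, hS'⟩ := (Ideal.span_eq_top_iff_finite S).1 hS
  obtain ⟨m, z, hz⟩ := exists_res_eq_pow_mul hU f x
  have hloc : ∀ g ∈ S', ∃ n : ℕ,
      (Z.presheaf.map (homOfLE (Z.basicOpen_le g)).op).hom (f ^ n * z) ∈
        locusIdeal P (Z.basicOpen g) := by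
    intro g hg
    obtain ⟨I, hI⟩ := hS'S hg
    rw [hI.locusIdeal_eq (hU.basicOpen g)]
    let f' := (Z.presheaf.map (homOfLE (Z.basicOpen_le g)).op).hom f
    have hle : Z.basicOpen f' ≤ Z.basicOpen f := by
      rw [Scheme.basicOpen_res]; exact inf_le_right
    obtain ⟨n, hn⟩ := exists_pow_mul_mem (U := Z.basicOpen g) (hU.basicOpen g) f' I
      ((Z.presheaf.map (homOfLE (Z.basicOpen_le g)).op).hom z) (by
        have h1 := hx (Z.basicOpen f') ((hU.basicOpen g).basicOpen f') hle _ (hI.restrict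
            (Z.basicOpen_le f'))
        rw [map_map_apply (Z.basicOpen_le g) (Z.basicOpen_le f') (hle.trans (Z.basicOpen_le f)),
          ← map_map_apply (Z.basicOpen_le f) hle, hz, map_mul]
        exact Ideal.mul_mem_left _ _ h1)
    refine ⟨n, ?_⟩
    rw [map_mul, map_pow]
    exact hn
  choose! n hn using hloc
  let N := S'.sup n
  have hN : f ^ N * z ∈ locusIdeal P U := by
    intro V hV i I hI
    -- The restrictions to `V` of the elements of `S'` generate the unit ideal, so membership in `I`
    -- may be checked after multiplication by a power of each.
    refine Submodule.mem_of_span_eq_top_of_smul_pow_mem I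
      ((Z.presheaf.map (homOfLE i).op).hom '' (S' : Set Γ(Z, U))) ?_ _ ?_
    · rw [← Ideal.map_span, hS', Ideal.map_top]
    · rintro ⟨_, g, hg, rfl⟩
      let g' := (Z.presheaf.map (homOfLE i).op).hom g
      have hle : Z.basicOpen g' ≤ Z.basicOpen g := by
        rw [Scheme.basicOpen_res]; exact inf_le_right
      refine exists_pow_mul_mem hV g' I _ ?_
      have h1 := hn g hg (Z.basicOpen g') (hV.basicOpen g') hle _ (hI.restrict (Z.basicOpen_le g'))
      rw [map_map_apply (Z.basicOpen_le g) hle (hle.trans (Z.basicOpen_le g))] at h1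
      rw [map_map_apply i (Z.basicOpen_le g') (hle.trans (Z.basicOpen_le g))]
      have : f ^ N * z = f ^ (N - n g) * (f ^ n g * z) := by
        rw [← mul_assoc, ← pow_add, Nat.sub_add_cancel (Finset.le_sup (f := n) hg)]
      rw [this, map_mul]
      exact Ideal.mul_mem_left _ _ h1
  have h2 := Ideal.mem_map_of_mem (Z.presheaf.map (homOfLE (Z.basicOpen_le f)).op).hom hN
  rw [map_mul, hz, map_pow, ← mul_assoc, ← pow_add] at h2
  exact (Ideal.unit_mul_mem_iff_mem _ ((isUnit_res_basicOpen f).pow _)).1 h2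

/-- The ideal sheaf of the locus where `P` holds. -/
def IsClosedLocus.idealSheaf (H : IsClosedLocus P) : Z.IdealSheafData where
  ideal U := locusIdeal P U.1
  map_ideal_basicOpen U f := H.map_locusIdeal U.2 f

/-- The ideal sheaves whose subscheme satisfies `P` are exactly those above `idealSheaf`. This
identifies the infima in the definitions of the Grassmannian, `ℙ_B(ℛ^⊥)` and `ℙ_ℳ(𝒰)` with ideals
computable on charts. -/
theorem IsClosedLocus.idealSheaf_le_iff (H : IsClosedLocus P) (J : Z.IdealSheafData) :
    H.idealSheaf ≤ J ↔ P J.subschemeι := by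
  constructor
  · intro hJ
    apply H.locally
    intro t
    obtain ⟨U, hU, htU, I, hI⟩ := H.chart (J.subschemeι t)
    refine ⟨J.subschemeι ⁻¹ᵁ U, htU, (hI _ (ι_top_le le_rfl)).2 ?_⟩
    intro x hx
    have h1 : x ∈ J.ideal ⟨U, hU⟩ := hJ ⟨U, hU⟩ (by
      change x ∈ locusIdeal P U
      rwa [hI.locusIdeal_eq hU])
    rw [← J.ker_subschemeι_app, RingHom.mem_ker] at h1
    rw [RingHom.mem_ker, ← appLE_appLE_apply _ J.subschemeι (V := J.subschemeι ⁻¹ᵁ U) le_rfl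
      (Scheme.Opens.ι_preimage_self _).ge, Scheme.Hom.appLE_eq_app]
    erw [h1]
    exact map_zero _
  · intro hJ
    choose U hU hzU I hI using H.chart
    refine Scheme.IdealSheafData.le_of_iSup_eq_top (fun z ↦ ⟨U z, hU z⟩) ?_ fun z ↦ ?_
    · rw [eq_top_iff]
      intro z _
      exact TopologicalSpace.Opens.mem_iSup.2 ⟨z, hzU z⟩
    · change locusIdeal P (U z) ≤ _
      rw [(hI z).locusIdeal_eq (hU z)]
      intro x hx
      rw [← J.ker_subschemeι_app, RingHom.mem_ker]
      have h1 := (hI z _ (ι_top_le (g := J.subschemeι) (V := J.subschemeι ⁻¹ᵁ U z) le_rfl)).1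
        (H.comp _ _ hJ) hx
      rw [RingHom.mem_ker, ← appLE_appLE_apply _ J.subschemeι (V := J.subschemeι ⁻¹ᵁ U z) le_rfl
        (Scheme.Opens.ι_preimage_self _).ge, Scheme.Hom.appLE_eq_app] at h1
      exact (map_eq_zero_iff _ (ConcreteCategory.bijective_of_isIso
        ((J.subschemeι ⁻¹ᵁ U z).ι.appLE _ ⊤ (Scheme.Opens.ι_preimage_self _).ge)).1).1 h1

theorem IsClosedLocus.sInf_eq (H : IsClosedLocus P) :
    sInf {J : Z.IdealSheafData | P J.subschemeι} = H.idealSheaf := by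
  apply le_antisymm
  · exact sInf_le ((H.idealSheaf_le_iff _).1 le_rfl)
  · exact le_sInf fun J hJ ↦ (H.idealSheaf_le_iff J).2 hJ

/-- On an affine open over which the locus is cut out by the ideal `I`, the ideal sheaf of the
locus is given by `I`. -/
theorem IsClosedLocus.sInf_ideal (H : IsClosedLocus P) {U : Z.Opens} (hU : IsAffineOpen U)
    {I : Ideal Γ(Z, U)} (hI : IsChartIdeal P U I) :
    (sInf {J : Z.IdealSheafData | P J.subschemeι}).ideal ⟨U, hU⟩ = I := by
  rw [H.sInf_eq]
  exact hI.locusIdeal_eq hU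

/-- A morphism factors through the closed subscheme of the locus if and only if `P` holds. -/
theorem IsClosedLocus.exists_lift_iff (H : IsClosedLocus P) {T : Scheme.{u}} (h : T ⟶ Z) :
    (∃ l, l ≫ (sInf {J : Z.IdealSheafData | P J.subschemeι}).subschemeι = h) ↔ P h := by
  rw [H.sInf_eq]
  constructor
  · rintro ⟨l, rfl⟩
    exact H.comp _ _ ((H.idealSheaf_le_iff _).1 le_rfl)
  · intro hP
    have hle : H.idealSheaf ≤ h.ker := by
      rw [Scheme.Hom.ker, Scheme.IdealSheafData.le_ofIdeals_iff]
      intro U x hx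
      rw [RingHom.mem_ker, Scheme.Hom.app_eq_appLE]
      apply section_eq_of_locally
      intro t ht
      obtain ⟨V, hV, htV, I, hI⟩ := H.chart (h t)
      obtain ⟨W, hW, htW, hWle⟩ := exists_affine_le (U := U.1 ⊓ V) (z := h t) ⟨ht, htV⟩
      have h1 := hx W hW (hWle.trans inf_le_left) _ (hI.restrict (hWle.trans inf_le_right))
      have h2 := ((hI.restrict (hWle.trans inf_le_right)) _
        (ι_top_le (g := h) (V := h ⁻¹ᵁ W) le_rfl)).1 (H.comp _ _ hP) h1
      have hle : h ⁻¹ᵁ W ≤ h ⁻¹ᵁ U.1 := fun t ht ↦ (hWle ht).1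
      refine ⟨h ⁻¹ᵁ W, hle, htW, ?_⟩
      rw [map_zero, appLE_map_apply _ _ _ hle, ← map_appLE_apply h le_rfl (hWle.trans inf_le_left)]
      rw [RingHom.mem_ker, ← appLE_appLE_apply _ h (V := h ⁻¹ᵁ W) le_rfl
        (Scheme.Opens.ι_preimage_self _).ge] at h2
      exact (map_eq_zero_iff _ (ConcreteCategory.bijective_of_isIso
        ((h ⁻¹ᵁ W).ι.appLE _ ⊤ (Scheme.Opens.ι_preimage_self _).ge)).1).1 h2
    exact ⟨IsClosedImmersion.lift H.idealSheaf.subschemeι h (by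
      rwa [Scheme.IdealSheafData.ker_subschemeι]), IsClosedImmersion.lift_fac _ _ _⟩

end ClosedLocus

/-! ### The ideal of an inverse image -/

section Comap

variable {X Y T : Scheme.{u}}

/-- Allows uniqueness of chart ideals to be used for an ideal sheaf given in advance, with `P` the
property of factoring through its subscheme. -/
theorem isChartIdeal_ideal (I : Y.IdealSheafData) {U : Y.Opens} (hU : IsAffineOpen U) :
    IsChartIdeal (fun ⦃T : Scheme.{u}⦄ (h : T ⟶ Y) ↦ ∃ l, l ≫ I.subschemeι = h) U
      (I.ideal ⟨U, hU⟩) := by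
  intro T h e
  constructor
  · rintro ⟨l, rfl⟩ x hx
    rw [← I.ker_subschemeι_app, RingHom.mem_ker] at hx
    have e' : ⊤ ≤ l ⁻¹ᵁ I.subschemeι ⁻¹ᵁ U := e
    rw [RingHom.mem_ker, ← appLE_appLE_apply l I.subschemeι le_rfl e', Scheme.Hom.appLE_eq_app]
    erw [hx]
    exact map_zero _
  · intro hI
    have hle : I ≤ h.ker := by
      rw [Scheme.Hom.ker, Scheme.IdealSheafData.le_ofIdeals_iff]
      intro U' x hx
      rw [RingHom.mem_ker, Scheme.Hom.app_eq_appLE]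
      apply section_eq_of_locally
      intro t ht
      obtain ⟨W, hW, htW, hWle⟩ := exists_affine_le (U := U'.1 ⊓ U) (z := h t) ⟨ht, e trivial⟩
      have hle : h ⁻¹ᵁ W ≤ h ⁻¹ᵁ U'.1 := fun t ht ↦ (hWle ht).1
      refine ⟨h ⁻¹ᵁ W, hle, htW, ?_⟩
      rw [map_zero, appLE_map_apply _ _ _ hle, ← map_appLE_apply h le_rfl (hWle.trans inf_le_left)]
      have h1 := Ideal.mem_map_of_mem
        (Y.presheaf.map (homOfLE (hWle.trans inf_le_left : W ≤ U'.1)).op).hom hx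
      have h2 := I.map_ideal (U := ⟨W, hW⟩) (V := U') (hWle.trans inf_le_left)
      have h3 := I.map_ideal (U := ⟨W, hW⟩) (V := ⟨U, hU⟩) (hWle.trans inf_le_right)
      have h4 := (h2.trans h3.symm).le h1
      have h5 : Ideal.map (Y.presheaf.map (homOfLE (hWle.trans inf_le_right : W ≤ U)).op).hom
          (I.ideal ⟨U, hU⟩) ≤ RingHom.ker (h.appLE W (h ⁻¹ᵁ W) le_rfl).hom := by
        rw [Ideal.map_le_iff_le_comap]
        intro y hy
        have hy' : (h.appLE U ⊤ e).hom y = 0 := hI hy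
        rw [Ideal.mem_comap, RingHom.mem_ker, map_appLE_apply h le_rfl _
          (fun t ht ↦ e trivial), ← appLE_map_apply h e le_top, hy', map_zero]
      exact h5 h4
    exact ⟨IsClosedImmersion.lift I.subschemeι h (by
      rwa [Scheme.IdealSheafData.ker_subschemeι]), IsClosedImmersion.lift_fac _ _ _⟩

theorem exists_lift_comap_iff (I : Y.IdealSheafData) (f : X ⟶ Y) (h : T ⟶ X) :
    (∃ l, l ≫ (I.comap f).subschemeι = h) ↔ ∃ l, l ≫ I.subschemeι = h ≫ f := by
  constructor
  · rintro ⟨l, rfl⟩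
    refine ⟨l ≫ (I.comapIso f).hom ≫ pullback.snd _ _, ?_⟩
    rw [Category.assoc, Category.assoc, ← pullback.condition, ← Category.assoc (I.comapIso f).hom,
      Scheme.IdealSheafData.comapIso_hom_fst, Category.assoc]
  · rintro ⟨l, hl⟩
    refine ⟨pullback.lift h l hl.symm ≫ (I.comapIso f).inv, ?_⟩
    rw [Category.assoc, Scheme.IdealSheafData.comapIso_inv_subschemeι, pullback.lift_fst]

/-- Both ideals cut out, on `V`, the morphisms whose composition with `f` factors through the
subscheme of `I`; uniqueness of chart ideals makes them equal. -/
theorem comap_ideal_eq_map (I : Y.IdealSheafData) (f : X ⟶ Y) {U : Y.Opens} (hU : IsAffineOpen U)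
    {V : X.Opens} (hV : IsAffineOpen V) (e : V ≤ f ⁻¹ᵁ U) :
    (I.comap f).ideal ⟨V, hV⟩ = (I.ideal ⟨U, hU⟩).map (f.appLE U V e).hom := by
  refine (isChartIdeal_ideal (I.comap f) hV).unique hV ?_
  intro T h e'
  have e'' : ⊤ ≤ (h ≫ f) ⁻¹ᵁ U := fun t ht ↦ e (e' ht)
  have h1 := isChartIdeal_ideal I hU (h ≫ f) e''
  refine (exists_lift_comap_iff I f h).trans (h1.trans ?_)
  rw [Ideal.map_le_iff_le_comap,
    RingHom.comap_ker, ← CommRingCat.hom_comp, Scheme.Hom.appLE_comp_appLE]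

end Comap

/-! ### Base change and homogeneity of the coordinate expressions -/

section CoordinateAlgebra

theorem map_skew {A A' : Type u} [CommRing A] [CommRing A'] (f : A →+* A') (p : Pair → A)
    (i j : Fin 5) : f (skew p i j) = skew (fun a ↦ f (p a)) i j := by
  unfold skew
  split_ifs <;> simp

theorem map_pairing {A A' : Type u} [CommRing A] [CommRing A'] (f : A →+* A') (r p : Pair → A) :
    f (pairing r p) = pairing (fun a ↦ f (r a)) (fun a ↦ f (p a)) := by
  simp [pairing]

theorem map_wedge {A A' : Type u} [CommRing A] [CommRing A'] (f : A →+* A') (v : Fin 5 → A)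
    (p : Pair → A) (i j l : Fin 5) :
    f (wedge v p i j l) = wedge (fun a ↦ f (v a)) (fun a ↦ f (p a)) i j l := by
  simp [wedge, map_skew]

theorem map_plucker {A A' : Type u} [CommRing A] [CommRing A'] (f : A →+* A')
    (p : Pair → A) (i j l m : Fin 5) :
    f (plucker p i j l m) = plucker (fun a ↦ f (p a)) i j l m := by
  simp [plucker, map_skew]

theorem map_contract {A A' : Type u} [CommRing A] [CommRing A'] (f : A →+* A') (r : Pair → A)
    (v : Fin 5 → A) (j : Fin 5) :
    f (contract r v j) = contract (fun a ↦ f (r a)) (fun a ↦ f (v a)) j := by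
  simp [contract, map_skew]

variable {A : Type u} [CommRing A]

theorem skew_smul (c : A) (p : Pair → A) (i j : Fin 5) : skew (c • p) i j = c * skew p i j := by
  unfold skew
  split_ifs <;> simp

theorem skew_add (p p' : Pair → A) (i j : Fin 5) : skew (p + p') i j = skew p i j + skew p' i j :=
    by
  unfold skew
  split_ifs <;> simp [add_comm]

theorem pairing_smul (c : A) (r p : Pair → A) : pairing r (c • p) = c * pairing r p := by
  simp [pairing, Finset.mul_sum, mul_left_comm]

theorem smul_pairing (c : A) (r p : Pair → A) : pairing (c • r) p = c * pairing r p := by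
  simp [pairing, Finset.mul_sum, mul_assoc]

theorem add_pairing (r r' p : Pair → A) : pairing (r + r') p = pairing r p + pairing r' p := by
  simp [pairing, add_mul, Finset.sum_add_distrib]

theorem zero_pairing (p : Pair → A) : pairing 0 p = 0 := by
  simp [pairing]

theorem plucker_smul (c : A) (p : Pair → A) (i j l m : Fin 5) :
    plucker (c • p) i j l m = c ^ 2 * plucker p i j l m := by
  simp only [plucker, skew_smul]; ring

theorem wedge_smul (c : A) (v : Fin 5 → A) (p : Pair → A) (i j l : Fin 5) :
    wedge v (c • p) i j l = c * wedge v p i j l := by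
  simp only [wedge, skew_smul]; ring

theorem smul_wedge (c : A) (v : Fin 5 → A) (p : Pair → A) (i j l : Fin 5) :
    wedge (c • v) p i j l = c * wedge v p i j l := by
  simp only [wedge, Pi.smul_apply, smul_eq_mul]; ring

theorem pairing_eq_zero_of_mem_span {S : Set (Pair → A)} {p : Pair → A}
    (h : ∀ r ∈ S, pairing r p = 0) {r : Pair → A} (hr : r ∈ Submodule.span A S) :
    pairing r p = 0 := by
  induction hr using Submodule.span_induction with
  | mem r hr => exact h r hr
  | zero => exact zero_pairing p
  | add r r' _ _ h h' => rw [add_pairing, h, h', add_zero]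
  | smul c r _ h => rw [smul_pairing, h, mul_zero]

end CoordinateAlgebra

/-! ### Choosing coordinates locally -/

section LocalTools

variable {ι : Type} {𝕜 : Type u} [Field 𝕜] {T Y : Scheme.{u}}

theorem Coord.exists_smul {g : Y ⟶ PP ι 𝕜} {i : ι} {s s' : ι → Γ(Y, ⊤)} (h : Coord g i s)
    (h' : s' ∈ tautLine g ⊤) : ∃ c : Γ(Y, ⊤), s' = c • s := by
  obtain ⟨c, hc⟩ := h.isUnit.exists_left_inv
  refine ⟨c * s' i, ?_⟩
  funext j
  simp only [Pi.smul_apply, smul_eq_mul]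
  linear_combination (-s' j) * hc + c * h.mul_comm h' i j

theorem ι_appLE_injective (W : Y.Opens) :
    Function.Injective (W.ι.appLE W ⊤ W.ι_preimage_self.ge).hom :=
  (ConcreteCategory.bijective_of_isIso (W.ι.appLE W ⊤ W.ι_preimage_self.ge)).1

/-- A section over `W` vanishes if it does locally on the scheme `W`. -/
theorem section_eq_zero_of_locally {W : Y.Opens} {x : Γ(Y, W)}
    (H : ∀ y : W, ∃ V : W.toScheme.Opens, y ∈ V ∧
      ((V.ι ≫ W.ι).appLE W ⊤ (top_le_comp _ W.ι_preimage_self.ge)).hom x = 0) : x = 0 := by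
  apply ι_appLE_injective W
  apply section_eq_of_locally_top
  intro y
  obtain ⟨V, hy, hV⟩ := H y
  refine ⟨V, hy, ?_⟩
  rw [map_zero, map_zero, appTop_appLE_apply _ _ _ _ (top_le_comp _ W.ι_preimage_self.ge), hV]

theorem exists_local_coord (q : Y ⟶ PP ι 𝕜) (y : Y) :
    ∃ (V : Y.Opens) (i : ι) (s : ι → Γ(V, ⊤)), y ∈ V ∧ s i = 1 ∧ Coord (V.ι ≫ q) i s := by
  obtain ⟨i, hi⟩ := PP.exists_mem_chart (q y)
  obtain ⟨s, hs, h⟩ := exists_coord_of_le q (i := i) (V := q ⁻¹ᵁ PP.chart 𝕜 i) le_rfl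
  exact ⟨_, i, s, hi, hs, h⟩

/-- Coordinates on an open subset, as sections over this open subset. -/
theorem exists_coord_section (q : Y ⟶ PP ι 𝕜) {V : Y.Opens} {i : ι}
    (h : V ≤ q ⁻¹ᵁ PP.chart 𝕜 i) : ∃ s : ι → Γ(Y, V), s i = 1 ∧ s ∈ tautLine q V ∧
      Coord (V.ι ≫ q) i (fun j ↦ (V.ι.appLE V ⊤ V.ι_preimage_self.ge).hom (s j)) := by
  have hi : (q.appLE (PP.chart 𝕜 i) V h).hom (PP.ratio 𝕜 i i) = 1 := by
    rw [PP.ratio_self, map_one]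
  refine ⟨_, hi, ratio_mem_tautLine q i h, ?_, tautLine_pullback q V.ι _ (ratio_mem_tautLine q i h)⟩
  rw [hi, map_one]
  exact isUnit_one

end LocalTools

/-! ### The Plücker relations as a closed condition -/

section Decomposable

variable {𝕜 : Type u} [Field 𝕜] {Y : Scheme.{u}}

/-- The Plücker relations for homogeneous coordinates over all schemes mapping to `Y`. -/
def CoordDecomposable (q : Y ⟶ PP Pair 𝕜) : Prop :=
  ∀ ⦃T : Scheme.{u}⦄ (j : T ⟶ Y) (a : Pair) (p : Pair → Γ(T, ⊤)), Coord (j ≫ q) a p →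
    ∀ i k l m, plucker p i k l m = 0

theorem CoordDecomposable.comp {q : Y ⟶ PP Pair 𝕜} (h : CoordDecomposable q) {T : Scheme.{u}}
    (j : T ⟶ Y) : CoordDecomposable (j ≫ q) := fun _ j' a p hp ↦
  h (j' ≫ j) a p (by rwa [Category.assoc])

theorem CoordDecomposable.of_locally {q : Y ⟶ PP Pair 𝕜}
    (H : ∀ y : Y, ∃ V : Y.Opens, y ∈ V ∧ CoordDecomposable (V.ι ≫ q)) : CoordDecomposable q := by
  intro T j a p hp i k l m
  apply section_eq_of_locally_top
  intro t
  obtain ⟨V, hy, hV⟩ := H (j t)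
  refine ⟨j ⁻¹ᵁ V, hy, ?_⟩
  rw [map_plucker, map_zero]
  refine hV (j ∣_ V) a _ ?_ i k l m
  have e : (j ∣_ V) ≫ V.ι ≫ q = (j ⁻¹ᵁ V).ι ≫ j ≫ q := by
    rw [← Category.assoc, morphismRestrict_ι, Category.assoc]
  rw [e]
  exact hp.comp _

theorem CoordDecomposable.of_coord {q : Y ⟶ PP Pair 𝕜} {a : Pair} {p : Pair → Γ(Y, ⊤)}
    (hp : Coord q a p) (h : ∀ i k l m, plucker p i k l m = 0) : CoordDecomposable q := by
  intro T j a' p' hp' i k l m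
  obtain ⟨c, rfl⟩ := (hp.comp j).exists_smul hp'.mem
  rw [plucker_smul, ← map_plucker, h, map_zero, mul_zero]

/-- The condition on tautological lines concerns only affine opens of `Y`, so its stability under
base change is not visible. The condition on coordinates is stable by construction, and the two
agree because a coordinate vector generates the line locally. The conditions `CoordInPerp` and
`CoordInBundle` play the same role below. -/
theorem coordDecomposable_iff (q : Y ⟶ PP Pair 𝕜) : CoordDecomposable q ↔ LineDecomposable q := by
  constructor
  · intro h W p hp i k l m
    apply section_eq_zero_of_locally
    intro y
    obtain ⟨V, a, p₁, hy, -, hp₁⟩ := exists_local_coord (W.1.ι ≫ q) y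
    refine ⟨V, hy, ?_⟩
    rw [map_plucker]
    have h2 := tautLine_pullback q (V.ι ≫ W.1.ι) (top_le_comp V.ι W.1.ι_preimage_self.ge) hp
    rw [Category.assoc] at h2
    obtain ⟨c, hc⟩ := hp₁.exists_smul h2
    rw [hc, plucker_smul, h (V.ι ≫ W.1.ι) a p₁ (by rwa [Category.assoc]), mul_zero]
  · intro h
    apply CoordDecomposable.of_locally
    intro y
    obtain ⟨a, ha⟩ := PP.exists_mem_chart (q y)
    obtain ⟨V, hV, hy, hle⟩ := exists_affine_le (U := q ⁻¹ᵁ PP.chart 𝕜 a) ha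
    obtain ⟨s, -, hs, hc⟩ := exists_coord_section q hle
    refine ⟨V, hy, .of_coord hc fun i k l m ↦ ?_⟩
    rw [← map_plucker, h ⟨V, hV⟩ s hs, map_zero]

theorem isClosedLocus_decomposable :
    IsClosedLocus (fun ⦃T : Scheme.{u}⦄ (q : T ⟶ PP Pair 𝕜) ↦ LineDecomposable q) := by
  simp only [← coordDecomposable_iff]
  refine ⟨fun T T' k h hh ↦ hh.comp k, fun T h ↦ .of_locally, fun z ↦ ?_⟩
  obtain ⟨a, ha⟩ := PP.exists_mem_chart z
  obtain ⟨V, hV, hy, hle⟩ := exists_affine_le ha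
  obtain ⟨s, hs1, hs, -⟩ := exists_coord_section (𝟙 (PP Pair 𝕜)) (V := V) (i := a) hle
  refine ⟨V, hV, hy, Ideal.span {x | ∃ i k l m, x = plucker s i k l m}, ?_⟩
  intro T h e
  have hc : Coord h a (fun j ↦ (h.appLE V ⊤ e).hom (s j)) := by
    refine ⟨by rw [hs1, map_one]; exact isUnit_one, ?_⟩
    simpa using tautLine_pullback (𝟙 (PP Pair 𝕜)) h e hs
  rw [Ideal.span_le]
  constructor
  · rintro hh _ ⟨i, k, l, m, rfl⟩
    change (h.appLE V ⊤ e).hom _ = 0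
    rw [map_plucker]
    exact hh (𝟙 T) a _ (by simpa using hc) i k l m
  · intro hh
    refine .of_coord hc fun i k l m ↦ ?_
    rw [← map_plucker]
    exact hh ⟨i, k, l, m, rfl⟩

end Decomposable

/-! ### Pulling back the forms of `ℛ` -/

section Forms

variable {B : Scheme.{u}} (R : Subbundle B) {T Y : Scheme.{u}}

theorem pullForm_comp (b : Y ⟶ B) (j : T ⟶ Y) {W' : B.Opens} {W : Y.Opens} {V : T.Opens}
    (h : W ≤ b ⁻¹ᵁ W') (e : V ≤ j ⁻¹ᵁ W) (h' : V ≤ (j ≫ b) ⁻¹ᵁ W') (r : Pair → Γ(B, W')) :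
    (fun a ↦ (j.appLE W V e).hom (pullForm b h r a)) = pullForm (j ≫ b) h' r := by
  funext a
  exact appLE_appLE_apply j b h e h' _

theorem pullForm_comp_top (b : Y ⟶ B) (j : T ⟶ Y) {W' : B.Opens}
    (h : ⊤ ≤ b ⁻¹ᵁ W') (h' : ⊤ ≤ (j ≫ b) ⁻¹ᵁ W') (r : Pair → Γ(B, W')) :
    (fun a ↦ j.appTop.hom (pullForm b h r a)) = pullForm (j ≫ b) h' r := by
  funext a
  exact appTop_appLE_apply j b _ h h' _

theorem pullForm_congr {b b' : Y ⟶ B} (hb : b = b') {W' : B.Opens} {W : Y.Opens}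
    (h : W ≤ b ⁻¹ᵁ W') (h' : W ≤ b' ⁻¹ᵁ W') (r : Pair → Γ(B, W')) :
    pullForm b h r = pullForm b' h' r := by
  subst hb
  rfl

/-- The image of a span under coefficientwise application of a ring homomorphism. -/
theorem map_mem_span {A A' : Type u} [CommRing A] [CommRing A'] (f : A →+* A') {ι : Type}
    {S : Set (ι → A)} {r : ι → A} (hr : r ∈ Submodule.span A S) :
    (fun a ↦ f (r a)) ∈ Submodule.span A' ((fun r a ↦ f (r a)) '' S) := by
  induction hr using Submodule.span_induction with
  | mem r hr => exact Submodule.subset_span ⟨r, hr, rfl⟩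
  | zero => simp only [Pi.zero_apply, map_zero]; exact zero_mem _
  | add r r' _ _ h h' => simp only [Pi.add_apply, map_add]; exact add_mem h h'
  | smul c r _ h =>
    simp only [Pi.smul_apply, smul_eq_mul, map_mul]
    exact Submodule.smul_mem _ (f c) h

theorem exists_pullForm_mem_span (b : T ⟶ B) {W W' : B.affineOpens} (e : ⊤ ≤ b ⁻¹ᵁ W.1)
    (e' : ⊤ ≤ b ⁻¹ᵁ W'.1) {S : Set (Pair → Γ(B, W))}
    (hS : (R.sections W).toSubmodule ≤ Submodule.span Γ(B, W) S) {r : Pair → Γ(B, W')}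
    (hr : r ∈ (R.sections W').toSubmodule) (t : T) :
    ∃ V : T.Opens, t ∈ V ∧
      pullForm (V.ι ≫ b) (top_le_comp V.ι e') r ∈ Submodule.span Γ(V, ⊤)
        (pullForm (V.ι ≫ b) (top_le_comp V.ι e) '' S) := by
  obtain ⟨W₀, hW₀, ht, hle⟩ := exists_affine_le (U := W.1 ⊓ W'.1) (z := b t)
    ⟨e trivial, e' trivial⟩
  let W₁ : B.affineOpens := ⟨W₀, hW₀⟩
  have h₁ : W₁ ≤ W := hle.trans inf_le_left
  have h₂ : W₁ ≤ W' := hle.trans inf_le_right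
  refine ⟨b ⁻¹ᵁ W₀, ht, ?_⟩
  have e₁ : ⊤ ≤ ((b ⁻¹ᵁ W₀).ι ≫ b) ⁻¹ᵁ W₁.1 := ι_top_le le_rfl
  have m₁ : (fun a ↦ (B.presheaf.map (homOfLE h₂).op).hom (r a)) ∈
      Submodule.span Γ(B, W₁)
        ((fun s a ↦ (B.presheaf.map (homOfLE h₁).op).hom (s a)) '' S) := by
    have : (fun a ↦ (B.presheaf.map (homOfLE h₂).op).hom (r a)) ∈
        (R.sections W₁).toSubmodule := by
      rw [R.restrict W' W₁ h₂]
      exact Submodule.subset_span ⟨r, hr, rfl⟩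
    rw [R.restrict W W₁ h₁] at this
    refine (Submodule.span_le.2 ?_) this
    rintro _ ⟨s, hs, rfl⟩
    exact map_mem_span _ (hS hs)
  have m₂ := map_mem_span (((b ⁻¹ᵁ W₀).ι ≫ b).appLE W₁.1 ⊤ e₁).hom m₁
  rw [Set.image_image] at m₂
  have k₁ : pullForm ((b ⁻¹ᵁ W₀).ι ≫ b) (top_le_comp (b ⁻¹ᵁ W₀).ι e') r =
      fun a ↦ (((b ⁻¹ᵁ W₀).ι ≫ b).appLE W₁.1 ⊤ e₁).hom
        ((B.presheaf.map (homOfLE h₂).op).hom (r a)) :=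
    funext fun a ↦ (map_appLE_apply _ e₁ h₂ _ _).symm
  have k₂ : pullForm ((b ⁻¹ᵁ W₀).ι ≫ b) (top_le_comp (b ⁻¹ᵁ W₀).ι e) =
      fun s a ↦ (((b ⁻¹ᵁ W₀).ι ≫ b).appLE W₁.1 ⊤ e₁).hom
        ((B.presheaf.map (homOfLE h₁).op).hom (s a)) :=
    funext fun s ↦ funext fun a ↦ (map_appLE_apply _ e₁ h₁ _ _).symm
  rw [k₁, k₂]
  exact m₂

end Forms

/-! ### Orthogonality to `ℛ` as a closed condition -/

section InPerp

variable {𝕜 : Type u} [Field 𝕜] {B : Scheme.{u}} (R : Subbundle B) {Y : Scheme.{u}}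

/-- The bivectors given by homogeneous coordinates over schemes mapping to `Y` are orthogonal
to `ℛ`. -/
def CoordInPerp (b : Y ⟶ B) (q : Y ⟶ PP Pair 𝕜) : Prop :=
  ∀ ⦃T : Scheme.{u}⦄ (j : T ⟶ Y) (W : B.affineOpens) (e : ⊤ ≤ (j ≫ b) ⁻¹ᵁ W.1) (a : Pair)
    (p : Pair → Γ(T, ⊤)), Coord (j ≫ q) a p →
    ∀ r ∈ (R.sections W).toSubmodule, pairing (pullForm (j ≫ b) e r) p = 0

variable {R}

theorem CoordInPerp.comp {b : Y ⟶ B} {q : Y ⟶ PP Pair 𝕜} (h : CoordInPerp R b q) {T : Scheme.{u}}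
    (j : T ⟶ Y) : CoordInPerp R (j ≫ b) (j ≫ q) := by
  intro T' j' W e a p hp r hr
  have e' : ⊤ ≤ ((j' ≫ j) ≫ b) ⁻¹ᵁ W.1 := by rwa [Category.assoc]
  rw [pullForm_congr (Category.assoc j' j b).symm e e']
  exact h (j' ≫ j) W e' a p (by rwa [Category.assoc]) r hr

theorem CoordInPerp.of_locally {b : Y ⟶ B} {q : Y ⟶ PP Pair 𝕜}
    (H : ∀ y : Y, ∃ V : Y.Opens, y ∈ V ∧ CoordInPerp R (V.ι ≫ b) (V.ι ≫ q)) :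
    CoordInPerp R b q := by
  intro T j W e a p hp r hr
  apply section_eq_of_locally_top
  intro t
  obtain ⟨V, hy, hV⟩ := H (j t)
  refine ⟨j ⁻¹ᵁ V, hy, ?_⟩
  rw [map_pairing, map_zero, pullForm_comp_top _ _ _ (top_le_comp _ e)]
  have e₁ : (j ∣_ V) ≫ V.ι ≫ q = (j ⁻¹ᵁ V).ι ≫ j ≫ q := by
    rw [← Category.assoc, morphismRestrict_ι, Category.assoc]
  have e₂ : (j ∣_ V) ≫ V.ι ≫ b = (j ⁻¹ᵁ V).ι ≫ j ≫ b := by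
    rw [← Category.assoc, morphismRestrict_ι, Category.assoc]
  have e' : ⊤ ≤ ((j ∣_ V) ≫ V.ι ≫ b) ⁻¹ᵁ W.1 := by rw [e₂]; exact top_le_comp _ e
  rw [pullForm_congr e₂.symm _ e']
  exact hV (j ∣_ V) W e' a _ (by rw [e₁]; exact hp.comp _) r hr

theorem CoordInPerp.of_coord {b : Y ⟶ B} {q : Y ⟶ PP Pair 𝕜} {W : B.affineOpens}
    (e : ⊤ ≤ b ⁻¹ᵁ W.1) {S : Set (Pair → Γ(B, W))}
    (hS : (R.sections W).toSubmodule ≤ Submodule.span Γ(B, W) S) {a : Pair} {p : Pair → Γ(Y, ⊤)}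
    (hp : Coord q a p) (h : ∀ r ∈ S, pairing (pullForm b e r) p = 0) : CoordInPerp R b q := by
  intro T j W' e' a' p' hp' r hr
  obtain ⟨c, rfl⟩ := (hp.comp j).exists_smul hp'.mem
  rw [pairing_smul]
  convert mul_zero _
  apply section_eq_of_locally_top
  intro t
  obtain ⟨V, ht, hV⟩ := exists_pullForm_mem_span R (j ≫ b) (top_le_comp j e) e' hS hr t
  refine ⟨V, ht, ?_⟩
  rw [map_pairing, map_zero, pullForm_comp_top _ _ _ (top_le_comp _ e')]
  refine pairing_eq_zero_of_mem_span ?_ hV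
  rintro _ ⟨s, hs, rfl⟩
  rw [← pullForm_comp_top (j ≫ b) V.ι (top_le_comp j e),
    ← pullForm_comp_top b j e, ← map_pairing, ← map_pairing, h s hs, map_zero, map_zero]

theorem coordInPerp_iff (b : Y ⟶ B) (q : Y ⟶ PP Pair 𝕜) : CoordInPerp R b q ↔ LineInPerp R b q := by
  constructor
  · intro h W' W e r hr p hp
    apply section_eq_zero_of_locally
    intro y
    obtain ⟨V, a, p₁, hy, -, hp₁⟩ := exists_local_coord (W.1.ι ≫ q) y
    refine ⟨V, hy, ?_⟩
    have h2 := tautLine_pullback q (V.ι ≫ W.1.ι) (top_le_comp V.ι W.1.ι_preimage_self.ge) hp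
    rw [Category.assoc] at h2
    obtain ⟨c, hc⟩ := hp₁.exists_smul h2
    have e₁ : ⊤ ≤ ((V.ι ≫ W.1.ι) ≫ b) ⁻¹ᵁ W'.1 := by
      rw [Category.assoc]
      exact top_le_comp _ (ι_top_le e)
    rw [map_pairing, pullForm_comp b (V.ι ≫ W.1.ι) e _ e₁, hc, pairing_smul,
      h (V.ι ≫ W.1.ι) W' e₁ a p₁ (by rwa [Category.assoc]) r hr, mul_zero]
  · intro h
    apply CoordInPerp.of_locally
    intro y
    obtain ⟨a, ha⟩ := PP.exists_mem_chart (q y)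
    obtain ⟨W', hW', hyW', -⟩ := exists_affine_le (U := ⊤) (z := b y) trivial
    obtain ⟨V, hV, hy, hle⟩ := exists_affine_le (U := q ⁻¹ᵁ PP.chart 𝕜 a ⊓ b ⁻¹ᵁ W') ⟨ha, hyW'⟩
    obtain ⟨s, -, hs, hc⟩ := exists_coord_section q (hle.trans inf_le_left)
    refine ⟨V, hy, .of_coord (W := ⟨W', hW'⟩) (ι_top_le (hle.trans inf_le_right))
      Submodule.subset_span hc fun r hr ↦ ?_⟩
    rw [← pullForm_comp b V.ι (hle.trans inf_le_right) V.ι_preimage_self.ge, ← map_pairing,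
      h ⟨W', hW'⟩ ⟨V, hV⟩ (hle.trans inf_le_right) r hr s hs, map_zero]

theorem isClosedLocus_inPerp (b : Y ⟶ B) (q : Y ⟶ PP Pair 𝕜) :
    IsClosedLocus (fun ⦃T : Scheme.{u}⦄ (h : T ⟶ Y) ↦ LineInPerp R (h ≫ b) (h ≫ q)) := by
  simp only [← coordInPerp_iff]
  refine ⟨fun T T' k h hh ↦ by simpa only [Category.assoc] using hh.comp k,
    fun T h H ↦ .of_locally (by simpa only [Category.assoc] using H), fun z ↦ ?_⟩
  obtain ⟨a, ha⟩ := PP.exists_mem_chart (q z)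
  obtain ⟨W', hW', hzW', -⟩ := exists_affine_le (U := ⊤) (z := b z) trivial
  obtain ⟨V, hV, hy, hle⟩ := exists_affine_le (U := q ⁻¹ᵁ PP.chart 𝕜 a ⊓ b ⁻¹ᵁ W') ⟨ha, hzW'⟩
  have hb : V ≤ b ⁻¹ᵁ W' := hle.trans inf_le_right
  obtain ⟨s, hs1, hs, -⟩ := exists_coord_section q (hle.trans inf_le_left)
  refine ⟨V, hV, hy, Ideal.span {x | ∃ r ∈ (R.sections ⟨W', hW'⟩).toSubmodule,
    x = pairing (pullForm b hb r) s}, ?_⟩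
  intro T h e
  have eb : ⊤ ≤ (h ≫ b) ⁻¹ᵁ W' := fun t ht ↦ hb (e ht)
  have hc : Coord (h ≫ q) a (fun j ↦ (h.appLE V ⊤ e).hom (s j)) :=
    ⟨by rw [hs1, map_one]; exact isUnit_one, tautLine_pullback q h e hs⟩
  rw [Ideal.span_le]
  constructor
  · rintro hh _ ⟨r, hr, rfl⟩
    change (h.appLE V ⊤ e).hom _ = 0
    rw [map_pairing, pullForm_comp b h hb e eb]
    have e' : ⊤ ≤ (𝟙 T ≫ h ≫ b) ⁻¹ᵁ W' := by rwa [Category.id_comp]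
    rw [pullForm_congr (Category.id_comp _).symm eb e']
    exact hh (𝟙 T) ⟨W', hW'⟩ e' a _ (by simpa using hc) r hr
  · intro hh
    refine .of_coord (W := ⟨W', hW'⟩) eb Submodule.subset_span hc fun r hr ↦ ?_
    rw [← pullForm_comp b h hb e, ← map_pairing]
    exact hh ⟨r, hr, rfl⟩

end InPerp

/-! ### Containment of the line in `𝒰` as a closed condition -/

section InBundle

variable {𝕜 : Type u} [Field 𝕜] {Y : Scheme.{u}}

/-- The vectors and bivectors given by homogeneous coordinates over schemes mapping to `Y` have
wedge product zero. -/
def CoordInBundle (v : Y ⟶ PP (Fin 5) 𝕜) (q : Y ⟶ PP Pair 𝕜) : Prop :=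
  ∀ ⦃T : Scheme.{u}⦄ (j : T ⟶ Y) (i : Fin 5) (a : Pair) (x : Fin 5 → Γ(T, ⊤))
    (p : Pair → Γ(T, ⊤)), Coord (j ≫ v) i x → Coord (j ≫ q) a p → ∀ k l m, wedge x p k l m = 0

theorem CoordInBundle.comp {v : Y ⟶ PP (Fin 5) 𝕜} {q : Y ⟶ PP Pair 𝕜} (h : CoordInBundle v q)
    {T : Scheme.{u}} (j : T ⟶ Y) : CoordInBundle (j ≫ v) (j ≫ q) := fun _ j' i a x p hx hp ↦
  h (j' ≫ j) i a x p (by rwa [Category.assoc]) (by rwa [Category.assoc])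

theorem CoordInBundle.of_locally {v : Y ⟶ PP (Fin 5) 𝕜} {q : Y ⟶ PP Pair 𝕜}
    (H : ∀ y : Y, ∃ V : Y.Opens, y ∈ V ∧ CoordInBundle (V.ι ≫ v) (V.ι ≫ q)) :
    CoordInBundle v q := by
  intro T j i a x p hx hp k l m
  apply section_eq_of_locally_top
  intro t
  obtain ⟨V, hy, hV⟩ := H (j t)
  refine ⟨j ⁻¹ᵁ V, hy, ?_⟩
  rw [map_wedge, map_zero]
  have e₁ : (j ∣_ V) ≫ V.ι ≫ q = (j ⁻¹ᵁ V).ι ≫ j ≫ q := by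
    rw [← Category.assoc, morphismRestrict_ι, Category.assoc]
  have e₂ : (j ∣_ V) ≫ V.ι ≫ v = (j ⁻¹ᵁ V).ι ≫ j ≫ v := by
    rw [← Category.assoc, morphismRestrict_ι, Category.assoc]
  exact hV (j ∣_ V) i a _ _ (by rw [e₂]; exact hx.comp _) (by rw [e₁]; exact hp.comp _) k l m

theorem CoordInBundle.of_coord {v : Y ⟶ PP (Fin 5) 𝕜} {q : Y ⟶ PP Pair 𝕜} {i : Fin 5} {a : Pair}
    {x : Fin 5 → Γ(Y, ⊤)} {p : Pair → Γ(Y, ⊤)} (hx : Coord v i x) (hp : Coord q a p)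
    (h : ∀ k l m, wedge x p k l m = 0) : CoordInBundle v q := by
  intro T j i' a' x' p' hx' hp' k l m
  obtain ⟨c, rfl⟩ := (hp.comp j).exists_smul hp'.mem
  obtain ⟨d, rfl⟩ := (hx.comp j).exists_smul hx'.mem
  rw [wedge_smul, smul_wedge, ← map_wedge, h, map_zero, mul_zero, mul_zero]

theorem coordInBundle_iff (v : Y ⟶ PP (Fin 5) 𝕜) (q : Y ⟶ PP Pair 𝕜) :
    CoordInBundle v q ↔ LineInBundle v q := by
  constructor
  · intro h W x hx p hp k l m
    apply section_eq_zero_of_locally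
    intro y
    obtain ⟨a, ha⟩ := PP.exists_mem_chart ((W.1.ι ≫ q) y)
    obtain ⟨i, hi⟩ := PP.exists_mem_chart ((W.1.ι ≫ v) y)
    let V : W.1.toScheme.Opens :=
      (W.1.ι ≫ q) ⁻¹ᵁ PP.chart 𝕜 a ⊓ (W.1.ι ≫ v) ⁻¹ᵁ PP.chart 𝕜 i
    obtain ⟨p₁, -, hp₁⟩ := exists_coord_of_le (W.1.ι ≫ q) (V := V) (i := a) inf_le_left
    obtain ⟨x₁, -, hx₁⟩ := exists_coord_of_le (W.1.ι ≫ v) (V := V) (i := i) inf_le_right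
    refine ⟨V, ⟨ha, hi⟩, ?_⟩
    rw [map_wedge]
    have h2 := tautLine_pullback q (V.ι ≫ W.1.ι) (top_le_comp V.ι W.1.ι_preimage_self.ge) hp
    have h3 := tautLine_pullback v (V.ι ≫ W.1.ι) (top_le_comp V.ι W.1.ι_preimage_self.ge) hx
    rw [Category.assoc] at h2 h3
    obtain ⟨c, hc⟩ := hp₁.exists_smul h2
    obtain ⟨d, hd⟩ := hx₁.exists_smul h3
    rw [hc, hd, wedge_smul, smul_wedge, h (V.ι ≫ W.1.ι) i a x₁ p₁ (by rwa [Category.assoc])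
      (by rwa [Category.assoc]), mul_zero, mul_zero]
  · intro h
    apply CoordInBundle.of_locally
    intro y
    obtain ⟨a, ha⟩ := PP.exists_mem_chart (q y)
    obtain ⟨i, hi⟩ := PP.exists_mem_chart (v y)
    obtain ⟨V, hV, hy, hle⟩ := exists_affine_le
      (U := q ⁻¹ᵁ PP.chart 𝕜 a ⊓ v ⁻¹ᵁ PP.chart 𝕜 i) ⟨ha, hi⟩
    obtain ⟨p, -, hp, hpc⟩ := exists_coord_section q (hle.trans inf_le_left)
    obtain ⟨x, -, hx, hxc⟩ := exists_coord_section v (hle.trans inf_le_right)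
    refine ⟨V, hy, .of_coord hxc hpc fun k l m ↦ ?_⟩
    rw [← map_wedge, h ⟨V, hV⟩ hx p hp, map_zero]

theorem isClosedLocus_inBundle (v : Y ⟶ PP (Fin 5) 𝕜) (q : Y ⟶ PP Pair 𝕜) :
    IsClosedLocus (fun ⦃T : Scheme.{u}⦄ (h : T ⟶ Y) ↦ LineInBundle (h ≫ v) (h ≫ q)) := by
  simp only [← coordInBundle_iff]
  refine ⟨fun T T' k h hh ↦ by simpa only [Category.assoc] using hh.comp k,
    fun T h H ↦ .of_locally (by simpa only [Category.assoc] using H), fun z ↦ ?_⟩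
  obtain ⟨a, ha⟩ := PP.exists_mem_chart (q z)
  obtain ⟨i, hi⟩ := PP.exists_mem_chart (v z)
  obtain ⟨V, hV, hy, hle⟩ := exists_affine_le
    (U := q ⁻¹ᵁ PP.chart 𝕜 a ⊓ v ⁻¹ᵁ PP.chart 𝕜 i) ⟨ha, hi⟩
  obtain ⟨p, hp1, hp, -⟩ := exists_coord_section q (hle.trans inf_le_left)
  obtain ⟨x, hx1, hx, -⟩ := exists_coord_section v (hle.trans inf_le_right)
  refine ⟨V, hV, hy, Ideal.span {y | ∃ k l m, y = wedge x p k l m}, ?_⟩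
  intro T h e
  have hpc : Coord (h ≫ q) a (fun j ↦ (h.appLE V ⊤ e).hom (p j)) :=
    ⟨by rw [hp1, map_one]; exact isUnit_one, tautLine_pullback q h e hp⟩
  have hxc : Coord (h ≫ v) i (fun j ↦ (h.appLE V ⊤ e).hom (x j)) :=
    ⟨by rw [hx1, map_one]; exact isUnit_one, tautLine_pullback v h e hx⟩
  rw [Ideal.span_le]
  constructor
  · rintro hh _ ⟨k, l, m, rfl⟩
    change (h.appLE V ⊤ e).hom _ = 0
    rw [map_wedge]
    exact hh (𝟙 T) i a _ _ (by simpa using hxc) (by simpa using hpc) k l m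
  · intro hh
    refine .of_coord hxc hpc fun k l m ↦ ?_
    rw [← map_wedge]
    exact hh ⟨k, l, m, rfl⟩

end InBundle

/-! ### Minors of the contraction map -/

section Minors

/-- A multilinear map vanishing on families in a set vanishes on families in its span. -/
theorem multilinear_eq_zero_of_span {A M N ι : Type*} [CommRing A] [AddCommGroup M] [Module A M]
    [AddCommGroup N] [Module A N] [Fintype ι] [DecidableEq ι]
    (f : MultilinearMap A (fun _ : ι ↦ M) N) {S : Set M} (h : ∀ r : ι → M, (∀ a, r a ∈ S) → f r = 0)
    (r : ι → M) (hr : ∀ a, r a ∈ Submodule.span A S) : f r = 0 := by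
  suffices H : ∀ (s : Finset ι) (r : ι → M), (∀ a ∈ s, r a ∈ Submodule.span A S) →
      (∀ a ∉ s, r a ∈ S) → f r = 0 from H Finset.univ r (fun a _ ↦ hr a) (by simp)
  intro s
  induction s using Finset.induction_on with
  | empty => exact fun r _ h' ↦ h r fun a ↦ h' a (by simp)
  | insert a s has ih =>
    intro r h₁ h₂
    suffices H : ∀ m ∈ Submodule.span A S, f (Function.update r a m) = 0 by
      simpa using H (r a) (h₁ a (by simp))
    intro m hm
    induction hm using Submodule.span_induction with
    | mem m hm =>
      apply ih
      · intro b hb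
        have : b ≠ a := fun e ↦ has (e ▸ hb)
        rw [Function.update_of_ne this]
        exact h₁ b (by simp [hb])
      · intro b hb
        by_cases e : b = a
        · subst e; simpa using hm
        · rw [Function.update_of_ne e]
          exact h₂ b (by simp [e, hb])
    | zero => exact f.map_update_zero r a
    | add x y _ _ hx hy => rw [f.map_update_add, hx, hy, add_zero]
    | smul c x _ hx => rw [f.map_update_smul, hx, smul_zero]

variable {A : Type u} [CommRing A]

theorem contract_self (r : Pair → A) (v : Fin 5 → A) : ∑ j, contract r v j * v j = 0 := by
  simp only [contract, skew, Fin.sum_univ_five]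
  simp (decide := true) only [↓reduceDIte]
  ring

/-- The bilinear map `(r, w) ↦ r(v, w)`. -/
def evalForm (v : Fin 5 → A) : (Pair → A) →ₗ[A] (Fin 5 → A) →ₗ[A] A :=
  LinearMap.mk₂ A (fun r w ↦ ∑ j, contract r v j * w j)
    (fun r r' w ↦ by
      simp only [contract, skew_add, add_mul, Finset.sum_add_distrib])
    (fun c r w ↦ by
      simp only [contract, skew_smul, smul_eq_mul, Finset.mul_sum, Finset.sum_mul, mul_assoc])
    (fun r w w' ↦ by simp only [Pi.add_apply, mul_add, Finset.sum_add_distrib])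
    (fun c r w ↦ by
      simp only [Pi.smul_apply, smul_eq_mul, Finset.mul_sum]
      exact Finset.sum_congr rfl fun j _ ↦ by ring)

theorem evalForm_apply (v : Fin 5 → A) (r : Pair → A) (w : Fin 5 → A) :
    evalForm v r w = ∑ j, contract r v j * w j := rfl

theorem evalForm_single (v : Fin 5 → A) (r : Pair → A) (j : Fin 5) :
    evalForm v r (Pi.single j 1) = contract r v j := by
  simp [evalForm_apply, Pi.single_apply]

theorem evalForm_self (v : Fin 5 → A) (r : Pair → A) : evalForm v r v = 0 := contract_self r v

theorem span_single_ne_insert {v : Fin 5 → A} {i : Fin 5} (hv : IsUnit (v i)) :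
    Submodule.span A (insert v (Set.range fun j : {j // j ≠ i} ↦ Pi.single j.1 1)) = ⊤ := by
  set P := Submodule.span A (insert v (Set.range fun j : {j // j ≠ i} ↦ Pi.single j.1 (1 : A)))
  have h₁ : ∀ j, j ≠ i → Pi.single j (1 : A) ∈ P := fun j hj ↦
    Submodule.subset_span (Or.inr ⟨⟨j, hj⟩, rfl⟩)
  have h₂ : v ∈ P := Submodule.subset_span (Or.inl rfl)
  obtain ⟨c, hc⟩ := hv.exists_left_inv
  have h₃ : Pi.single i (1 : A) ∈ P := by
    have e : v i • Pi.single i 1 + ∑ j ∈ Finset.univ.erase i, v j • Pi.single j (1 : A) = v := by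
      rw [Finset.add_sum_erase Finset.univ (fun j ↦ v j • Pi.single j (1 : A)) (Finset.mem_univ i)]
      exact (pi_eq_sum_univ' v).symm
    have : Pi.single i (1 : A) = c • (v - ∑ j ∈ Finset.univ.erase i, v j • Pi.single j 1) := by
      rw [sub_eq_of_eq_add e.symm, smul_smul, hc, one_smul]
    rw [this]
    refine P.smul_mem _ (P.sub_mem h₂ (P.sum_mem fun j hj ↦ P.smul_mem _ (h₁ j ?_)))
    simpa using hj
  rw [eq_top_iff]
  intro w _
  rw [pi_eq_sum_univ' w]
  refine P.sum_mem fun j _ ↦ P.smul_mem _ ?_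
  by_cases e : j = i
  · rw [e]; exact h₃
  · exact h₁ j e

/-- The minors of the contraction map vanish if they do for generators and for a frame of the
quotient by `v`. -/
theorem det_evalForm_eq_zero {n : ℕ} {v : Fin 5 → A} {i : Fin 5} (hv : IsUnit (v i))
    {S : Set (Pair → A)}
    (h : ∀ r : Fin n → Pair → A, (∀ a, r a ∈ S) → ∀ σ : Fin n → {j // j ≠ i},
      (Matrix.of fun a c ↦ contract (r a) v (σ c).1).det = 0)
    {r : Fin n → Pair → A} (hr : ∀ a, r a ∈ Submodule.span A S) (w : Fin n → Fin 5 → A) :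
    (Matrix.of fun a c ↦ evalForm v (r a) (w c)).det = 0 := by
  have h₁ : ∀ r : Fin n → Pair → A, (∀ a, r a ∈ S) → ∀ w : Fin n → Fin 5 → A,
      (Matrix.of fun a c ↦ evalForm v (r a) (w c)).det = 0 := by
    intro r hr w
    let F : MultilinearMap A (fun _ : Fin n ↦ Fin 5 → A) A :=
      (Matrix.detRowAlternating (n := Fin n) (R := A)).toMultilinearMap.compLinearMap
        fun _ ↦ LinearMap.pi fun a ↦ evalForm v (r a)
    have hF : ∀ w, (Matrix.of fun a c ↦ evalForm v (r a) (w c)).det = F w := fun w ↦ by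
      rw [← Matrix.det_transpose]; rfl
    rw [hF]
    refine multilinear_eq_zero_of_span F (S := insert v (Set.range fun j : {j // j ≠ i} ↦
      Pi.single j.1 1)) ?_ w fun a ↦ by rw [span_single_ne_insert hv]; trivial
    intro w hw
    rw [← hF]
    -- A column coming from `v` itself is zero because `r(v, v) = 0`, so only the standard vectors
    -- other than the `i`-th matter.
    by_cases hv : ∃ c, w c = v
    · obtain ⟨c, hc⟩ := hv
      apply Matrix.det_eq_zero_of_column_eq_zero c
      intro a
      simp only [Matrix.of_apply, hc, evalForm_self]
    · push Not at hv
      have : ∀ c, ∃ j : {j // j ≠ i}, Pi.single j.1 1 = w c := fun c ↦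
        (hw c).resolve_left (hv c)
      choose σ hσ using this
      simp only [← hσ, evalForm_single]
      exact h r hr σ
  let G : MultilinearMap A (fun _ : Fin n ↦ Pair → A) A :=
    (Matrix.detRowAlternating (n := Fin n) (R := A)).toMultilinearMap.compLinearMap
      fun _ ↦ LinearMap.pi fun c ↦ (evalForm v).flip (w c)
  exact multilinear_eq_zero_of_span G (fun r hr ↦ h₁ r hr w) r hr

theorem map_evalForm {A A' : Type u} [CommRing A] [CommRing A'] (f : A →+* A') (v : Fin 5 → A)
    (r : Pair → A) (w : Fin 5 → A) :
    f (evalForm v r w) = evalForm (fun a ↦ f (v a)) (fun a ↦ f (r a)) (fun a ↦ f (w a)) := by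
  simp [evalForm_apply, map_contract]

theorem map_det_evalForm {A A' : Type u} [CommRing A] [CommRing A'] (f : A →+* A') {n : ℕ}
    (v : Fin 5 → A) (r : Fin n → Pair → A) (w : Fin n → Fin 5 → A) :
    f (Matrix.of fun a c ↦ evalForm v (r a) (w c)).det =
      (Matrix.of fun a c ↦
        evalForm (fun k ↦ f (v k)) (fun k ↦ f (r a k)) (fun k ↦ f (w c k))).det := by
  rw [RingHom.map_det]
  congr 1
  ext a c
  exact map_evalForm f _ _ _

theorem map_det_contract {A A' : Type u} [CommRing A] [CommRing A'] (f : A →+* A') {n : ℕ}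
    (v : Fin 5 → A) (r : Fin n → Pair → A) (σ : Fin n → Fin 5) :
    f (Matrix.of fun a c ↦ contract (r a) v (σ c)).det =
      (Matrix.of fun a c ↦ contract (fun k ↦ f (r a k)) (fun k ↦ f (v k)) (σ c)).det := by
  rw [RingHom.map_det]
  congr 1
  ext a c
  exact map_contract f _ _ _

theorem smul_evalForm (c : A) (v : Fin 5 → A) (r : Pair → A) (w : Fin 5 → A) :
    evalForm (c • v) r w = c * evalForm v r w := by
  simp only [evalForm_apply, contract, Pi.smul_apply, smul_eq_mul, Finset.mul_sum, Finset.sum_mul]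
  exact Finset.sum_congr rfl fun j _ ↦ Finset.sum_congr rfl fun l _ ↦ by ring

theorem smul_det_evalForm (c : A) {n : ℕ} (v : Fin 5 → A) (r : Fin n → Pair → A)
    (w : Fin n → Fin 5 → A) :
    (Matrix.of fun a b ↦ evalForm (c • v) (r a) (w b)).det =
      c ^ n * (Matrix.of fun a b ↦ evalForm v (r a) (w b)).det := by
  have : (Matrix.of fun a b ↦ evalForm (c • v) (r a) (w b)) =
      c • (Matrix.of fun a b ↦ evalForm v (r a) (w b)) := by
    ext a b; simp [smul_evalForm]
  rw [this, Matrix.det_smul, Fintype.card_fin]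

end Minors

/-! ### Degeneracy as a closed condition -/

section Degenerate

variable {𝕜 : Type u} [Field 𝕜] {B : Scheme.{u}} (R : Subbundle B) {Y : Scheme.{u}}

/-- The minors of order `n` of the contraction map `ℛ → v^⊥` vanish over all schemes mapping
to `Y`. -/
def CoordDegenerate (n : ℕ) (b : Y ⟶ B) (v : Y ⟶ PP (Fin 5) 𝕜) : Prop :=
  ∀ ⦃T : Scheme.{u}⦄ (j : T ⟶ Y) (W : B.affineOpens) (e : ⊤ ≤ (j ≫ b) ⁻¹ᵁ W.1) (i : Fin 5)
    (x : Fin 5 → Γ(T, ⊤)), Coord (j ≫ v) i x →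
    ∀ r : Fin n → Pair → Γ(B, W), (∀ a, r a ∈ (R.sections W).toSubmodule) →
    ∀ w : Fin n → Fin 5 → Γ(T, ⊤),
      (Matrix.of fun a c ↦ evalForm x (pullForm (j ≫ b) e (r a)) (w c)).det = 0

variable {R}

theorem CoordDegenerate.comp {n : ℕ} {b : Y ⟶ B} {v : Y ⟶ PP (Fin 5) 𝕜}
    (h : CoordDegenerate R n b v) {T : Scheme.{u}} (j : T ⟶ Y) :
    CoordDegenerate R n (j ≫ b) (j ≫ v) := by
  intro T' j' W e i x hx r hr w
  have e' : ⊤ ≤ ((j' ≫ j) ≫ b) ⁻¹ᵁ W.1 := by rwa [Category.assoc]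
  simp only [pullForm_congr (Category.assoc j' j b).symm e e']
  exact h (j' ≫ j) W e' i x (by rwa [Category.assoc]) r hr w

theorem CoordDegenerate.of_locally {n : ℕ} {b : Y ⟶ B} {v : Y ⟶ PP (Fin 5) 𝕜}
    (H : ∀ y : Y, ∃ V : Y.Opens, y ∈ V ∧ CoordDegenerate R n (V.ι ≫ b) (V.ι ≫ v)) :
    CoordDegenerate R n b v := by
  intro T j W e i x hx r hr w
  apply section_eq_of_locally_top
  intro t
  obtain ⟨V, hy, hV⟩ := H (j t)
  refine ⟨j ⁻¹ᵁ V, hy, ?_⟩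
  rw [map_det_evalForm, map_zero]
  simp only [pullForm_comp_top _ _ _ (top_le_comp (j ⁻¹ᵁ V).ι e)]
  have e₁ : (j ∣_ V) ≫ V.ι ≫ v = (j ⁻¹ᵁ V).ι ≫ j ≫ v := by
    rw [← Category.assoc, morphismRestrict_ι, Category.assoc]
  have e₂ : (j ∣_ V) ≫ V.ι ≫ b = (j ⁻¹ᵁ V).ι ≫ j ≫ b := by
    rw [← Category.assoc, morphismRestrict_ι, Category.assoc]
  have e' : ⊤ ≤ ((j ∣_ V) ≫ V.ι ≫ b) ⁻¹ᵁ W.1 := by rw [e₂]; exact top_le_comp _ e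
  simp only [pullForm_congr e₂.symm _ e']
  exact hV (j ∣_ V) W e' i _ (by rw [e₁]; exact hx.comp _) r hr _

theorem CoordDegenerate.of_coord {n : ℕ} {b : Y ⟶ B} {v : Y ⟶ PP (Fin 5) 𝕜} {W : B.affineOpens}
    (e : ⊤ ≤ b ⁻¹ᵁ W.1) {κ : Type*} {r : κ → Pair → Γ(B, W)}
    (hr : (R.sections W).toSubmodule ≤ Submodule.span Γ(B, W) (Set.range r)) {i : Fin 5}
    {x : Fin 5 → Γ(Y, ⊤)} (hx : Coord v i x)
    (h : ∀ (ρ : Fin n → κ) (σ : Fin n → {j // j ≠ i}),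
      (Matrix.of fun a c ↦ contract (pullForm b e (r (ρ a))) x (σ c).1).det = 0) :
    CoordDegenerate R n b v := by
  intro T j W' e' i' x' hx' r' hr' w
  obtain ⟨c, rfl⟩ := (hx.comp j).exists_smul hx'.mem
  rw [smul_det_evalForm]
  convert mul_zero _
  apply section_eq_of_locally_top
  intro t
  choose V htV hV using fun a ↦ exists_pullForm_mem_span R (j ≫ b) (top_le_comp j e) e' hr (hr' a) t
  -- Each of the `n` forms lies in the span of the generators only near `t`; the finite intersection
  -- serves all of them at once.
  let V₀ : T.Opens := Finset.univ.inf V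
  have ht : t ∈ V₀ := by
    have : ∀ s : Finset (Fin n), t ∈ s.inf V := by
      intro s
      induction s using Finset.induction_on with
      | empty => trivial
      | insert a s _ ih => rw [Finset.inf_insert]; exact ⟨htV a, ih⟩
    exact this _
  refine ⟨V₀, ht, ?_⟩
  rw [map_det_evalForm, map_zero]
  simp only [pullForm_comp_top _ _ _ (top_le_comp V₀.ι e')]
  refine det_evalForm_eq_zero (i := i)
    (S := Set.range fun k ↦ pullForm (V₀.ι ≫ j ≫ b) (top_le_comp _ (top_le_comp j e)) (r k))
    ((hx.comp j).comp V₀.ι).isUnit ?_ (fun a ↦ ?_) _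
  · intro r₁ hr₁ σ
    choose ρ hρ using hr₁
    obtain rfl : (fun a ↦ pullForm (V₀.ι ≫ j ≫ b) (top_le_comp _ (top_le_comp j e)) (r (ρ a))) = r₁
        :=
      funext hρ
    have := congr(V₀.ι.appTop.hom (j.appTop.hom $(h ρ σ)))
    rw [map_zero, map_zero] at this
    rw [← this, map_det_contract _ _ _ (fun c ↦ (σ c).1), map_det_contract _ _ _ (fun c ↦ (σ c).1)]
    simp only [← pullForm_comp_top (j ≫ b) V₀.ι (top_le_comp j e)
      (top_le_comp V₀.ι (top_le_comp j e)), ← pullForm_comp_top b j e (top_le_comp j e)]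
  · have hle : V₀ ≤ V a := Finset.inf_le (Finset.mem_univ a)
    have h₁ : T.homOfLE hle ≫ (V a).ι = V₀.ι := Scheme.homOfLE_ι _ _
    have h₂ := map_mem_span (T.homOfLE hle).appTop.hom (hV a)
    have h₃ : T.homOfLE hle ≫ (V a).ι ≫ j ≫ b = V₀.ι ≫ j ≫ b := by rw [← Category.assoc, h₁]
    have k : ∀ {W₁ : B.Opens} (e₁ : ⊤ ≤ (j ≫ b) ⁻¹ᵁ W₁) (r : Pair → Γ(B, W₁)),
        (fun m ↦ (T.homOfLE hle).appTop.hom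
          (pullForm ((V a).ι ≫ j ≫ b) (top_le_comp _ e₁) r m)) =
        pullForm (V₀.ι ≫ j ≫ b) (top_le_comp _ e₁) r := by
      intro W₁ e₁ r
      rw [pullForm_comp_top _ _ _ (top_le_comp _ (top_le_comp _ e₁))]
      exact pullForm_congr h₃ _ _ _
    rw [k e'] at h₂
    refine Submodule.span_mono ?_ h₂
    rintro _ ⟨_, ⟨_, ⟨m, rfl⟩, rfl⟩, rfl⟩
    exact ⟨m, (k (top_le_comp j e) (r m)).symm⟩

variable (R) in
/-- The ideal of minors with respect to generators of `ℛ` and a frame of the quotient of `V₅` by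
the tautological line. -/
theorem isChartIdeal_degenerate (n : ℕ) (b : Y ⟶ B) (v : Y ⟶ PP (Fin 5) 𝕜) {W : B.affineOpens}
    {κ : Type*} {r : κ → Pair → Γ(B, W)}
    (hr : (R.sections W).toSubmodule = Submodule.span Γ(B, W) (Set.range r)) {i : Fin 5}
    {V : Y.Opens} (hb : V ≤ b ⁻¹ᵁ W.1) {x : Fin 5 → Γ(Y, V)} (hx : x ∈ tautLine v V)
    (hx1 : x i = 1) :
    IsChartIdeal (fun ⦃T : Scheme.{u}⦄ (h : T ⟶ Y) ↦ CoordDegenerate R n (h ≫ b) (h ≫ v)) V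
      (Ideal.span {y | ∃ (ρ : Fin n → κ) (σ : Fin n → {j // j ≠ i}),
        y = (Matrix.of fun a c ↦ contract (pullForm b hb (r (ρ a))) x (σ c).1).det}) := by
  intro T h e
  have eb : ⊤ ≤ (h ≫ b) ⁻¹ᵁ W.1 := fun t ht ↦ hb (e ht)
  have hxc : Coord (h ≫ v) i (fun j ↦ (h.appLE V ⊤ e).hom (x j)) :=
    ⟨by rw [hx1, map_one]; exact isUnit_one, tautLine_pullback v h e hx⟩
  rw [Ideal.span_le]
  constructor
  · rintro hh _ ⟨ρ, σ, rfl⟩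
    change (h.appLE V ⊤ e).hom _ = 0
    rw [map_det_contract _ _ _ (fun c ↦ (σ c).1)]
    have e' : ⊤ ≤ (𝟙 T ≫ h ≫ b) ⁻¹ᵁ W.1 := by rwa [Category.id_comp]
    simp only [pullForm_comp b h hb e eb]
    have := hh (𝟙 T) W e' i _ (by simpa using hxc) (fun a ↦ r (ρ a))
      (fun a ↦ by rw [hr]; exact Submodule.subset_span ⟨_, rfl⟩)
      (fun c ↦ Pi.single (σ c).1 1)
    simpa only [evalForm_single, pullForm_congr (Category.id_comp (h ≫ b)) e' eb] using this
  · intro hh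
    refine .of_coord eb hr.le hxc fun ρ σ ↦ ?_
    have : (h.appLE V ⊤ e).hom _ = 0 := hh ⟨ρ, σ, rfl⟩
    rw [map_det_contract _ _ _ (fun c ↦ (σ c).1)] at this
    simpa only [pullForm_comp b h hb e eb] using this

variable (R) in
theorem isClosedLocus_degenerate (n : ℕ) (b : Y ⟶ B) (v : Y ⟶ PP (Fin 5) 𝕜) :
    IsClosedLocus (fun ⦃T : Scheme.{u}⦄ (h : T ⟶ Y) ↦ CoordDegenerate R n (h ≫ b) (h ≫ v)) := by
  refine ⟨fun T T' k h hh ↦ by simpa only [Category.assoc] using hh.comp k,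
    fun T h H ↦ .of_locally (by simpa only [Category.assoc] using H), fun z ↦ ?_⟩
  obtain ⟨a, ha⟩ := PP.exists_mem_chart (v z)
  obtain ⟨W', hW', hzW', -⟩ := exists_affine_le (U := ⊤) (z := b z) trivial
  obtain ⟨V, hV, hy, hle⟩ := exists_affine_le (U := v ⁻¹ᵁ PP.chart 𝕜 a ⊓ b ⁻¹ᵁ W') ⟨ha, hzW'⟩
  obtain ⟨x, hx1, hx, -⟩ := exists_coord_section v (hle.trans inf_le_left)
  exact ⟨V, hV, hy, _, isChartIdeal_degenerate R n b v (W := ⟨W', hW'⟩)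
    (κ := (R.sections ⟨W', hW'⟩).toSubmodule) (r := Subtype.val) (by
      rw [Subtype.range_coe_subtype]; exact (Submodule.span_eq _).symm)
    (hle.trans inf_le_right) hx hx1⟩

/-- Minors lying in `J` is the same as minors vanishing on the subscheme of `J`, so the degeneracy
ideal becomes that of a closed locus and can be computed from one frame on each small affine open.
-/
theorem degeneracyIdeal_eq (s : B ⟶ Spec (.of 𝕜)) (k : ℕ) :
    degeneracyIdeal R s k = sInf {J | CoordDegenerate R (4 - k) (J.subschemeι ≫ BxP.toB s)
      (J.subschemeι ≫ BxP.toPP s)} := by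
  unfold degeneracyIdeal
  congr 1
  ext J
  simp only [Set.mem_ofPred_eq]
  constructor
  · intro h
    apply CoordDegenerate.of_locally
    intro y
    let z := J.subschemeι y
    obtain ⟨a, ha⟩ := PP.exists_mem_chart (BxP.toPP s z)
    obtain ⟨W', hW', hzW', -⟩ := exists_affine_le (U := ⊤) (z := BxP.toB s z) trivial
    obtain ⟨V, hV, hy, hle⟩ := exists_affine_le
      (U := BxP.toPP s ⁻¹ᵁ PP.chart 𝕜 a ⊓ BxP.toB s ⁻¹ᵁ W') ⟨ha, hzW'⟩
    have hb : V ≤ BxP.toB s ⁻¹ᵁ W' := hle.trans inf_le_right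
    obtain ⟨x, hx1, hx, -⟩ := exists_coord_section (BxP.toPP s) (hle.trans inf_le_left)
    refine ⟨J.subschemeι ⁻¹ᵁ V, hy, ?_⟩
    rw [← Category.assoc, ← Category.assoc]
    refine (isChartIdeal_degenerate R (4 - k) (BxP.toB s) (BxP.toPP s) (W := ⟨W', hW'⟩)
      (κ := (R.sections ⟨W', hW'⟩).toSubmodule) (r := Subtype.val) (by
        rw [Subtype.range_coe_subtype]; exact (Submodule.span_eq _).symm) hb hx hx1 _
        (ι_top_le le_rfl)).2 ?_
    rw [Ideal.span_le]
    rintro _ ⟨ρ, σ, rfl⟩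
    have h₁ := h ⟨W', hW'⟩ ⟨V, hV⟩ hb x hx (fun a ↦ (ρ a).1) (fun a ↦ (ρ a).2)
      (fun c ↦ Pi.single (σ c).1 1)
    simp only [← evalForm_apply, evalForm_single] at h₁
    exact (isChartIdeal_ideal J hV ((J.subschemeι ⁻¹ᵁ V).ι ≫ J.subschemeι) (ι_top_le le_rfl)).1
      ⟨_, rfl⟩ h₁
  · intro h W' W e x hx r hr w
    simp only [← evalForm_apply]
    rw [← J.ker_subschemeι_app, RingHom.mem_ker, Scheme.Hom.app_eq_appLE]
    apply section_eq_zero_of_locally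
    intro y
    let U : J.subscheme.Opens := J.subschemeι ⁻¹ᵁ W.1
    obtain ⟨V, i, x₁, hy, -, hx₁⟩ := exists_local_coord (U.ι ≫ J.subschemeι ≫ BxP.toPP s) y
    refine ⟨V, hy, ?_⟩
    have e₂ : ⊤ ≤ ((V.ι ≫ U.ι) ≫ J.subschemeι) ⁻¹ᵁ W.1 := by
      rw [Category.assoc]; exact top_le_comp V.ι (ι_top_le le_rfl)
    have h2 := tautLine_pullback (BxP.toPP s) ((V.ι ≫ U.ι) ≫ J.subschemeι) e₂ hx
    simp only [Category.assoc] at h2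
    obtain ⟨c, hc⟩ := hx₁.exists_smul h2
    have e₁ : ⊤ ≤ ((V.ι ≫ U.ι) ≫ J.subschemeι ≫ BxP.toB s) ⁻¹ᵁ W'.1 := by
      simp only [Category.assoc] at e₂ ⊢
      exact fun t ht ↦ e (e₂ ht)
    have e₃ : ⊤ ≤ (((V.ι ≫ U.ι) ≫ J.subschemeι) ≫ BxP.toB s) ⁻¹ᵁ W'.1 := by
      rwa [Category.assoc]
    rw [appLE_appLE_apply _ _ _ _ e₂, map_det_evalForm]
    simp only [pullForm_comp (BxP.toB s) _ e e₂ e₃]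
    simp only [pullForm_congr (Category.assoc (V.ι ≫ U.ι) J.subschemeι (BxP.toB s)) e₃ e₁]
    have hc' : (fun k ↦ (((V.ι ≫ U.ι) ≫ J.subschemeι).appLE W.1 ⊤ e₂).hom (x k)) = c • x₁ := by
      rw [← hc]
      simp only [Category.assoc]
    rw [hc', smul_det_evalForm, h (V.ι ≫ U.ι) W' e₁ i x₁ (by rwa [Category.assoc]) r hr, mul_zero]

end Degenerate

/-! ### Bivectors `x ∧ u` -/

section WedgeVec

variable {A : Type u} [CommRing A]

/-- The bivector `x ∧ u`. -/
def wedgeVec (x u : Fin 5 → A) : Pair → A := fun a ↦ x a.1.1 * u a.1.2 - x a.1.2 * u a.1.1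

theorem skew_wedgeVec (x u : Fin 5 → A) (k l : Fin 5) :
    skew (wedgeVec x u) k l = x k * u l - x l * u k := by
  unfold skew wedgeVec
  split_ifs with h₁ h₂
  · rfl
  · ring
  · rw [le_antisymm (not_lt.1 h₂) (not_lt.1 h₁)]; ring

theorem wedgeVec_smul (c : A) (x u : Fin 5 → A) : wedgeVec x (c • u) = c • wedgeVec x u := by
  funext a
  simp only [wedgeVec, Pi.smul_apply, smul_eq_mul]; ring

theorem plucker_wedgeVec (x u : Fin 5 → A) (i j l m : Fin 5) :
    plucker (wedgeVec x u) i j l m = 0 := by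
  simp only [plucker, skew_wedgeVec]; ring

theorem wedge_wedgeVec (x u : Fin 5 → A) (i j l : Fin 5) : wedge x (wedgeVec x u) i j l = 0 := by
  simp only [wedge, skew_wedgeVec]; ring

theorem map_wedgeVec {A A' : Type u} [CommRing A] [CommRing A'] (f : A →+* A') (x u : Fin 5 → A) :
    (fun a ↦ f (wedgeVec x u a)) = wedgeVec (fun k ↦ f (x k)) (fun k ↦ f (u k)) := by
  funext a
  simp [wedgeVec]

theorem sum_pair {M : Type*} [AddCommMonoid M] (g : Fin 5 → Fin 5 → M) :
    ∑ a : Pair, g a.1.1 a.1.2 = ∑ i, ∑ j, if i < j then g i j else 0 := by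
  rw [← Fintype.sum_prod_type', ← Finset.sum_filter]
  exact (Finset.sum_subtype (Finset.univ.filter fun p : Fin 5 × Fin 5 ↦ p.1 < p.2) (by simp)
    fun p ↦ g p.1 p.2).symm

/-- Turns orthogonality of a bivector to `ℛ` into linear equations `r(x, u) = 0` on the vector `u`.
-/
theorem pairing_wedgeVec (r : Pair → A) (x u : Fin 5 → A) :
    pairing r (wedgeVec x u) = evalForm x r u := by
  have : ∀ a : Pair, r a * wedgeVec x u a =
      skew r a.1.1 a.1.2 * (x a.1.1 * u a.1.2 - x a.1.2 * u a.1.1) := by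
    rintro ⟨⟨i, j⟩, h⟩
    have h : i < j := h
    simp [skew, wedgeVec, h]
  rw [pairing, Finset.sum_congr rfl fun a _ ↦ this a,
    sum_pair fun i j ↦ skew r i j * (x i * u j - x j * u i), evalForm_apply]
  simp only [contract, skew, Fin.sum_univ_five]
  simp (decide := true) only [↓reduceDIte, ↓reduceIte]
  ring

/-- The component of `x ∧ p` at `(i, k, l)` can be solved for `p_kl` since `x_i = 1`. The vector
found is the `i`-th row of `p`, whose `i`-th entry is zero; this normalization makes `u` unique. -/
theorem eq_wedgeVec_of_wedge_eq_zero {x : Fin 5 → A} {p : Pair → A} {i : Fin 5} (hx : x i = 1)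
    (h : ∀ k l m, wedge x p k l m = 0) : p = wedgeVec x (skew p i) := by
  funext ⟨⟨k, l⟩, hkl⟩
  have hkl : k < l := hkl
  have := h i k l
  simp only [wedge, hx] at this
  have e : skew p k l = p ⟨(k, l), hkl⟩ := by simp [skew, hkl]
  rw [e] at this
  simp only [wedgeVec]
  linear_combination this

theorem skew_self (p : Pair → A) (i : Fin 5) : skew p i i = 0 := by
  simp [skew]

/-- Some entry of `x ∧ u` is a unit if `x i = 1`, `u i = 0` and some entry of `u` is a unit. -/
theorem exists_isUnit_wedgeVec {x u : Fin 5 → A} {i l : Fin 5} (hx : x i = 1) (hu : u i = 0)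
    (hl : IsUnit (u l)) (hil : l ≠ i) : ∃ a, IsUnit (wedgeVec x u a) := by
  rcases lt_or_gt_of_ne hil with h | h
  · refine ⟨⟨(l, i), h⟩, ?_⟩
    simp only [wedgeVec, hx, hu]
    simpa using hl.neg
  · refine ⟨⟨(i, l), h⟩, ?_⟩
    simp only [wedgeVec, hx, hu]
    simpa using hl

end WedgeVec

/-! ### The functor of points of `ℙ_ℳ(𝒰)` -/

section Points

variable {𝕜 : Type u} [Field 𝕜] {B : Scheme.{u}} (R : Subbundle B) (s : B ⟶ Spec (.of 𝕜))

/-- The map `ℙ_ℳ(𝒰) ⟶ ℙ(⋀² V₅)`. -/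
def PMU.toPair : PMU R s ⟶ PP Pair 𝕜 :=
  (flagIdeal R s).subschemeι ≫ pullback.fst _ _ ≫ MM.toPP R s

variable {R s} {T : Scheme.{u}}

theorem mapF_toB : mapF R s ≫ BxP.toB s =
    (flagIdeal R s).subschemeι ≫ pullback.fst _ _ ≫ MM.toB R s := pullback.lift_fst _ _ _

theorem mapF_toPP : mapF R s ≫ BxP.toPP s =
    (flagIdeal R s).subschemeι ≫ pullback.snd _ _ := pullback.lift_snd _ _ _

theorem toPair_toSpec : PMU.toPair R s ≫ PP.toSpec Pair 𝕜 = mapF R s ≫ BxP.toB s ≫ s := by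
  rw [← Category.assoc (mapF R s), mapF_toB]
  have h₁ : MM.toPP R s = pullback.fst _ _ ≫ PPerp.toPP R s := pullback.condition.symm
  simp only [PMU.toPair, h₁, Category.assoc]
  rw [← pullback.condition]

/-- `ℙ_ℳ(𝒰)` is assembled from fiber products and closed immersions, which are monomorphisms, so a
point of it is determined by its images in `B`, `ℙ(V₅)` and `ℙ(⋀² V₅)`. -/
theorem PMU.hom_ext {y y' : T ⟶ PMU R s} (h₁ : y ≫ mapF R s = y' ≫ mapF R s)
    (h₂ : y ≫ PMU.toPair R s = y' ≫ PMU.toPair R s) : y = y' := by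
  have hB := congr($h₁ ≫ BxP.toB s)
  have hV := congr($h₁ ≫ BxP.toPP s)
  simp only [Category.assoc] at hB hV
  rw [mapF_toB] at hB
  rw [mapF_toPP] at hV
  simp only [PMU.toPair] at h₂
  rw [← cancel_mono (flagIdeal R s).subschemeι]
  apply pullback.hom_ext
  · apply pullback.hom_ext
    · rw [← cancel_mono (perpIdeal R s).subschemeι]
      apply pullback.hom_ext
      · simpa only [Category.assoc] using hB
      · have h₃ : MM.toPP R s = pullback.fst _ _ ≫ PPerp.toPP R s := pullback.condition.symm
        rw [h₃] at h₂
        simpa only [Category.assoc] using h₂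
    · rw [← cancel_mono (Gr.ι 𝕜)]
      simpa only [Category.assoc] using h₂
  · simpa only [Category.assoc] using hV

theorem exists_lift_gr {q : T ⟶ PP Pair 𝕜} (h : LineDecomposable q) :
    ∃ g : T ⟶ Gr 𝕜, g ≫ Gr.ι 𝕜 = q :=
  isClosedLocus_decomposable.exists_lift_iff q |>.2 h

/-- The three closed conditions are imposed at the three stages of the construction of `ℙ_ℳ(𝒰)`, and
each lifts the point through the corresponding closed immersion. -/
theorem exists_PMU (h : T ⟶ BxP s) (q : T ⟶ PP Pair 𝕜)
    (hq : q ≫ PP.toSpec Pair 𝕜 = h ≫ BxP.toB s ≫ s) (h₁ : LineInPerp R (h ≫ BxP.toB s) q)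
    (h₂ : LineDecomposable q) (h₃ : LineInBundle (h ≫ BxP.toPP s) q) :
    ∃ y : T ⟶ PMU R s, y ≫ mapF R s = h ∧ y ≫ PMU.toPair R s = q := by
  obtain ⟨g, hg⟩ := exists_lift_gr h₂
  let z : T ⟶ pullback s (PP.toSpec Pair 𝕜) := pullback.lift (h ≫ BxP.toB s) q (by
    rw [hq, Category.assoc])
  have hz₁ : z ≫ pullback.fst _ _ = h ≫ BxP.toB s := pullback.lift_fst _ _ _
  have hz₂ : z ≫ pullback.snd _ _ = q := pullback.lift_snd _ _ _
  obtain ⟨z', hz'⟩ : ∃ z' : T ⟶ PPerp R s, z' ≫ (perpIdeal R s).subschemeι = z :=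
    (isClosedLocus_inPerp (R := R) (pullback.fst s (PP.toSpec Pair 𝕜)) (pullback.snd _ _)
      |>.exists_lift_iff z).2 (by rw [hz₁, hz₂]; exact h₁)
  let m : T ⟶ MM R s := pullback.lift z' g (by
    rw [hg, PPerp.toPP, ← Category.assoc, hz', hz₂])
  have hm₁ : m ≫ MM.toB R s = h ≫ BxP.toB s := by
    rw [MM.toB, ← Category.assoc, pullback.lift_fst, PPerp.toB, ← Category.assoc, hz', hz₁]
  have hm₂ : m ≫ MM.toPP R s = q := by
    rw [MM.toPP, ← Category.assoc, pullback.lift_snd, hg]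
  let f : T ⟶ pullback (MM.toB R s ≫ s) (PP.toSpec (Fin 5) 𝕜) :=
    pullback.lift m (h ≫ BxP.toPP s) (by
      rw [← Category.assoc, hm₁, Category.assoc, Category.assoc, pullback.condition])
  have hf₁ : f ≫ pullback.fst _ _ = m := pullback.lift_fst _ _ _
  have hf₂ : f ≫ pullback.snd _ _ = h ≫ BxP.toPP s := pullback.lift_snd _ _ _
  obtain ⟨y, hy⟩ : ∃ y : T ⟶ PMU R s, y ≫ (flagIdeal R s).subschemeι = f :=
    (isClosedLocus_inBundle (pullback.snd (MM.toB R s ≫ s) (PP.toSpec (Fin 5) 𝕜))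
      (pullback.fst _ _ ≫ MM.toPP R s) |>.exists_lift_iff f).2 (by
        rw [hf₂, ← Category.assoc, hf₁, hm₂]; exact h₃)
  refine ⟨y, ?_, ?_⟩
  · apply pullback.hom_ext
    · rw [Category.assoc]
      erw [mapF_toB]
      rw [← Category.assoc, hy, ← Category.assoc, hf₁, hm₁]
    · rw [Category.assoc]
      erw [mapF_toPP]
      rw [← Category.assoc, hy, hf₂]
  · rw [PMU.toPair, ← Category.assoc, hy, ← Category.assoc, hf₁, hm₂]

variable (R s) in
-- The identity of `ℙ_B(ℛ^⊥)` factors through its closed immersion, so the condition holds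
-- universally there and pulls back to `ℙ_ℳ(𝒰)`.
theorem lineInPerp_PMU : LineInPerp R (mapF R s ≫ BxP.toB s) (PMU.toPair R s) := by
  have h : LineInPerp R ((perpIdeal R s).subschemeι ≫ pullback.fst _ _)
      ((perpIdeal R s).subschemeι ≫ pullback.snd _ _) :=
    (isClosedLocus_inPerp (R := R) (pullback.fst s (PP.toSpec Pair 𝕜)) (pullback.snd _ _)
      |>.exists_lift_iff _).1 ⟨𝟙 _, Category.id_comp _⟩
  rw [← coordInPerp_iff] at h ⊢
  have h' := h.comp ((flagIdeal R s).subschemeι ≫ pullback.fst _ _ ≫ pullback.fst _ _)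
  have e : MM.toPP R s = pullback.fst _ _ ≫ PPerp.toPP R s := pullback.condition.symm
  rw [mapF_toB, PMU.toPair, e]
  simpa only [Category.assoc] using h'

variable (R s) in
theorem lineInBundle_PMU : LineInBundle (mapF R s ≫ BxP.toPP s) (PMU.toPair R s) := by
  have h := (isClosedLocus_inBundle (pullback.snd (MM.toB R s ≫ s) (PP.toSpec (Fin 5) 𝕜))
    (pullback.fst _ _ ≫ MM.toPP R s) |>.exists_lift_iff _).1 ⟨𝟙 _, Category.id_comp _⟩
  rw [mapF_toPP]
  exact h

/-- A bivector `x ∧ u` with `ℛ(x, u) = 0` defines a point of `ℙ_ℳ(𝒰)` over the point `x`. -/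
theorem exists_PMU_of_coord {h : T ⟶ BxP s} {i : Fin 5} {x : Fin 5 → Γ(T, ⊤)}
    (hx : Coord (h ≫ BxP.toPP s) i x) {W : B.affineOpens} (e : ⊤ ≤ (h ≫ BxP.toB s) ⁻¹ᵁ W.1)
    {κ : Type*} {r : κ → Pair → Γ(B, W)}
    (hr : (R.sections W).toSubmodule = Submodule.span Γ(B, W) (Set.range r))
    {u : Fin 5 → Γ(T, ⊤)} {a : Pair} (ha : IsUnit (wedgeVec x u a))
    (hu : ∀ k, evalForm x (pullForm (h ≫ BxP.toB s) e (r k)) u = 0) :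
    ∃ y : T ⟶ PMU R s, y ≫ mapF R s = h ∧ Coord (y ≫ PMU.toPair R s) a (wedgeVec x u) := by
  obtain ⟨q, hq, hqc⟩ := exists_coord (h ≫ BxP.toB s ≫ s) a _ ha
  obtain ⟨y, hy₁, hy₂⟩ := exists_PMU (R := R) h q hq
    ((coordInPerp_iff _ _).1 (.of_coord e hr.le hqc (by
      rintro _ ⟨k, rfl⟩
      rw [pairing_wedgeVec, hu])))
    ((coordDecomposable_iff _).1 (.of_coord hqc (plucker_wedgeVec x u)))
    ((coordInBundle_iff _ _).1 (.of_coord hx hqc (wedge_wedgeVec x u)))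
  exact ⟨y, hy₁, by rwa [hy₂]⟩

theorem PMU.coord_eq_wedgeVec {y : T ⟶ PMU R s} {i : Fin 5} {x : Fin 5 → Γ(T, ⊤)}
    (hx : Coord (y ≫ mapF R s ≫ BxP.toPP s) i x) (hx1 : x i = 1) {a : Pair} {p : Pair → Γ(T, ⊤)}
    (hp : Coord (y ≫ PMU.toPair R s) a p) : p = wedgeVec x (skew p i) := by
  have h := (coordInBundle_iff _ _).2 (lineInBundle_PMU R s)
  exact eq_wedgeVec_of_wedge_eq_zero hx1 (h y i a x p hx hp)

theorem PMU.evalForm_eq_zero {y : T ⟶ PMU R s} {i : Fin 5} {x : Fin 5 → Γ(T, ⊤)}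
    (hx : Coord (y ≫ mapF R s ≫ BxP.toPP s) i x) (hx1 : x i = 1) {a : Pair} {p : Pair → Γ(T, ⊤)}
    (hp : Coord (y ≫ PMU.toPair R s) a p) {W : B.affineOpens}
    (e : ⊤ ≤ (y ≫ mapF R s ≫ BxP.toB s) ⁻¹ᵁ W.1) {r : Pair → Γ(B, W)}
    (hr : r ∈ (R.sections W).toSubmodule) :
    evalForm x (pullForm (y ≫ mapF R s ≫ BxP.toB s) e r) (skew p i) = 0 := by
  rw [← pairing_wedgeVec, ← PMU.coord_eq_wedgeVec hx hx1 hp]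
  exact (coordInPerp_iff _ _).2 (lineInPerp_PMU R s) y W e a p hp r hr

end Points

/-! ### Local frames of `ℛ` -/

section Frames

open scoped LocalizedModule in
/-- A submodule of a free module with projective quotient of constant rank is, up to
multiplication by an element outside a given prime, generated by as many elements as its rank. -/
theorem exists_smul_le_span {A : Type u} [CommRing A] {ι : Type} [Fintype ι] {m n : ℕ}
    (hn : n + m = Fintype.card ι) (N : Module.Grassmannian A (ι → A) m) (p : Ideal A) [p.IsPrime] :
    ∃ f : A, f ∉ p ∧ ∃ r : Fin n → (ι → A), (∀ a, r a ∈ N.toSubmodule) ∧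
      ∀ x ∈ N.toSubmodule, f • x ∈ Submodule.span A (Set.range r) := by
  -- The quotient is projective, so it splits off; this makes the submodule a finite projective
  -- module.
  obtain ⟨g, hg⟩ := Module.projective_lifting_property N.toSubmodule.mkQ LinearMap.id
    N.toSubmodule.mkQ_surjective
  have hg' : ∀ y, N.toSubmodule.mkQ (g y) = y := fun y ↦ LinearMap.congr_fun hg y
  have hN : ∀ x ∈ N.toSubmodule, N.toSubmodule.mkQ x = 0 := fun x hx ↦
    (Submodule.Quotient.mk_eq_zero _).2 hx
  let π : (ι → A) →ₗ[A] N.toSubmodule :=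
    LinearMap.codRestrict _ (LinearMap.id - g ∘ₗ N.toSubmodule.mkQ) (fun x ↦ by
      apply (Submodule.Quotient.mk_eq_zero _).1
      change N.toSubmodule.mkQ (x - g (N.toSubmodule.mkQ x)) = 0
      rw [map_sub, hg', sub_self])
  have hπ' : ∀ x, (π x : ι → A) = x - g (N.toSubmodule.mkQ x) := fun x ↦ rfl
  have hπ : ∀ x : N.toSubmodule, π x = x := by
    intro x
    apply Subtype.ext
    rw [hπ', hN x.1 x.2, map_zero, sub_zero]
  have hproj : Module.Projective A N.toSubmodule :=
    Module.Projective.of_split N.toSubmodule.subtype π (LinearMap.ext hπ)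
  have hfin : Module.Finite A N.toSubmodule :=
    Module.Finite.of_surjective π fun x ↦ ⟨x, hπ x⟩
  -- Ranks add up in this decomposition, which gives the submodule rank `card ι - m = n` at `p`.
  let E : (ι → A) ≃ₗ[A] N.toSubmodule × ((ι → A) ⧸ N.toSubmodule) :=
    LinearEquiv.ofBijective (π.prod N.toSubmodule.mkQ) (by
      constructor
      · rw [injective_iff_map_eq_zero]
        intro x hx
        have h₁ : π x = 0 := congr(($hx).1)
        have h₂ : N.toSubmodule.mkQ x = 0 := congr(($hx).2)
        have h₃ := hπ' x
        rw [h₁, h₂, map_zero, sub_zero] at h₃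
        exact h₃.symm
      · rintro ⟨n, y⟩
        refine ⟨n + g y, Prod.ext ?_ ?_⟩
        · change π (n + g y) = n
          apply Subtype.ext
          rw [hπ', map_add, hN n.1 n.2, hg', zero_add, add_sub_cancel_right]
        · change N.toSubmodule.mkQ (n + g y) = y
          rw [map_add, hN n.1 n.2, hg', zero_add])
  have hrank : Module.rankAtStalk (R := A) N.toSubmodule ⟨p, inferInstance⟩ = n := by
    have : Nontrivial A := ⟨⟨0, 1, fun h ↦ (Ideal.ne_top_iff_one p).1 (Ideal.IsPrime.ne_top ‹_›)
      (h ▸ p.zero_mem)⟩⟩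
    have h₁ := congrFun (Module.rankAtStalk_eq_of_equiv E) ⟨p, inferInstance⟩
    rw [Module.rankAtStalk_prod, Pi.add_apply, N.rankAtStalk_eq,
      Module.rankAtStalk_eq_finrank_of_free] at h₁
    simp at h₁
    omega
  have hfree : Module.Free (Localization.AtPrime p) (LocalizedModule p.primeCompl N.toSubmodule) :=
      by
    have : Module.FinitePresentation A N.toSubmodule :=
      Module.finitePresentation_of_projective _ _
    have h : (⟨p, inferInstance⟩ : PrimeSpectrum A) ∈ Module.freeLocus A N.toSubmodule := by
      rw [Module.freeLocus_eq_univ]; trivial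
    exact h
  have hfin' : Module.Finite (Localization.AtPrime p)
      (LocalizedModule p.primeCompl N.toSubmodule) :=
    Module.Finite.of_isLocalizedModule p.primeCompl
      (LocalizedModule.mkLinearMap p.primeCompl N.toSubmodule)
  let b : Module.Basis (Fin n) (Localization.AtPrime p)
      (LocalizedModule p.primeCompl N.toSubmodule) := Module.finBasisOfFinrankEq _ _ hrank
  choose z hz using fun a ↦ IsLocalizedModule.surj p.primeCompl
    (LocalizedModule.mkLinearMap p.primeCompl N.toSubmodule) (b a)
  -- The numerators `z` of a basis at `p` span the localized module; clearing denominators gives,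
  -- for each `x`, one multiplier outside `p`.
  have key : ∀ x : N.toSubmodule, ∃ f : A, f ∉ p ∧
      f • x.1 ∈ Submodule.span A (Set.range fun a ↦ ((z a).1 : ι → A)) := by
    intro x
    have h₁ : ∀ y : LocalizedModule p.primeCompl N.toSubmodule, ∃ f ∈ p.primeCompl,
        ∃ w ∈ Submodule.span A (Set.range fun a ↦ (z a).1), f • y =
          LocalizedModule.mkLinearMap p.primeCompl N.toSubmodule w := by
      intro y
      rw [← b.sum_repr y]
      have : ∀ t : Finset (Fin n), ∃ f ∈ p.primeCompl,
        ∃ w ∈ Submodule.span A (Set.range fun a ↦ (z a).1), f • ∑ a ∈ t, b.repr y a • b a =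
          LocalizedModule.mkLinearMap p.primeCompl N.toSubmodule w := by
        intro t
        induction t using Finset.induction_on with
        | empty => exact ⟨1, one_mem _, 0, zero_mem _, by simp⟩
        | insert a t hat ih =>
          obtain ⟨f, hf, w, hw, e⟩ := ih
          obtain ⟨⟨c, d⟩, hc⟩ := IsLocalization.surj p.primeCompl (b.repr y a)
          refine ⟨f * (d * (z a).2), mul_mem hf (mul_mem d.2 (z a).2.2),
            ((d : A) * (z a).2) • w + (f * c) • (z a).1, add_mem (Submodule.smul_mem _ _ hw)
              (Submodule.smul_mem _ _ (Submodule.subset_span ⟨a, rfl⟩)), ?_⟩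
          rw [Finset.sum_insert hat, smul_add, map_add, map_smul, map_smul, ← e, ← hz a, add_comm,
            smul_smul, mul_comm _ f]
          congr 1
          rw [Submonoid.smul_def, smul_smul, ← algebraMap_smul (Localization.AtPrime p),
            ← algebraMap_smul (Localization.AtPrime p) (f * c * _), smul_smul]
          congr 1
          simp only [map_mul]
          linear_combination algebraMap A (Localization.AtPrime p) f *
            algebraMap A (Localization.AtPrime p) ((z a).2 : A) * hc
      exact this _
    obtain ⟨f, hf, w, hw, e⟩ := h₁ (LocalizedModule.mkLinearMap p.primeCompl N.toSubmodule x)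
    rw [← map_smul, IsLocalizedModule.eq_iff_exists p.primeCompl] at e
    obtain ⟨c, hc⟩ := e
    refine ⟨c * f, mul_mem c.2 hf, ?_⟩
    have hw' : (w : ι → A) ∈ Submodule.span A (Set.range fun a ↦ ((z a).1 : ι → A)) := by
      have := Submodule.mem_map_of_mem (f := N.toSubmodule.subtype) hw
      rw [Submodule.map_span, ← Set.range_comp] at this
      exact this
    have hc' := congr(($hc : ι → A))
    have : (c * f : A) • x.1 = c.1 • w.1 := by
      rw [mul_smul]
      exact hc'
    rw [this]
    exact Submodule.smul_mem _ _ hw'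
  choose d hd hd' using key
  classical
  obtain ⟨t, ht⟩ := hfin.fg_top
  -- Multiplying the multipliers of finitely many generators gives one valid for all elements, still
  -- outside the prime `p`.
  refine ⟨∏ x ∈ t, d x, ?_, fun a ↦ (z a).1, fun a ↦ (z a).1.2, ?_⟩
  · rw [Ideal.IsPrime.prod_mem_iff]
    rintro ⟨x, _, hx⟩
    exact hd x hx
  · intro x hx
    have : (⟨x, hx⟩ : N.toSubmodule) ∈ Submodule.span A (t : Set N.toSubmodule) := ht ▸ trivial
    have hle : Submodule.span A (t : Set N.toSubmodule) ≤
        (Submodule.span A (Set.range fun a ↦ ((z a).1 : ι → A))).comap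
          ((∏ x ∈ t, d x) • N.toSubmodule.subtype) := by
      rw [Submodule.span_le]
      intro y hy
      have e : ∏ x ∈ t, d x = (∏ x ∈ t.erase y, d x) * d y := (Finset.prod_erase_mul t d hy).symm
      change (∏ x ∈ t, d x) • (y : ι → A) ∈
        Submodule.span A (Set.range fun a ↦ ((z a).1 : ι → A))
      rw [e, mul_smul]
      exact Submodule.smul_mem _ _ (hd' y)
    exact hle this

variable {B : Scheme.{u}} (R : Subbundle B)

/-- Locally the subbundle `ℛ` is generated by three forms. -/
theorem exists_frame (z : B) : ∃ W : B.affineOpens, z ∈ W.1 ∧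
    ∃ r : Fin 3 → Pair → Γ(B, W),
      (R.sections W).toSubmodule = Submodule.span Γ(B, W) (Set.range r) := by
  obtain ⟨W₀, hW₀, hz, -⟩ := exists_affine_le (U := ⊤) (z := z) trivial
  let p := (hW₀.primeIdealOf ⟨z, hz⟩).asIdeal
  obtain ⟨f, hf, r, hr, hspan⟩ := exists_smul_le_span (n := 3) (m := 7) (by decide)
    (R.sections ⟨W₀, hW₀⟩) p
  have hzf : z ∈ B.basicOpen f := by
    have h1 : hW₀.fromSpec (hW₀.primeIdealOf ⟨z, hz⟩) = z := hW₀.fromSpec_primeIdealOf ⟨z, hz⟩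
    have h2 : hW₀.primeIdealOf ⟨z, hz⟩ ∈ hW₀.fromSpec ⁻¹ᵁ B.basicOpen f := by
      rw [hW₀.fromSpec_preimage_basicOpen]
      exact hf
    rw [← h1]
    exact h2
  let W : B.affineOpens := ⟨B.basicOpen f, hW₀.basicOpen f⟩
  have hle : W ≤ ⟨W₀, hW₀⟩ := B.basicOpen_le f
  refine ⟨W, hzf, fun a k ↦ (B.presheaf.map (homOfLE hle).op).hom (r a k), ?_⟩
  rw [R.restrict ⟨W₀, hW₀⟩ W hle]
  apply le_antisymm
  · rw [Submodule.span_le]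
    rintro _ ⟨x, hx, rfl⟩
    have h1 := map_mem_span (B.presheaf.map (homOfLE hle).op).hom (hspan x hx)
    obtain ⟨c, hc⟩ := (isUnit_res_basicOpen f).exists_left_inv
    rw [← Set.range_comp] at h1
    have h2 := Submodule.smul_mem _ c h1
    have e : (c • fun a ↦ (B.presheaf.map (homOfLE hle).op).hom ((f • x) a)) =
        fun a ↦ (B.presheaf.map (homOfLE hle).op).hom (x a) := by
      funext k
      change c * (B.presheaf.map (homOfLE hle).op).hom (f * x k) = _
      rw [map_mul, ← mul_assoc]
      exact (congrArg (· * _) hc).trans (one_mul _)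
    rw [e] at h2
    exact h2
  · rw [Submodule.span_le]
    rintro _ ⟨a, rfl⟩
    exact Submodule.subset_span ⟨r a, hr a, rfl⟩

end Frames

/-! ### Laplace expansion and Cramer's rule for `3 × 4` matrices -/

section SignedMinors

variable {A : Type u} [CommRing A]

/-- The signed maximal minors of a `3 × 4` matrix. -/
def signedMinor (N : Fin 3 → Fin 4 → A) (l : Fin 4) : A :=
  (-1) ^ (l : ℕ) * (Matrix.of fun a c ↦ N a (l.succAbove c)).det

theorem det_cons_eq_sum (N : Fin 3 → Fin 4 → A) (y : Fin 4 → A) :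
    (Matrix.of (Fin.cons y N : Fin 4 → Fin 4 → A)).det = ∑ l, y l * signedMinor N l := by
  rw [Matrix.det_succ_row_zero]
  refine Finset.sum_congr rfl fun l _ ↦ ?_
  have : (Matrix.of (Fin.cons y N : Fin 4 → Fin 4 → A)).submatrix Fin.succ l.succAbove =
      Matrix.of fun a c ↦ N a (l.succAbove c) := by
    ext a c; simp
  rw [this, signedMinor]
  simp only [Matrix.of_apply, Fin.cons_zero]
  ring

/-- Expansion along its first row of a `4 × 4` determinant in which the `a`-th row of `N` is
repeated. -/
theorem sum_mul_signedMinor (N : Fin 3 → Fin 4 → A) (a : Fin 3) :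
    ∑ l, N a l * signedMinor N l = 0 := by
  rw [← det_cons_eq_sum]
  exact Matrix.det_zero_of_row_eq (Fin.succ_ne_zero a).symm (by ext; simp)

/-- Cramer's rule, valid over any ring. Put the `j`-th unit row on top of `N`: the determinant is
the `j`-th minor, the product with `w` is `w_j` times the first unit vector, and the first column of
the adjugate consists of the signed minors. -/
theorem signedMinor_mul_comm {N : Fin 3 → Fin 4 → A} {w : Fin 4 → A}
    (hw : ∀ a, ∑ l, N a l * w l = 0) (j l : Fin 4) :
    signedMinor N j * w l = signedMinor N l * w j := by
  let M : Matrix (Fin 4) (Fin 4) A := Matrix.of (Fin.cons (Pi.single j 1) N)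
  have hdet : M.det = signedMinor N j := by
    rw [det_cons_eq_sum]
    simp [Pi.single_apply]
  have hMw : M.mulVec w = Pi.single 0 (w j) := by
    funext k
    refine Fin.cases ?_ (fun a ↦ ?_) k
    · simp [M, Matrix.mulVec, dotProduct, Pi.single_apply]
    · simpa [M, Matrix.mulVec, dotProduct] using hw a
  have h := congr(($(Matrix.adjugate_mul M)).mulVec w l)
  rw [← Matrix.mulVec_mulVec, hMw, Matrix.mulVec_single, Matrix.smul_mulVec, Matrix.one_mulVec,
    hdet] at h
  simp only [Pi.smul_apply, smul_eq_mul, MulOpposite.smul_eq_mul_unop, MulOpposite.unop_op,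
    Matrix.col_apply] at h
  rw [← h, Matrix.adjugate_fin_succ_eq_det_submatrix, signedMinor]
  have : M.submatrix (Fin.succAbove 0) l.succAbove =
      Matrix.of fun a c ↦ N a (l.succAbove c) := by
    ext a c; simp [M]
  rw [this]
  simp

/-- Three column indices miss some `l`, so the matrix is the one defining the `l`-th minor
multiplied on both sides by matrices selecting rows and columns, with repetitions allowed. -/
theorem det_mem_span_signedMinor (N : Fin 3 → Fin 4 → A) (ρ : Fin 3 → Fin 3) (σ : Fin 3 → Fin 4) :
    (Matrix.of fun a c ↦ N (ρ a) (σ c)).det ∈ Ideal.span (Set.range (signedMinor N)) := by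
  by_cases hσ : ∃ l, ∀ c, σ c ≠ l
  · obtain ⟨l, hl⟩ := hσ
    choose π hπ using fun c ↦ Fin.exists_succAbove_eq (hl c)
    have e : (Matrix.of fun a c ↦ N (ρ a) (σ c)) =
        (1 : Matrix (Fin 3) (Fin 3) A).submatrix ρ (Equiv.refl _) *
          (Matrix.of fun a c ↦ N a (l.succAbove c)) *
          (1 : Matrix (Fin 3) (Fin 3) A).submatrix (Equiv.refl _) π := by
      rw [Matrix.one_submatrix_mul, Matrix.mul_submatrix_one]
      ext a c
      simp [hπ]
    have hm : (Matrix.of fun a c ↦ N a (l.succAbove c)).det = (-1) ^ (l : ℕ) * signedMinor N l := by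
      rw [signedMinor, ← mul_assoc, ← pow_add, ← two_mul, pow_mul]
      simp
    rw [e, Matrix.det_mul, Matrix.det_mul, hm]
    exact Ideal.mul_mem_right _ _ (Ideal.mul_mem_left _ _ (Ideal.mul_mem_left _ _
      (Ideal.subset_span ⟨l, rfl⟩)))
  · push Not at hσ
    exact absurd (Fintype.card_le_of_surjective σ hσ) (by simp)

theorem map_signedMinor {A A' : Type u} [CommRing A] [CommRing A'] (f : A →+* A')
    (N : Fin 3 → Fin 4 → A) (l : Fin 4) :
    f (signedMinor N l) = signedMinor (fun a c ↦ f (N a c)) l := by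
  rw [signedMinor, signedMinor, map_mul, map_pow, map_neg, map_one, RingHom.map_det]
  rfl

/-- The matrix of the contraction map with respect to forms `r` and the standard vectors
different from the `i`-th. -/
def contractMatrix {n : ℕ} (r : Fin n → Pair → A) (x : Fin 5 → A) (i : Fin 5) (a : Fin n)
    (l : Fin 4) : A := contract (r a) x (i.succAbove l)

theorem map_contractMatrix {A A' : Type u} [CommRing A] [CommRing A'] (f : A →+* A') {n : ℕ}
    (r : Fin n → Pair → A) (x : Fin 5 → A) (i : Fin 5) (a : Fin n) (l : Fin 4) :
    f (contractMatrix r x i a l) =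
      contractMatrix (fun a k ↦ f (r a k)) (fun k ↦ f (x k)) i a l := map_contract f _ _ _

theorem evalForm_eq_sum_contractMatrix {n : ℕ} (r : Fin n → Pair → A) (x : Fin 5 → A) {i : Fin 5}
    {u : Fin 5 → A} (hu : u i = 0) (a : Fin n) :
    evalForm x (r a) u = ∑ l, contractMatrix r x i a l * u (i.succAbove l) := by
  rw [evalForm_apply, Fin.sum_univ_succAbove _ i, hu, mul_zero, zero_add]
  rfl

theorem span_minors_eq (r : Fin 3 → Pair → A) (x : Fin 5 → A) (i : Fin 5) :
    Ideal.span {y | ∃ (ρ : Fin 3 → Fin 3) (σ : Fin 3 → {j // j ≠ i}),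
      y = (Matrix.of fun a c ↦ contract (r (ρ a)) x (σ c).1).det} =
    Ideal.span (Set.range (signedMinor (contractMatrix r x i))) := by
  apply le_antisymm
  · rw [Ideal.span_le]
    rintro _ ⟨ρ, σ, rfl⟩
    choose τ hτ using fun c ↦ Fin.exists_succAbove_eq (σ c).2
    simp only [← hτ]
    exact det_mem_span_signedMinor (contractMatrix r x i) ρ τ
  · rw [Ideal.span_le]
    rintro _ ⟨l, rfl⟩
    refine Ideal.mul_mem_left _ _ (Ideal.subset_span ⟨id,
      fun c ↦ ⟨i.succAbove (l.succAbove c), Fin.succAbove_ne _ _⟩, rfl⟩)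

end SignedMinors

/-! ### Nonzerodivisors under open immersions -/

section NonZeroDivisors

variable {T Y : Scheme.{u}}

/-- Stalks on an affine open are localizations, where nonzerodivisors stay nonzerodivisors; open
immersions do not change stalks, and sections are detected by their germs. -/
theorem appLE_mem_nonZeroDivisors (k : T ⟶ Y) [IsOpenImmersion k] {V : Y.Opens}
    (hV : IsAffineOpen V) {a : Γ(Y, V)} (ha : a ∈ nonZeroDivisors Γ(Y, V)) {O : T.Opens}
    (e : O ≤ k ⁻¹ᵁ V) : (k.appLE V O e).hom a ∈ nonZeroDivisors Γ(T, O) := by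
  rw [mem_nonZeroDivisors_iff_right]
  intro z hz
  refine TopCat.Presheaf.section_ext T.sheaf O z 0 fun t ht ↦ ?_
  have ha' : (Y.presheaf.germ V (k t) (e ht)).hom a ∈ nonZeroDivisors (Y.presheaf.stalk (k t)) := by
    let y : V := ⟨k t, e ht⟩
    let := TopCat.Presheaf.algebra_section_stalk Y.presheaf y
    have := hV.isLocalization_stalk y
    exact IsLocalization.map_nonZeroDivisors_le (hV.primeIdealOf y).asIdeal.primeCompl
      (Y.presheaf.stalk y.1) ⟨a, ha, rfl⟩
  have h₁ : (T.presheaf.germ O t ht).hom ((k.appLE V O e).hom a) =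
      (k.stalkMap t).hom ((Y.presheaf.germ V (k t) (e ht)).hom a) := by
    refine Eq.trans ?_ (Scheme.Hom.germ_stalkMap_apply k V t (e ht) a).symm
    exact TopCat.Presheaf.germ_res_apply T.presheaf (homOfLE e) t ht _
  have h₂ := congr((T.presheaf.germ O t ht).hom $hz)
  rw [map_mul, h₁, map_zero] at h₂
  let E := (asIso (k.stalkMap t)).commRingCatIsoToRingEquiv
  have h₃ : E.symm ((T.presheaf.germ O t ht).hom z) * (Y.presheaf.germ V (k t) (e ht)).hom a = 0 :=
      by
    apply E.injective
    rw [map_mul, RingEquiv.apply_symm_apply, map_zero]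
    exact h₂
  have h₄ := (mem_nonZeroDivisors_iff_right.1 ha') _ h₃
  rw [map_eq_zero_iff _ E.symm.injective] at h₄
  exact h₄.trans (map_zero _).symm

theorem res_mem_nonZeroDivisors {V O : Y.Opens} (hV : IsAffineOpen V) {a : Γ(Y, V)}
    (ha : a ∈ nonZeroDivisors Γ(Y, V)) (e : O ≤ V) :
    (Y.presheaf.map (homOfLE e).op).hom a ∈ nonZeroDivisors Γ(Y, O) := by
  have := appLE_mem_nonZeroDivisors (𝟙 Y) hV ha (O := O) e
  have h : (𝟙 Y : Y ⟶ Y).appLE V O e = Y.presheaf.map (homOfLE e).op := by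
    simp only [Scheme.Hom.appLE, Scheme.Hom.id_app]
    exact Category.id_comp _
  rwa [h] at this

end NonZeroDivisors

/-! ### The universal property of the blow up -/

section BlowUpLift

variable {𝕜 : Type u} [Field 𝕜] {B : Scheme.{u}} {R : Subbundle B} {s : B ⟶ Spec (.of 𝕜)}
  {T : Scheme.{u}}

theorem degeneracyIdeal_ideal (k : ℕ) {W : B.affineOpens} {κ : Type*} {r : κ → Pair → Γ(B, W)}
    (hr : (R.sections W).toSubmodule = Submodule.span Γ(B, W) (Set.range r)) {i : Fin 5}
    {V : (BxP s).Opens} (hV : IsAffineOpen V) (hb : V ≤ BxP.toB s ⁻¹ᵁ W.1)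
    {x : Fin 5 → Γ(BxP s, V)} (hx : x ∈ tautLine (BxP.toPP s) V) (hx1 : x i = 1) :
    (degeneracyIdeal R s k).ideal ⟨V, hV⟩ =
      Ideal.span {y | ∃ (ρ : Fin (4 - k) → κ) (σ : Fin (4 - k) → {j // j ≠ i}),
        y = (Matrix.of fun a c ↦ contract (pullForm (BxP.toB s) hb (r (ρ a))) x (σ c).1).det} := by
  rw [degeneracyIdeal_eq]
  exact (isClosedLocus_degenerate R (4 - k) (BxP.toB s) (BxP.toPP s)).sInf_ideal hV
    (isChartIdeal_degenerate R (4 - k) (BxP.toB s) (BxP.toPP s) hr hb hx hx1)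

theorem degeneracyIdeal_one_ideal {W : B.affineOpens} {r : Fin 3 → Pair → Γ(B, W)}
    (hr : (R.sections W).toSubmodule = Submodule.span Γ(B, W) (Set.range r)) {i : Fin 5}
    {V : (BxP s).Opens} (hV : IsAffineOpen V) (hb : V ≤ BxP.toB s ⁻¹ᵁ W.1)
    {x : Fin 5 → Γ(BxP s, V)} (hx : x ∈ tautLine (BxP.toPP s) V) (hx1 : x i = 1) :
    (degeneracyIdeal R s 1).ideal ⟨V, hV⟩ = Ideal.span (Set.range (signedMinor
      (contractMatrix (fun a ↦ pullForm (BxP.toB s) hb (r a)) x i))) := by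
  rw [← span_minors_eq, degeneracyIdeal_ideal 1 hr hV hb hx hx1]

/-- The ideal of the inverse image of `D_1` over a small affine open. -/
theorem comap_degeneracyIdeal_one_ideal (g : T ⟶ BxP s) {W : B.affineOpens}
    {r : Fin 3 → Pair → Γ(B, W)}
    (hr : (R.sections W).toSubmodule = Submodule.span Γ(B, W) (Set.range r)) {i : Fin 5}
    {U : (BxP s).Opens} (hU : IsAffineOpen U) (hb : U ≤ BxP.toB s ⁻¹ᵁ W.1)
    (hi : U ≤ BxP.toPP s ⁻¹ᵁ PP.chart 𝕜 i) {V : T.Opens} (hV : IsAffineOpen V) (hVU : V ≤ g ⁻¹ᵁ U)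
    (hb' : V ≤ (g ≫ BxP.toB s) ⁻¹ᵁ W.1)
    {x : Fin 5 → Γ(T, V)} (hx : x ∈ tautLine (g ≫ BxP.toPP s) V) (hx1 : x i = 1) :
    ((degeneracyIdeal R s 1).comap g).ideal ⟨V, hV⟩ = Ideal.span (Set.range (signedMinor
      (contractMatrix (fun a ↦ pullForm (g ≫ BxP.toB s) hb' (r a)) x i))) := by
  obtain ⟨x₀, hx₀1, hx₀, -⟩ := exists_coord_section (BxP.toPP s) hi
  have h₁ := tautLine_pullback (BxP.toPP s) g hVU hx₀
  have hxx : (fun j ↦ (g.appLE U V hVU).hom (x₀ j)) = x := by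
    funext j
    -- Both vectors are proportional and have `i`-th entry `1`, so they coincide.
    have := tautLine_mul_comm _ h₁ hx i j
    rw [hx1, hx₀1, map_one, mul_one, one_mul] at this
    exact this.symm
  rw [comap_ideal_eq_map _ g hU hV hVU, degeneracyIdeal_one_ideal hr hU hb hx₀ hx₀1,
    Ideal.map_span, ← Set.range_comp]
  congr 1
  congr 1
  funext l
  simp only [Function.comp_apply, map_signedMinor, map_contractMatrix, hxx]
  congr 1
  funext a c
  congr 1
  funext a
  exact pullForm_comp (BxP.toB s) g hb hVU hb' (r a)

theorem exists_small_affine (g : T ⟶ BxP s) (R : Subbundle B) {V₀ : T.Opens} {t : T}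
    (ht : t ∈ V₀) :
    ∃ (W : B.affineOpens) (r : Fin 3 → Pair → Γ(B, W)) (i : Fin 5) (U : (BxP s).Opens)
      (V : T.Opens), (R.sections W).toSubmodule = Submodule.span Γ(B, W) (Set.range r) ∧
      IsAffineOpen U ∧ U ≤ BxP.toB s ⁻¹ᵁ W.1 ∧ U ≤ BxP.toPP s ⁻¹ᵁ PP.chart 𝕜 i ∧
      IsAffineOpen V ∧ V ≤ g ⁻¹ᵁ U ∧ t ∈ V ∧ V ≤ V₀ := by
  obtain ⟨W, hW, r, hr⟩ := exists_frame R (BxP.toB s (g t))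
  obtain ⟨i, hi⟩ := PP.exists_mem_chart (BxP.toPP s (g t))
  obtain ⟨U, hU, htU, hle⟩ := exists_affine_le
    (U := BxP.toPP s ⁻¹ᵁ PP.chart 𝕜 i ⊓ BxP.toB s ⁻¹ᵁ W.1) (z := g t) ⟨hi, hW⟩
  obtain ⟨V, hV, htV, hVle⟩ := exists_affine_le (U := V₀ ⊓ g ⁻¹ᵁ U) (z := t) ⟨ht, htU⟩
  exact ⟨W, r, i, U, V, hr, hU, hle.trans inf_le_right, hle.trans inf_le_left, hV,
    hVle.trans inf_le_right, htV, hVle.trans inf_le_left⟩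

/-- The local description of a morphism such that the inverse image of `D_1` is a Cartier divisor:
the minors are `a u_l` for a nonzerodivisor `a` and a vector `u` one of whose entries is a unit. -/
theorem exists_cartier_data (g : T ⟶ BxP s) (hg : IsCartier ((degeneracyIdeal R s 1).comap g))
    (t : T) : ∃ (V : T.Opens) (W : B.affineOpens) (r : Fin 3 → Pair → Γ(B, W)) (i : Fin 5)
      (hb : V ≤ (g ≫ BxP.toB s) ⁻¹ᵁ W.1) (x : Fin 5 → Γ(T, V)) (a : Γ(T, V)) (u : Fin 4 → Γ(T, V))
      (l₀ : Fin 4), IsAffineOpen V ∧ t ∈ V ∧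
      (R.sections W).toSubmodule = Submodule.span Γ(B, W) (Set.range r) ∧
      x ∈ tautLine (g ≫ BxP.toPP s) V ∧ x i = 1 ∧ a ∈ nonZeroDivisors Γ(T, V) ∧ IsUnit (u l₀) ∧
      ∀ l, signedMinor (contractMatrix (fun b ↦ pullForm (g ≫ BxP.toB s) hb (r b)) x i) l =
        a * u l := by
  obtain ⟨V₀, ht₀, a₀, ha₀, hI₀⟩ := hg t
  obtain ⟨W, r, i, U, V, hr, hU, hb, hi, hV, hVU, htV, hle⟩ := exists_small_affine g R ht₀
  have hb' : V ≤ (g ≫ BxP.toB s) ⁻¹ᵁ W.1 := fun t ht ↦ hb (hVU ht)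
  have hi' : V ≤ (g ≫ BxP.toPP s) ⁻¹ᵁ PP.chart 𝕜 i := fun t ht ↦ hi (hVU ht)
  obtain ⟨x, hx1, hx, -⟩ := exists_coord_section (g ≫ BxP.toPP s) hi'
  let a : Γ(T, V) := (T.presheaf.map (homOfLE hle).op).hom a₀
  have ha : a ∈ nonZeroDivisors Γ(T, V) := res_mem_nonZeroDivisors V₀.2 ha₀ hle
  have hI : ((degeneracyIdeal R s 1).comap g).ideal ⟨V, hV⟩ = Ideal.span {a} := by
    have := ((degeneracyIdeal R s 1).comap g).map_ideal (U := ⟨V, hV⟩) (V := V₀) hle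
    rw [← this, hI₀, Ideal.map_span, Set.image_singleton]
    rfl
  rw [comap_degeneracyIdeal_one_ideal g hr hU hb hi hV hVU hb' hx hx1] at hI
  set m := signedMinor (contractMatrix (fun b ↦ pullForm (g ≫ BxP.toB s) hb' (r b)) x i) with hm
  have h₁ : ∀ l, ∃ u, m l = a * u := by
    intro l
    have : m l ∈ Ideal.span {a} := hI ▸ Ideal.subset_span ⟨l, rfl⟩
    obtain ⟨u, hu⟩ := Ideal.mem_span_singleton'.1 this
    exact ⟨u, by rw [mul_comm]; exact hu.symm⟩
  choose u hu using h₁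
  -- The generator `a` is itself a combination of the minors `a * u l`; cancelling `a` shows that
  -- the `u l` generate the unit ideal, so one of them is invertible at `t`.
  have h₂ : ∃ c : Fin 4 → Γ(T, V), ∑ l, c l * u l = 1 := by
    have : a ∈ Ideal.span (Set.range m) := hI ▸ Ideal.mem_span_singleton_self a
    obtain ⟨c, hc⟩ := (Ideal.mem_span_range_iff_exists_fun).1 this
    refine ⟨c, ?_⟩
    have h : (∑ l, c l * u l - 1) * a = 0 := by
      rw [sub_mul, Finset.sum_mul, one_mul, ← hc, sub_eq_zero]
      refine Finset.sum_congr rfl fun l _ ↦ ?_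
      rw [hc, hu]
      ring
    exact sub_eq_zero.1 ((mem_nonZeroDivisors_iff_right.1 ha) _ h)
  obtain ⟨c, hc⟩ := h₂
  obtain ⟨l₀, hl₀⟩ : ∃ l, t ∈ T.basicOpen (u l) := by
    by_contra hcon
    push Not at hcon
    simp only [Scheme.mem_basicOpen _ _ _ htV] at hcon
    have h1 := congr((T.presheaf.germ V t htV).hom $hc)
    rw [map_one, map_sum] at h1
    have h2 : ∑ l, (T.presheaf.germ V t htV).hom (c l * u l) ∈
        IsLocalRing.maximalIdeal (T.presheaf.stalk t) := by
      refine sum_mem fun l _ ↦ ?_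
      rw [map_mul]
      exact Ideal.mul_mem_left _ _ ((IsLocalRing.mem_maximalIdeal _).2 (hcon l))
    rw [h1] at h2
    exact (Ideal.ne_top_iff_one _).1 (IsLocalRing.maximalIdeal.isMaximal _).ne_top h2
  have hle' : T.basicOpen (u l₀) ≤ V := T.basicOpen_le _
  refine ⟨T.basicOpen (u l₀), W, r, i, hle'.trans hb',
    fun j ↦ (T.presheaf.map (homOfLE hle').op).hom (x j), (T.presheaf.map (homOfLE hle').op).hom a,
    fun j ↦ (T.presheaf.map (homOfLE hle').op).hom (u j), l₀, hV.basicOpen _, hl₀, hr,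
    tautLine_restrict _ hle' hx, by simp only [hx1, map_one], res_mem_nonZeroDivisors hV ha hle',
    isUnit_res_basicOpen _, fun l ↦ ?_⟩
  rw [← map_mul, ← hu, hm, map_signedMinor]
  simp only [map_contractMatrix]
  congr 1
  funext b l
  congr 1
  funext b k
  exact (appLE_map_apply (g ≫ BxP.toB s) hb' hle' _ _).symm

/-- Uniqueness of the lift in algebraic form: Cramer's rule makes the kernel vector of `p`
proportional to `a u`, and `a` cancels. -/
theorem exists_eq_smul_wedgeVec {A : Type u} [CommRing A] {r : Fin 3 → Pair → A} {x : Fin 5 → A}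
    {i : Fin 5} {a : A} (ha : a ∈ nonZeroDivisors A) {u : Fin 4 → A} {l₀ : Fin 4}
    (hu : IsUnit (u l₀)) (hm : ∀ l, signedMinor (contractMatrix r x i) l = a * u l)
    {p : Pair → A} (hp : p = wedgeVec x (skew p i))
    (hr : ∀ b, evalForm x (r b) (skew p i) = 0) :
    ∃ c : A, p = c • wedgeVec x (i.insertNth 0 u : Fin 5 → A) := by
  have h₁ : ∀ b, ∑ l, contractMatrix r x i b l * skew p i (i.succAbove l) = 0 := fun b ↦ by
    rw [← evalForm_eq_sum_contractMatrix r x (skew_self p i), hr]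
  have h₂ : ∀ j l, u j * skew p i (i.succAbove l) = u l * skew p i (i.succAbove j) := by
    intro j l
    have := signedMinor_mul_comm h₁ j l
    rw [hm, hm] at this
    refine sub_eq_zero.1 ((mem_nonZeroDivisors_iff_right.1 ha) _ ?_)
    linear_combination this
  obtain ⟨d, hd⟩ := hu.exists_left_inv
  refine ⟨d * skew p i (i.succAbove l₀), ?_⟩
  rw [← wedgeVec_smul]
  nth_rewrite 1 [hp]
  congr 1
  funext j
  refine Fin.succAboveCases i ?_ (fun l ↦ ?_) j
  · simp [skew_self]
  · simp only [Pi.smul_apply, Fin.insertNth_apply_succAbove, smul_eq_mul]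
    linear_combination (-skew p i (i.succAbove l)) * hd + d * h₂ l₀ l

/-- Existence of the lift in algebraic form: the vector of minors `a u` lies in the kernel, and `a`
cancels. -/
theorem wedgeVec_evalForm_eq_zero {A : Type u} [CommRing A] {r : Fin 3 → Pair → A} {x : Fin 5 → A}
    {i : Fin 5} {a : A} (ha : a ∈ nonZeroDivisors A) {u : Fin 4 → A}
    (hm : ∀ l, signedMinor (contractMatrix r x i) l = a * u l) (b : Fin 3) :
    evalForm x (r b) (i.insertNth 0 u : Fin 5 → A) = 0 := by
  rw [evalForm_eq_sum_contractMatrix r x (Fin.insertNth_apply_same i 0 u)]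
  simp only [Fin.insertNth_apply_succAbove]
  refine (mem_nonZeroDivisors_iff_right.1 ha) _ ?_
  rw [Finset.sum_mul, ← sum_mul_signedMinor (contractMatrix r x i) b]
  refine Finset.sum_congr rfl fun l _ ↦ ?_
  rw [hm]; ring

/-- Locally both lifts have coordinates which are multiples of the same `x ∧ u`. The open immersion
`j` is allowed because gluing compares lifts on overlaps; there `a` remains a nonzerodivisor. -/
theorem PMU.eq_of_cartier {T' : Scheme.{u}} {g : T ⟶ BxP s}
    (hg : IsCartier ((degeneracyIdeal R s 1).comap g)) (j : T' ⟶ T) [IsOpenImmersion j]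
    {y y' : T' ⟶ PMU R s} (hy : y ≫ mapF R s = j ≫ g) (hy' : y' ≫ mapF R s = j ≫ g) : y = y' := by
  apply hom_ext_of_locally
  intro t
  obtain ⟨V, W, r, i, hb, x, a, u, l₀, hV, htV, hr, hx, hx1, ha, hu, hm⟩ :=
    exists_cartier_data g hg (j t)
  obtain ⟨b, hbt⟩ := PP.exists_mem_chart ((y ≫ PMU.toPair R s) t)
  obtain ⟨b', hbt'⟩ := PP.exists_mem_chart ((y' ≫ PMU.toPair R s) t)
  let O : T'.Opens := j ⁻¹ᵁ V ⊓ ((y ≫ PMU.toPair R s) ⁻¹ᵁ PP.chart 𝕜 b ⊓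
    (y' ≫ PMU.toPair R s) ⁻¹ᵁ PP.chart 𝕜 b')
  refine ⟨O, ⟨htV, hbt, hbt'⟩, ?_⟩
  have hOV : O ≤ j ⁻¹ᵁ V := inf_le_left
  let k : O.toScheme ⟶ T := O.ι ≫ j
  have e : ⊤ ≤ k ⁻¹ᵁ V := ι_top_le hOV
  let φ := (k.appLE V ⊤ e).hom
  have hφa : φ a ∈ nonZeroDivisors Γ(O, ⊤) := appLE_mem_nonZeroDivisors k hV ha e
  have key : ∀ {z : O.toScheme ⟶ PMU R s} {b : Pair} {p : Pair → Γ(O, ⊤)},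
      z ≫ mapF R s = k ≫ g → Coord (z ≫ PMU.toPair R s) b p →
      ∃ c : Γ(O, ⊤), p = c • wedgeVec (fun l ↦ φ (x l))
        (i.insertNth 0 (fun l ↦ φ (u l)) : Fin 5 → Γ(O, ⊤)) := by
    intro z b p hz hp
    have hzc : Coord (z ≫ mapF R s ≫ BxP.toPP s) i (fun l ↦ φ (x l)) := by
      refine ⟨by rw [hx1, map_one]; exact isUnit_one, ?_⟩
      rw [← Category.assoc, hz, Category.assoc]
      exact tautLine_pullback _ k e hx
    have hzB : z ≫ mapF R s ≫ BxP.toB s = k ≫ g ≫ BxP.toB s := by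
      rw [← Category.assoc, hz, Category.assoc]
    have eb : ⊤ ≤ (k ≫ g ≫ BxP.toB s) ⁻¹ᵁ W.1 := fun t ht ↦ hb (e ht)
    have eb' : ⊤ ≤ (z ≫ mapF R s ≫ BxP.toB s) ⁻¹ᵁ W.1 := by rw [hzB]; exact eb
    have hx1' : (fun l ↦ φ (x l)) i = 1 := by simp only [hx1, map_one]
    refine exists_eq_smul_wedgeVec hφa (l₀ := l₀) (hu.map φ)
      (r := fun b ↦ pullForm (z ≫ mapF R s ≫ BxP.toB s) eb' (r b)) (fun l ↦ ?_)
      (PMU.coord_eq_wedgeVec hzc hx1' hp)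
      (fun c ↦ PMU.evalForm_eq_zero hzc hx1' hp eb' (by
        rw [hr]; exact Submodule.subset_span ⟨c, rfl⟩))
    rw [← map_mul, ← hm, map_signedMinor]
    simp only [map_contractMatrix]
    congr 1
    funext c l
    congr 1
    funext c
    rw [pullForm_congr hzB eb' eb]
    exact (pullForm_comp (g ≫ BxP.toB s) k hb e eb (r c)).symm
  obtain ⟨p, -, hp⟩ := exists_coord_of_le (y ≫ PMU.toPair R s) (V := O) (i := b)
    (inf_le_right.trans inf_le_left)
  obtain ⟨p', -, hp'⟩ := exists_coord_of_le (y' ≫ PMU.toPair R s) (V := O) (i := b')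
    (inf_le_right.trans inf_le_right)
  rw [← Category.assoc] at hp hp'
  have h₁ : (O.ι ≫ y) ≫ mapF R s = k ≫ g := by rw [Category.assoc, hy, ← Category.assoc]
  have h₂ : (O.ι ≫ y') ≫ mapF R s = k ≫ g := by rw [Category.assoc, hy', ← Category.assoc]
  obtain ⟨c, hc⟩ := key h₁ hp
  obtain ⟨c', hc'⟩ := key h₂ hp'
  refine PMU.hom_ext (h₁.trans h₂.symm) (hp.hom_ext' hp' ?_ fun l ↦ ?_)
  · rw [Category.assoc (O.ι ≫ y), Category.assoc (O.ι ≫ y'), toPair_toSpec,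
      ← Category.assoc (O.ι ≫ y), h₁, ← Category.assoc (O.ι ≫ y'), h₂]
  · rw [hc, hc']
    simp only [Pi.smul_apply, smul_eq_mul]
    ring

theorem existsUnique_lift_of_cartier (g : T ⟶ BxP s)
    (hg : IsCartier ((degeneracyIdeal R s 1).comap g)) : ∃! h : T ⟶ PMU R s, h ≫ mapF R s = g := by
  obtain ⟨y, hy⟩ := exists_glue (T := T) (G := PMU R s) (fun T' j y ↦ y ≫ mapF R s = j ≫ g)
    (fun T' T'' k _ j y h ↦ by rw [Category.assoc, h, Category.assoc])
    (fun T' j _ y y' h h' ↦ PMU.eq_of_cartier hg j h h') (by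
      intro t
      obtain ⟨V, W, r, i, hb, x, a, u, l₀, hV, htV, hr, hx, hx1, ha, hu, hm⟩ :=
        exists_cartier_data g hg t
      have e : ⊤ ≤ V.ι ⁻¹ᵁ V := V.ι_preimage_self.ge
      let φ := (V.ι.appLE V ⊤ e).hom
      have hx1' : (fun l ↦ φ (x l)) i = 1 := by simp only [hx1, map_one]
      have hxc : Coord ((V.ι ≫ g) ≫ BxP.toPP s) i (fun l ↦ φ (x l)) := by
        refine ⟨by rw [hx1, map_one]; exact isUnit_one, ?_⟩
        rw [Category.assoc]
        exact tautLine_pullback _ V.ι e hx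
      have eb : ⊤ ≤ (V.ι ≫ g ≫ BxP.toB s) ⁻¹ᵁ W.1 := fun t ht ↦ hb (e ht)
      have eb' : ⊤ ≤ ((V.ι ≫ g) ≫ BxP.toB s) ⁻¹ᵁ W.1 := by rwa [Category.assoc]
      obtain ⟨b, hbu⟩ := exists_isUnit_wedgeVec (x := fun l ↦ φ (x l))
        (u := (i.insertNth 0 (fun l ↦ φ (u l)) : Fin 5 → Γ(V, ⊤))) (i := i)
        (l := i.succAbove l₀) hx1' (by simp) (by
          rw [Fin.insertNth_apply_succAbove]; exact hu.map φ) (Fin.succAbove_ne _ _)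
      obtain ⟨y, hy, -⟩ := exists_PMU_of_coord hxc eb' hr hbu
        (wedgeVec_evalForm_eq_zero (appLE_mem_nonZeroDivisors V.ι hV ha e) (fun l ↦ by
          change _ = φ a * φ (u l)
          rw [← map_mul, ← hm, map_signedMinor]
          simp only [map_contractMatrix]
          congr 1
          funext c l
          congr 1
          funext c
          rw [pullForm_congr (Category.assoc _ _ _) eb' eb]
          exact (pullForm_comp (g ≫ BxP.toB s) V.ι hb e eb (r c)).symm))
      exact ⟨V, htV, y, hy⟩)
  have hy' : y ≫ mapF R s = g := hom_ext_of_locally fun t ↦ by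
    obtain ⟨V, htV, hV⟩ := hy t
    exact ⟨V, htV, by rw [← Category.assoc, hV]⟩
  refine ⟨y, hy', fun y' h ↦ PMU.eq_of_cartier hg (𝟙 T) (by rw [h, Category.id_comp])
    (by rw [hy', Category.id_comp])⟩

end BlowUpLift

/-! ### Depth, dimension and regular sequences -/

section Depth

open IsLocalRing RingTheory.Sequence
open scoped Pointwise

variable {A : Type u} [CommRing A] [IsLocalRing A] [IsNoetherianRing A]

variable (A) in
/-- The depth of the module `M` is at least `n`. -/
def DepthGE (M : Type u) [AddCommGroup M] [Module A M] (n : ℕ) : Prop :=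
  ∃ rs : List A, rs.length = n ∧ (∀ a ∈ rs, a ∈ maximalIdeal A) ∧ IsRegular M rs

variable {M : Type u} [AddCommGroup M] [Module A M] [Module.Finite A M]

theorem smul_top_lt_top [Nontrivial M] : maximalIdeal A • (⊤ : Submodule A M) < ⊤ :=
  lt_top_iff_ne_top.2 (Submodule.top_ne_ideal_smul_of_le_jacobson_annihilator
    (maximalIdeal_le_jacobson _)).symm

open Abelian in
/-- Dividing by a nonzerodivisor decreases the depth by at most one. -/
theorem DepthGE.quotSMulTop {n : ℕ} (h : DepthGE A M (n + 1)) {x : A} (hx : x ∈ maximalIdeal A)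
    (hreg : IsSMulRegular M x) : DepthGE A (QuotSMulTop x M) n := by
  have : Nontrivial M := h.choose_spec.2.2.nontrivial
  have : Nontrivial (QuotSMulTop x M) := nontrivial_quotSMulTop_of_mem_maximalIdeal M hx
  -- Depth at least `n + 1` means vanishing of Ext groups into `M` in degrees up to `n`. The long
  -- exact sequence of multiplication by `x` places the group for `M / xM` in degree `i` between
  -- those for `M` in degrees `i` and `i + 1`.
  have h₁ := ((ModuleCat.exists_isRegular_tfae (maximalIdeal A) (n + 1) (ModuleCat.of A M)
    smul_top_lt_top).out 3 1).1 h
  refine ((ModuleCat.exists_isRegular_tfae (maximalIdeal A) n (ModuleCat.of A (QuotSMulTop x M))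
    smul_top_lt_top).out 1 3).1 fun i hi ↦ ?_
  have zero1 := AddCommGrpCat.isZero_of_iff_subsingleton.mpr (h₁ i (by omega))
  have zero2 := AddCommGrpCat.isZero_of_iff_subsingleton.mpr (h₁ (i + 1) (by omega))
  have hreg' : IsSMulRegular (ModuleCat.of A M) x := hreg
  exact AddCommGrpCat.subsingleton_of_isZero <| ShortComplex.Exact.isZero_of_both_zeros
    ((Ext.covariant_sequence_exact₃' _ hreg'.smulShortComplex_shortExact) i (i + 1) rfl)
    (zero1.eq_zero_of_src _) (zero2.eq_zero_of_tgt _)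

/-- The depth is at most the dimension of every associated prime. -/
theorem DepthGE.le_ringKrullDim {n : ℕ} (h : DepthGE A M n) {p : Ideal A}
    (hp : p ∈ associatedPrimes A M) : (n : WithBot ℕ∞) ≤ ringKrullDim (A ⧸ p) := by
  induction n generalizing M p with
  | zero =>
    have := IsAssociatedPrime.isPrime hp
    have : Nontrivial (A ⧸ p) := Ideal.Quotient.nontrivial_iff.2 this.ne_top
    exact ringKrullDim_nonneg_of_nontrivial
  | succ n ih =>
    obtain ⟨rs, hlen, hmem, hreg⟩ := h
    obtain ⟨x, rs, rfl⟩ := List.exists_cons_of_length_eq_add_one hlen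
    rw [isRegular_cons_iff] at hreg
    have hx : x ∈ maximalIdeal A := hmem x (by simp)
    have hprime := IsAssociatedPrime.isPrime hp
    obtain ⟨-, a, ha⟩ := isAssociatedPrime_iff.1 (AssociatedPrimes.mem_iff.1 hp)
    have hxp : x ∉ p := by
      intro hxp
      have h₁ : x ∈ ⋃ q ∈ associatedPrimes A M, (q : Set A) := Set.mem_biUnion hp hxp
      rw [biUnion_associatedPrimes_eq_compl_regular] at h₁
      exact h₁ hreg.1
    -- the elements killed by `p`
    let N : Submodule A M := Submodule.torsionBySet A M p
    have hN : ∀ z, z ∈ N ↔ ∀ c ∈ p, c • z = 0 := fun z ↦ by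
      simp only [N, Submodule.mem_torsionBySet_iff]
      exact ⟨fun h c hc ↦ h ⟨c, hc⟩, fun h c ↦ h c.1 c.2⟩
    have ha0 : a ≠ 0 := by
      rintro rfl
      apply hprime.ne_top
      rw [ha, eq_top_iff]
      intro c _
      simp [Submodule.mem_colon_singleton]
    have haN : a ∈ N := (hN a).2 fun c hc ↦ by
      rw [ha, Submodule.mem_colon_singleton] at hc
      simpa using hc
    -- If `N` were contained in `xM`, regularity of `x` would give `N = xN`, and then `N = 0` by
    -- Nakayama's lemma.
    obtain ⟨z, hzN, hz⟩ : ∃ z ∈ N, z ∉ x • (⊤ : Submodule A M) := by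
      by_contra hcon
      push Not at hcon
      apply ha0
      have : N = ⊥ := by
        refine Submodule.eq_bot_of_le_smul_of_le_jacobson_bot (Ideal.span {x}) N
          (IsNoetherian.noetherian N) (fun z hz ↦ ?_) ?_
        · obtain ⟨w, -, hw⟩ := Submodule.mem_smul_pointwise_iff_exists _ _ _ |>.1 (hcon z hz)
          rw [Submodule.ideal_span_singleton_smul, Submodule.mem_smul_pointwise_iff_exists]
          refine ⟨w, (hN w).2 fun c hc ↦ ?_, hw⟩
          apply hreg.1
          change x • c • w = x • 0
          rw [smul_zero, smul_comm, hw]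
          exact (hN z).1 hz c hc
        · rw [Ideal.span_singleton_le_iff_mem]
          exact maximalIdeal_le_jacobson _ hx
      rw [this] at haN
      exact (Submodule.mem_bot A).1 haN
    have hz' : (Submodule.Quotient.mk z : QuotSMulTop x M) ≠ 0 := by
      rwa [Ne, Submodule.Quotient.mk_eq_zero]
    -- This associated prime of `M / xM` contains `p` and also `x`, which is not in `p`; so passing
    -- from `p` to `p'` lowers the dimension by at least one, and induction applies to `p'`.
    obtain ⟨p', hp', hle⟩ := exists_le_isAssociatedPrime_of_isNoetherianRing A
      (Submodule.Quotient.mk z : QuotSMulTop x M) hz'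
    have hkill : ∀ c : A, c • (Submodule.Quotient.mk z : QuotSMulTop x M) = 0 → c ∈ p' := by
      intro c hc
      apply hle
      rw [Submodule.mem_colon_singleton, hc]
      exact zero_mem _
    have hpp' : p ≤ p' := fun c hc ↦ hkill c (by
      rw [← Submodule.Quotient.mk_smul, (hN z).1 hzN c hc, Submodule.Quotient.mk_zero])
    have hxp' : x ∈ p' := hkill x (by
      rw [← Submodule.Quotient.mk_smul, Submodule.Quotient.mk_eq_zero]
      exact Submodule.smul_mem_pointwise_smul _ _ _ trivial)
    have h₂ := ih (M := QuotSMulTop x M) ⟨rs, by simpa using hlen,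
      fun a ha ↦ hmem a (by simp [ha]), hreg.2⟩ (AssociatedPrimes.mem_iff.2 hp')
    have h₃ : ringKrullDim (A ⧸ p') + 1 ≤ ringKrullDim (A ⧸ p) := by
      have : IsDomain (A ⧸ p) := Ideal.Quotient.isDomain p
      have hx0 : Ideal.Quotient.mk p x ∈ nonZeroDivisors (A ⧸ p) :=
        mem_nonZeroDivisors_of_ne_zero (by rwa [Ne, Ideal.Quotient.eq_zero_iff_mem])
      refine le_trans ?_ (ringKrullDim_quotient_succ_le_of_nonZeroDivisor hx0)
      gcongr
      let f : (A ⧸ p) ⧸ Ideal.span {Ideal.Quotient.mk p x} →+* A ⧸ p' :=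
        Ideal.Quotient.lift _ (Ideal.Quotient.factor hpp') (by
          intro c hc
          obtain ⟨d, rfl⟩ := Ideal.mem_span_singleton'.1 hc
          rw [map_mul, Ideal.Quotient.factor_mk, Ideal.Quotient.eq_zero_iff_mem.2 hxp', mul_zero])
      exact ringKrullDim_le_of_surjective f (Ideal.Quotient.lift_surjective_of_surjective _ _
        (Ideal.Quotient.factor_surjective hpp'))
    refine le_trans ?_ h₃
    push_cast
    gcongr

/-- In a Cohen–Macaulay module, elements which cut down the dimension as much as possible form a
regular sequence, and the quotient is Cohen–Macaulay. -/
theorem DepthGE.quotient_ofList {d : ℕ} (h : DepthGE A M d) (hdim : Module.supportDim A M ≤ d)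
    (xs : List A) (hxs : ∀ x ∈ xs, x ∈ maximalIdeal A)
    (hle : Module.supportDim A (M ⧸ (Ideal.ofList xs • ⊤ : Submodule A M)) + xs.length ≤ d) :
    ∃ e : ℕ, e + xs.length = d ∧ DepthGE A (M ⧸ (Ideal.ofList xs • ⊤ : Submodule A M)) e := by
  induction xs generalizing M d with
  | nil =>
    refine ⟨d, by simp, ?_⟩
    obtain ⟨rs, h₁, h₂, h₃⟩ := h
    refine ⟨rs, h₁, h₂, ?_⟩
    have e : (M ⧸ (Ideal.ofList ([] : List A) • ⊤ : Submodule A M)) ≃ₗ[A] M :=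
      Submodule.quotEquivOfEqBot _ (by simp)
    exact (e.isRegular_congr rs).2 h₃
  | cons x xs ih =>
    have hx : x ∈ maximalIdeal A := hxs x (by simp)
    have hnt : Nontrivial M := h.choose_spec.2.2.nontrivial
    let E := Submodule.quotOfListConsSMulTopEquivQuotSMulTopInner M x xs
    rw [Module.supportDim_eq_of_equiv E, List.length_cons] at hle
    have hxs' : ∀ y ∈ xs, y ∈ maximalIdeal A := fun y hy ↦ hxs y (by simp [hy])
    -- Each element lowers the dimension by at most one. As the whole list lowers it by its length,
    -- the first element must already lower it by one.
    have key : ∀ (ys : List A) (M : Type u) [AddCommGroup M] [Module A M] [Module.Finite A M],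
        (∀ y ∈ ys, y ∈ maximalIdeal A) → Module.supportDim A M ≤
          Module.supportDim A (M ⧸ (Ideal.ofList ys • ⊤ : Submodule A M)) + ys.length := by
      intro ys
      induction ys with
      | nil =>
        intro M _ _ _ _
        have e : (M ⧸ (Ideal.ofList ([] : List A) • ⊤ : Submodule A M)) ≃ₗ[A] M :=
          Submodule.quotEquivOfEqBot _ (by simp)
        rw [Module.supportDim_eq_of_equiv e]
        simp
      | cons y ys ihy =>
        intro M _ _ _ hys
        rw [Module.supportDim_eq_of_equiv
          (Submodule.quotOfListConsSMulTopEquivQuotSMulTopInner M y ys)]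
        refine (Module.supportDim_le_supportDim_quotSMulTop_succ (hys y (by simp))).trans ?_
        have := ihy (QuotSMulTop y M) fun z hz ↦ hys z (by simp [hz])
        rw [List.length_cons, Nat.cast_add, ← add_assoc]
        exact add_le_add_left this _
    have hd1 : Module.supportDim A (QuotSMulTop x M) + 1 ≤ d := by
      refine le_trans ?_ hle
      rw [Nat.cast_add, ← add_assoc]
      exact add_le_add_left (key xs _ hxs') _
    -- A zero divisor `x` would lie in an associated prime `p`. Then `A ⧸ p` has dimension at least
    -- `d` by the depth, but at most that of the support of `M / xM`, which is below `d`.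
    have hreg : IsSMulRegular M x := by
      by_contra hcon
      have h₁ : x ∈ ({r | IsSMulRegular M r}ᶜ : Set A) := hcon
      rw [← biUnion_associatedPrimes_eq_compl_regular] at h₁
      obtain ⟨p, hp, hxp⟩ := Set.mem_iUnion₂.1 h₁
      have hprime := IsAssociatedPrime.isPrime hp
      have h₂ := h.le_ringKrullDim hp
      have h₃ : ringKrullDim (A ⧸ p) ≤ Module.supportDim A (QuotSMulTop x M) := by
        rw [Module.supportDim_eq_ringKrullDim_quotient_annihilator]
        have hpm : (⟨p, hprime⟩ : PrimeSpectrum A) ∈ Module.support A (QuotSMulTop x M) := by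
          rw [Module.support_quotSMulTop]
          refine ⟨?_, by simpa using hxp⟩
          rw [Module.mem_support_iff_of_finite]
          rw [← Submodule.annihilator_top]
          exact IsAssociatedPrime.annihilator_le hp
        rw [Module.mem_support_iff_of_finite] at hpm
        exact ringKrullDim_le_of_surjective (Ideal.Quotient.factor hpm)
          (Ideal.Quotient.factor_surjective hpm)
      have h₄ : ((d + 1 : ℕ) : WithBot ℕ∞) ≤ (d : ℕ) := by
        refine le_trans ?_ hd1
        push_cast
        gcongr
        exact h₂.trans h₃
      have : d + 1 ≤ d := by exact_mod_cast h₄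
      omega
    have hnt' : Nontrivial (QuotSMulTop x M) := nontrivial_quotSMulTop_of_mem_maximalIdeal M hx
    have hdpos : 1 ≤ d := by
      have h₅ : (0 : WithBot ℕ∞) ≤ Module.supportDim A (QuotSMulTop x M) := by
        rw [Module.supportDim_eq_ringKrullDim_quotient_annihilator]
        have : Nontrivial (A ⧸ Module.annihilator A (QuotSMulTop x M)) :=
          Ideal.Quotient.nontrivial_iff.2 (by
            rw [Ne, Module.annihilator_eq_top_iff]
            exact not_subsingleton _)
        exact ringKrullDim_nonneg_of_nontrivial
      have : ((1 : ℕ) : WithBot ℕ∞) ≤ (d : ℕ) := by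
        refine le_trans ?_ hd1
        simpa using add_le_add_left h₅ 1
      exact_mod_cast this
    obtain ⟨d', rfl⟩ : ∃ d', d = d' + 1 := ⟨d - 1, by omega⟩
    have cancel : ∀ a : WithBot ℕ∞, a + 1 ≤ ((d' + 1 : ℕ) : WithBot ℕ∞) → a ≤ (d' : ℕ) := by
      intro a ha
      induction a with
      | bot => exact bot_le
      | coe a =>
        have : a + 1 ≤ ((d' + 1 : ℕ) : ℕ∞) := by exact_mod_cast ha
        have : a ≤ (d' : ℕ∞) := by
          push_cast at this
          exact (ENat.add_le_add_iff_right (by simp)).1 this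
        exact_mod_cast this
    obtain ⟨e, he, h₆⟩ := ih (h.quotSMulTop hx hreg) (cancel _ hd1) hxs' (cancel _ (by
      rw [add_assoc]; exact_mod_cast hle))
    refine ⟨e, by rw [List.length_cons]; omega, ?_⟩
    obtain ⟨rs, k₁, k₂, k₃⟩ := h₆
    exact ⟨rs, k₁, k₂, (E.isRegular_congr rs).2 k₃⟩

end Depth

/-! ### Polynomial rings over Cohen–Macaulay rings -/

section Polynomial

open IsLocalRing Polynomial Ideal RingTheory.Sequence

theorem IsCohenMacaulayLocalRing.of_ringEquiv {A B : Type u} [CommRing A] [CommRing B]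
    (h : IsCohenMacaulayLocalRing A) (e : A ≃+* B) : IsCohenMacaulayLocalRing B := by
  have := h.isLocalRing
  have := h.isNoetherianRing
  have hB : IsLocalRing B := e.isLocalRing
  refine ⟨hB, isNoetherianRing_of_ringEquiv A e, ?_⟩
  obtain ⟨rs, h₁, h₂, h₃⟩ := h.exists_regular
  refine ⟨rs.map e, fun b hb ↦ ?_, ?_, ?_⟩
  · obtain ⟨a, ha, rfl⟩ := List.mem_map.1 hb
    have := h₁ a ha
    rw [mem_maximalIdeal, mem_nonunits_iff] at this ⊢
    simpa using this
  · refine (AddEquiv.isRegular_congr (e := e.toAddEquiv) (as := rs) (bs := rs.map e) ?_).1 h₂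
    rw [List.forall₂_map_right_iff]
    exact List.forall₂_same.2 fun a _ x ↦ by simp
  · rw [List.length_map, h₃, ringKrullDim_eq_of_ringEquiv e]

/-- A ring with Cohen–Macaulay local rings. -/
structure IsCohenMacaulayRing (A : Type u) [CommRing A] : Prop where
  isNoetherianRing : IsNoetherianRing A
  localization : ∀ (p : Ideal A) [p.IsPrime], IsCohenMacaulayLocalRing (Localization.AtPrime p)

theorem IsCohenMacaulayRing.of_ringEquiv {A B : Type u} [CommRing A] [CommRing B]
    (h : IsCohenMacaulayRing A) (e : A ≃+* B) : IsCohenMacaulayRing B := by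
  have := h.isNoetherianRing
  refine ⟨isNoetherianRing_of_ringEquiv A e, fun p hp ↦ ?_⟩
  refine (h.localization (p.comap e)).of_ringEquiv (Localization.localRingEquiv _ p e rfl)

/-- A regular sequence of length `dim S` stays weakly regular in `S[X]` by flatness. If `Q` is
extended from `S` it already has the length of the height of `Q`; otherwise `Q` is the extension
plus one monic `y`, which is appended to the sequence, and the height is larger by one. -/
theorem isCohenMacaulayLocalRing_polynomial {S : Type u} [CommRing S] [IsLocalRing S]
    (h : IsCohenMacaulayLocalRing S) (Q : Ideal S[X]) [Q.IsPrime]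
    (hQ : Q.comap C = maximalIdeal S) : IsCohenMacaulayLocalRing (Localization.AtPrime Q) := by
  have := h.isNoetherianRing
  obtain ⟨rs, hrs, hreg, hlen⟩ := h.exists_regular
  refine ⟨inferInstance, IsLocalization.isNoetherianRing Q.primeCompl _ inferInstance, ?_⟩
  have hmem : ∀ a ∈ rs.map (algebraMap S S[X]), a ∈ Q := by
    intro b hb
    obtain ⟨a, ha, rfl⟩ := List.mem_map.1 hb
    have := hrs a ha
    rwa [← hQ] at this
  have hw : IsWeaklyRegular S[X] (rs.map (algebraMap S S[X])) := hreg.1.of_flat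
  have hlen' : (rs.length : WithBot ℕ∞) = (maximalIdeal S).height := by
    rw [hlen, maximalIdeal_height_eq_ringKrullDim]
  have key : ∀ l : List S[X], IsWeaklyRegular S[X] l → (∀ a ∈ l, a ∈ Q) →
      (l.length : WithBot ℕ∞) = Q.height →
      ∃ rs : List (Localization.AtPrime Q), (∀ a ∈ rs, a ∈ maximalIdeal (Localization.AtPrime Q)) ∧
        IsRegular (Localization.AtPrime Q) rs ∧
        (rs.length : WithBot ℕ∞) = ringKrullDim (Localization.AtPrime Q) := by
    intro l h₁ h₂ h₃
    refine ⟨l.map (algebraMap _ _), fun b hb ↦ ?_,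
      h₁.isRegular_of_isLocalization_of_mem (Localization.AtPrime Q) Q h₂, ?_⟩
    · obtain ⟨a, ha, rfl⟩ := List.mem_map.1 hb
      exact (IsLocalization.AtPrime.to_map_mem_maximal_iff _ Q a).2 (h₂ a ha)
    · rw [List.length_map, h₃, IsLocalization.AtPrime.ringKrullDim_eq_height Q]
  have hle : (maximalIdeal S).map C ≤ Q := by rw [← hQ]; exact map_comap_le
  by_cases heq : Q = (maximalIdeal S).map C
  · refine key _ hw hmem ?_
    rw [List.length_map, hlen', heq, height_map_C]
  · have hlt := lt_of_le_of_ne hle (Ne.symm heq)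
    have : (comap C Q).IsMaximal := by simpa [hQ] using maximalIdeal.isMaximal S
    obtain ⟨y, hy, hspan⟩ := Polynomial.exists_monic_span_sup_map_eq S Q this (by simpa [hQ])
    have hlies : Q.LiesOver (maximalIdeal S) := ⟨hQ.symm⟩
    refine key (rs.map (algebraMap S S[X]) ++ [y]) ?_ ?_ ?_
    · rw [isWeaklyRegular_append_iff, isWeaklyRegular_singleton_iff]
      refine ⟨hw, ?_⟩
      rw [isSMulRegular_iff_right_eq_zero_of_smul]
      intro f hf
      obtain ⟨f, rfl⟩ := Submodule.Quotient.mk_surjective _ f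
      rw [← Submodule.Quotient.mk_smul, Submodule.Quotient.mk_eq_zero] at hf
      rw [Submodule.Quotient.mk_eq_zero]
      rw [← Ideal.map_ofList, smul_eq_mul, Ideal.mul_top] at hf ⊢
      -- Modulo the extended ideal one computes in polynomials over the quotient of `S`, where `y`
      -- is still monic and hence a nonzerodivisor.
      have hm : ∀ g : S[X], g ∈ (ofList rs).map (algebraMap S S[X]) ↔
          g.map (Ideal.Quotient.mk (ofList rs)) = 0 := by
        intro g
        rw [Polynomial.algebraMap_eq, Ideal.mem_map_C_iff, Polynomial.ext_iff]
        simp [Ideal.Quotient.eq_zero_iff_mem]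
      rw [hm] at hf ⊢
      rw [smul_eq_mul, Polynomial.map_mul] at hf
      exact (hy.map _).mul_right_eq_zero_iff.1 hf
    · intro a ha
      rcases List.mem_append.1 ha with ha | ha
      · exact hmem a ha
      · rw [List.mem_singleton.1 ha, hspan]
        exact Ideal.mem_sup_right (Ideal.mem_span_singleton_self y)
    · rw [List.length_append, List.length_map, List.length_singleton, Nat.cast_add, hlen',
        Nat.cast_one]
      norm_cast
      refine le_antisymm ?_ ?_
      · rw [← height_map_C (maximalIdeal S)]
        exact height_add_one_le_of_lt_of_isPrime hlt
      -- By going down, the excess of the height of `Q` is its height in the fiber ring. There `Q`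
      -- is generated by the class of `y`, so Krull's principal ideal theorem bounds it by one.
      · rw [height_eq_height_add_of_liesOver_of_hasGoingDown (maximalIdeal S) Q]
        gcongr
        have : (Q.map (Ideal.Quotient.mk ((maximalIdeal S).map (algebraMap S S[X])))).IsPrime :=
          Ideal.map_isPrime_of_surjective Ideal.Quotient.mk_surjective (by rw [mk_ker]; exact hle)
        have hmap : Q.map (Ideal.Quotient.mk ((maximalIdeal S).map (algebraMap S S[X]))) =
            Ideal.span {Ideal.Quotient.mk _ y} := by
          nth_rw 1 [hspan]
          rw [Ideal.map_sup, hQ, Polynomial.algebraMap_eq, Ideal.map_quotient_self, bot_sup_eq,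
            Ideal.map_span, Set.image_singleton]
        rw [hmap] at this ⊢
        refine Ideal.height_span_singleton_le_one fun hu ↦ this.ne_top ?_
        exact Ideal.span_singleton_eq_top.2 hu

open Polynomial in
attribute [local instance] Polynomial.algebra Polynomial.isLocalization in
-- Localizing the coefficients at the contraction of `p` reduces to a local coefficient ring and a
-- prime lying over its maximal ideal.
theorem IsCohenMacaulayRing.polynomial {A : Type u} [CommRing A] (h : IsCohenMacaulayRing A) :
    IsCohenMacaulayRing A[X] := by
  have := h.isNoetherianRing
  refine ⟨inferInstance, fun p hp ↦ ?_⟩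
  let q := p.comap C
  let S := (Localization.AtPrime q)[X]
  let pc := Submonoid.map Polynomial.C.toMonoidHom q.primeCompl
  have : IsLocalization pc S := Polynomial.isLocalization _ _
  let pS := p.map (algebraMap A[X] S)
  have disj : Disjoint (pc : Set A[X]) (p : Set A[X]) := by
    simpa [pc, q] using! Set.disjoint_image_left.mpr
      (Set.disjoint_compl_left_iff_subset.mpr (fun _ a ↦ a))
  have : pS.IsPrime := IsLocalization.isPrime_of_isPrime_disjoint pc _ _ ‹_› disj
  have : IsLocalization.AtPrime (Localization.AtPrime pS) p := by
    convert IsLocalization.isLocalization_isLocalization_atPrime_isLocalization pc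
      (Localization.AtPrime pS) pS
    exact (IsLocalization.under_map_of_isPrime_disjoint pc _ ‹_› disj).symm
  have eq : comap C pS = maximalIdeal (Localization.AtPrime q) := by
    rw [← IsLocalization.map_under q.primeCompl _ (comap C pS),
      ← IsLocalization.map_under q.primeCompl _ (maximalIdeal (Localization.AtPrime q))]
    simp only [comap_comap, S, pS]
    rw [← Polynomial.algebraMap_eq (R := Localization.AtPrime q),
      ← IsScalarTower.algebraMap_eq A (Localization.AtPrime q) (Localization.AtPrime q)[X],
      IsScalarTower.algebraMap_eq A A[X] (Localization.AtPrime q)[X], ← comap_comap,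
      ← Ideal.under_def A[X], IsLocalization.under_map_of_isPrime_disjoint pc _ ‹_› disj]
    simp [q, IsLocalization.AtPrime.under_maximalIdeal (Localization.AtPrime q) q]
  exact (isCohenMacaulayLocalRing_polynomial (h.localization q) pS eq).of_ringEquiv
    (IsLocalization.algEquiv p.primeCompl
      (Localization.AtPrime pS) (Localization.AtPrime p)).toRingEquiv

theorem IsCohenMacaulayRing.mvPolynomial {A : Type u} [CommRing A] (h : IsCohenMacaulayRing A)
    (n : ℕ) : IsCohenMacaulayRing (MvPolynomial (Fin n) A) := by
  induction n with
  | zero => exact h.of_ringEquiv (MvPolynomial.isEmptyRingEquiv A (Fin 0)).symm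
  | succ n ih => exact ih.polynomial.of_ringEquiv (MvPolynomial.finSuccEquiv A n).symm.toRingEquiv

end Polynomial

/-! ### Heights of primes containing linear forms -/

section LinearForms

open IsLocalRing Ideal RingTheory.Sequence

theorem height_add_length_le {α : Type*} [Preorder α] (p : LTSeries α) {n : ℕ∞}
    (h : n ≤ Order.height p.head) : n + p.length ≤ Order.height p.last := by
  have key : ∀ i : ℕ, ∀ hi : i < p.length + 1, n + i ≤ Order.height (p ⟨i, hi⟩) := by
    intro i
    induction i with
    | zero => intro hi; simpa [RelSeries.head] using h
    | succ i ih =>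
      intro hi
      have h₁ := ih (by omega)
      have h₂ : p ⟨i, by omega⟩ < p ⟨i + 1, hi⟩ := p.strictMono (by simp)
      refine le_trans ?_ (Order.height_add_one_le h₂)
      push_cast
      rw [← add_assoc]
      gcongr
  exact key p.length (by omega)

/-- If all the primes containing `J` have height at least `n`, then the dimension of `R ⧸ J` is at
most `dim R - n`. -/
theorem ringKrullDim_quotient_add_le {R : Type u} [CommRing R] (J : Ideal R) (n : ℕ)
    (h : ∀ p : Ideal R, p.IsPrime → J ≤ p → (n : ℕ∞) ≤ p.height) :
    ringKrullDim (R ⧸ J) + n ≤ ringKrullDim R := by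
  rw [ringKrullDim_quotient]
  rcases isEmpty_or_nonempty (PrimeSpectrum.zeroLocus (R := R) J) with he | he
  · rw [Order.krullDim_eq_bot]
    simp
  rw [Order.krullDim_eq_iSup_length, ringKrullDim]
  have key : ∀ l : LTSeries (PrimeSpectrum.zeroLocus (R := R) J),
      ((l.length + n : ℕ) : WithBot ℕ∞) ≤ Order.krullDim (PrimeSpectrum R) := by
    -- A chain of primes over `J` starts at a prime of height at least `n`, so it can be prolonged
    -- downwards by `n` steps.
    intro l
    let l' : LTSeries (PrimeSpectrum R) := l.map Subtype.val (fun _ _ h ↦ h)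
    have h₁ := height_add_length_le l' (n := n) (by
      have h₂ := h l.head.1.asIdeal l.head.1.2 l.head.2
      rwa [PrimeSpectrum.height_eq_orderHeight] at h₂)
    refine le_trans ?_ (Order.height_le_krullDim l'.last)
    rw [add_comm]
    exact_mod_cast h₁
  have hne : Nonempty (PrimeSpectrum R) := ⟨he.some.1⟩
  rw [Order.krullDim_eq_iSup_length] at key ⊢
  have h₁ : (⨆ l : LTSeries (PrimeSpectrum.zeroLocus (R := R) J), (l.length : ℕ∞)) + n ≤
      ⨆ l : LTSeries (PrimeSpectrum R), (l.length : ℕ∞) := by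
    rw [ENat.iSup_add]
    refine iSup_le fun l ↦ ?_
    have := key l
    exact_mod_cast this
  exact_mod_cast h₁

open Polynomial in
theorem height_le_height_map_C {A : Type u} [CommRing A] [IsNoetherianRing A] (p : Ideal A)
    [p.IsPrime] : p.height ≤ (p.map (C : A →+* A[X])).height := by
  have : (p.map (C : A →+* A[X])).LiesOver p := ⟨by
    ext a
    rw [Ideal.under_def, Ideal.mem_comap, Polynomial.algebraMap_eq, Ideal.mem_map_C_iff]
    refine ⟨fun h n ↦ ?_, fun h ↦ by simpa using h 0⟩
    rw [coeff_C]
    split_ifs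
    exacts [h, zero_mem _]⟩
  rw [height_eq_height_add_of_liesOver_of_hasGoingDown p (p.map (C : A →+* A[X]))]
  exact le_self_add

open Polynomial in
theorem height_comap_C_le {A : Type u} [CommRing A] [IsNoetherianRing A] (Q : Ideal A[X])
    [Q.IsPrime] : (Q.comap C).height ≤ Q.height :=
  (height_le_height_map_C _).trans (Ideal.height_mono map_comap_le)

open Polynomial in
-- An extended ideal contains the coefficients of its elements, so `Q` is strictly larger than the
-- extension of its contraction.
theorem height_comap_C_add_one_le {A : Type u} [CommRing A] [IsNoetherianRing A] (Q : Ideal A[X])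
    [Q.IsPrime] {a b : A} (h : C a * X + C b ∈ Q) (ha : C a ∉ Q) :
    (Q.comap C).height + 1 ≤ Q.height := by
  have hlt : (Q.comap C).map C < Q := by
    refine lt_of_le_of_ne map_comap_le fun heq ↦ ha ?_
    rw [← heq, Ideal.mem_map_C_iff] at h
    simpa using h 1
  refine le_trans ?_ (height_add_one_le_of_lt_of_isPrime hlt)
  gcongr
  exact height_le_height_map_C _

/-- A prime of a polynomial ring containing `ρ` linear forms which are independent modulo its
contraction to the coefficients has height at least `ρ` in its fiber. -/
theorem height_comap_add_le {A : Type u} [CommRing A] [IsNoetherianRing A] (n : ℕ) :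
    ∀ (ρ : ℕ) (Q : Ideal (MvPolynomial (Fin n) A)) [Q.IsPrime] (c : Fin ρ → Fin n → A)
      (d : Fin ρ → A), (∀ a, ∑ j, MvPolynomial.C (c a j) * MvPolynomial.X j +
        MvPolynomial.C (d a) ∈ Q) →
      (∀ t : Fin ρ → A, (∀ j, MvPolynomial.C (∑ a, t a * c a j) ∈ Q) →
        ∀ a, MvPolynomial.C (t a) ∈ Q) →
      (Q.comap MvPolynomial.C).height + ρ ≤ Q.height := by
  induction n with
  | zero =>
    intro ρ Q hQ c d _ hind
    -- Without variables independence is vacuous: the coefficients `t = 1` would force `1 ∈ Q`.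
    obtain rfl : ρ = 0 := by
      by_contra hρ
      have := hind 1 (fun j ↦ j.elim0) ⟨0, by omega⟩
      exact hQ.ne_top ((Ideal.eq_top_iff_one Q).2 (by simpa using this))
    have h := (MvPolynomial.isEmptyRingEquiv A (Fin 0)).symm.height_comap Q
    have h' : Q.comap (MvPolynomial.isEmptyRingEquiv A (Fin 0)).symm =
        Q.comap MvPolynomial.C := rfl
    rw [← h, h']
    simp
  | succ n ih =>
    intro ρ Q hQ c d hf hind
    let e := (MvPolynomial.finSuccEquiv A n).toRingEquiv
    let Q' : Ideal (Polynomial (MvPolynomial (Fin n) A)) := Q.comap e.symm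
    have hmem : ∀ x, e x ∈ Q' ↔ x ∈ Q := fun x ↦ by simp [Q']
    have hQ' : Q'.IsPrime := inferInstance
    rw [← e.symm.height_comap Q]
    change _ ≤ Q'.height
    let Q₀ : Ideal (MvPolynomial (Fin n) A) := Q'.comap Polynomial.C
    have heC : ∀ a, e (MvPolynomial.C a) = Polynomial.C (MvPolynomial.C a) := fun a ↦ by
      simpa [e] using MvPolynomial.finSuccEquiv_apply A n (MvPolynomial.C a)
    have hC : ∀ a, MvPolynomial.C a ∈ Q₀ ↔ MvPolynomial.C a ∈ Q := fun a ↦ by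
      rw [← hmem, heC]
      rfl
    have hcomap : Q.comap MvPolynomial.C = Q₀.comap MvPolynomial.C := by
      ext a
      exact (hC a).symm
    have heX0 : e (MvPolynomial.X 0) = Polynomial.X :=
      MvPolynomial.finSuccEquiv_X_zero
    have heXs : ∀ j : Fin n, e (MvPolynomial.X j.succ) = Polynomial.C (MvPolynomial.X j) :=
      fun j ↦ MvPolynomial.finSuccEquiv_X_succ
    let g : Fin ρ → MvPolynomial (Fin n) A := fun a ↦
      ∑ j, MvPolynomial.C (c a j.succ) * MvPolynomial.X j + MvPolynomial.C (d a)
    have hg : ∀ a, Polynomial.C (MvPolynomial.C (c a 0)) * Polynomial.X + Polynomial.C (g a) ∈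
        Q' := by
      intro a
      have := (hmem _).2 (hf a)
      rw [map_add, map_sum, Fin.sum_univ_succ] at this
      simp only [map_mul, heC, heX0, heXs] at this
      convert this using 1
      simp only [g, map_add, map_sum, map_mul]
      ring
    -- If the first variable does not occur modulo `Q`, the forms descend to the remaining
    -- variables. Otherwise one form with a leading coefficient outside `Q` is a pivot: it accounts
    -- for one unit of height and the variable is eliminated from the others.
    by_cases hcol : ∀ a, MvPolynomial.C (c a 0) ∈ Q
    · rw [hcomap]
      refine le_trans ?_ (height_comap_C_le Q')
      refine ih ρ Q₀ (fun a j ↦ c a j.succ) d (fun a ↦ ?_) fun t ht a ↦ ?_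
      · have h₁ : Polynomial.C (MvPolynomial.C (c a 0)) ∈ Q' := (hC _).2 (hcol a)
        exact (Ideal.add_mem_iff_right _ (Q'.mul_mem_right _ h₁)).1 (hg a)
      · rw [hC]
        refine hind t (fun j ↦ ?_) a
        refine Fin.cases ?_ (fun j ↦ (hC _).1 (ht j)) j
        rw [map_sum]
        exact Ideal.sum_mem _ fun a _ ↦ by
          rw [map_mul]; exact Q.mul_mem_left _ (hcol a)
    · push Not at hcol
      obtain ⟨a₀, ha₀⟩ := hcol
      obtain ⟨ρ, rfl⟩ : ∃ ρ', ρ = ρ' + 1 := ⟨ρ - 1, by have := a₀.2; omega⟩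
      have h₁ := height_comap_C_add_one_le Q' (hg a₀) fun h ↦ ha₀ ((hC _).1 h)
      rw [hcomap]
      refine le_trans ?_ h₁
      push_cast
      rw [← add_assoc]
      gcongr
      -- Gaussian elimination without division: each other form is multiplied by the pivot
      -- coefficient before a multiple of the pivot form is subtracted.
      refine ih ρ Q₀ (fun b j ↦ c a₀ 0 * c (a₀.succAbove b) j.succ -
        c (a₀.succAbove b) 0 * c a₀ j.succ)
        (fun b ↦ c a₀ 0 * d (a₀.succAbove b) - c (a₀.succAbove b) 0 * d a₀)
        (fun b ↦ ?_) fun t ht b ↦ ?_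
      · have h₂ := Q'.sub_mem (Q'.mul_mem_left (Polynomial.C (MvPolynomial.C (c a₀ 0)))
          (hg (a₀.succAbove b))) (Q'.mul_mem_left
            (Polynomial.C (MvPolynomial.C (c (a₀.succAbove b) 0))) (hg a₀))
        change Polynomial.C _ ∈ Q'
        convert h₂ using 1
        have h₃ : ∑ j, MvPolynomial.C (c a₀ 0 * c (a₀.succAbove b) j.succ -
            c (a₀.succAbove b) 0 * c a₀ j.succ) * MvPolynomial.X j +
            MvPolynomial.C (c a₀ 0 * d (a₀.succAbove b) - c (a₀.succAbove b) 0 * d a₀) =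
            MvPolynomial.C (c a₀ 0) * g (a₀.succAbove b) -
              MvPolynomial.C (c (a₀.succAbove b) 0) * g a₀ := by
          simp only [g, mul_add, Finset.mul_sum, map_sub, map_mul, sub_mul,
            Finset.sum_sub_distrib, mul_assoc]
          ring
        rw [h₃, map_sub, map_mul, map_mul]
        ring
      · rw [hC]
        -- A relation `t` between the eliminated forms comes from this relation between the original
        -- ones; the pivot coefficient then cancels because `Q` is prime.
        have h₂ := hind (a₀.insertNth (-∑ b, t b * c (a₀.succAbove b) 0) fun b ↦ t b * c a₀ 0)
          (fun j ↦ by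
            rw [Fin.sum_univ_succAbove _ a₀]
            simp only [Fin.insertNth_apply_same, Fin.insertNth_apply_succAbove]
            refine Fin.cases ?_ (fun j ↦ ?_) j
            · convert Q.zero_mem
              rw [← map_zero MvPolynomial.C]
              congr 1
              rw [neg_mul, Finset.sum_mul, neg_add_eq_zero]
              exact Finset.sum_congr rfl fun b _ ↦ by ring
            · have h₄ := (hC _).1 (ht j)
              convert h₄ using 2
              rw [neg_mul, Finset.sum_mul, ← Finset.sum_neg_distrib, ← Finset.sum_add_distrib]
              exact Finset.sum_congr rfl fun b _ ↦ by ring) (a₀.succAbove b)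
        rw [Fin.insertNth_apply_succAbove, map_mul] at h₂
        exact (hQ.mem_or_mem h₂).resolve_right ha₀

/-! ### The ideal of the linear forms given by a `3 × 4` matrix -/

section Minors

variable {A : Type u} [CommRing A] (M : Matrix (Fin 3) (Fin 4) A) (l₀ : Fin 4)

/-- The vector with coordinate `1` at `l₀` whose other coordinates are variables. -/
def affineVec : Fin 4 → MvPolynomial (Fin 3) A :=
  l₀.insertNth 1 (fun j ↦ MvPolynomial.X j : Fin 3 → MvPolynomial (Fin 3) A)

/-- The product of the matrix `M` with the vector `affineVec l₀`. -/
def linForm (a : Fin 3) : MvPolynomial (Fin 3) A :=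
  ∑ j, MvPolynomial.C (M a j) * affineVec l₀ j

theorem linForm_eq (a : Fin 3) : linForm M l₀ a =
    ∑ j, MvPolynomial.C (M a (l₀.succAbove j)) * MvPolynomial.X j + MvPolynomial.C (M a l₀) := by
  rw [linForm, Fin.sum_univ_succAbove _ l₀, add_comm]
  simp [affineVec]

/-- Let `q` be the contraction of `Q` and `ρ` the rank over the residue field of `Q` of the matrix
without column `l₀`. Independent rows give height at least that of `q` plus `ρ`. If `ρ ≤ 2`, all
minors of order `ρ + 1` of the full matrix lie in `q`, whose height is then at least `4 - ρ`; if `ρ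
= 3`, the bound `3` is immediate. -/
theorem height_of_linForm_mem [IsNoetherianRing A]
    (hmin : ∀ m : ℕ, 1 ≤ m → m ≤ 3 → ∀ q : Ideal A, q.IsPrime →
      (∀ (a : Fin m → Fin 3) (c : Fin m → Fin 4), (M.submatrix a c).det ∈ q) →
        (5 : ℕ∞) ≤ q.height + m)
    (Q : Ideal (MvPolynomial (Fin 3) A)) [Q.IsPrime] (hQ : ∀ a, linForm M l₀ a ∈ Q) :
    3 ≤ Q.height ∧
      (MvPolynomial.C (M.submatrix id l₀.succAbove).det ∈ Q → 4 ≤ Q.height) := by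
  let K := FractionRing (MvPolynomial (Fin 3) A ⧸ Q)
  let ψ : MvPolynomial (Fin 3) A →+* K :=
    (algebraMap (MvPolynomial (Fin 3) A ⧸ Q) K).comp (Ideal.Quotient.mk Q)
  have hψ : ∀ x, ψ x = 0 ↔ x ∈ Q := fun x ↦ by
    change algebraMap _ K (Ideal.Quotient.mk Q x) = 0 ↔ _
    rw [map_eq_zero_iff _ (IsFractionRing.injective _ K), Ideal.Quotient.eq_zero_iff_mem]
  let φ : A →+* K := ψ.comp MvPolynomial.C
  let q : Ideal A := Q.comap MvPolynomial.C
  have hφ : ∀ x, φ x = 0 ↔ x ∈ q := fun x ↦ hψ _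
  let N : Matrix (Fin 3) (Fin 3) K := (M.submatrix id l₀.succAbove).map φ
  -- independent rows
  have hrow := Submodule.exists_fun_fin_finrank_span_eq K (Set.range N.row)
  rw [← Matrix.rank_eq_finrank_span_row] at hrow
  obtain ⟨f, hfmem, -, hfind⟩ := hrow
  choose σ hσ using hfmem
  have hht : q.height + N.rank ≤ Q.height := by
    refine height_comap_add_le 3 N.rank Q (fun a j ↦ M (σ a) (l₀.succAbove j)) (fun a ↦ M (σ a) l₀)
      (fun a ↦ ?_) fun t ht a ↦ ?_
    · rw [← linForm_eq]
      exact hQ _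
    · have h₁ := Fintype.linearIndependent_iff.1 hfind (fun a ↦ φ (t a)) (by
        ext j
        have h₂ := (hψ _).2 (ht j)
        change φ _ = 0 at h₂
        rw [map_sum] at h₂
        simp only [map_mul] at h₂
        simp only [Finset.sum_apply, Pi.smul_apply, smul_eq_mul, ← hσ]
        exact h₂) a
      exact (hψ _).1 h₁
  have hrank : N.rank ≤ 3 := N.rank_le_width
  have hlin : ∀ a, φ (M a l₀) = - ∑ j, φ (M a (l₀.succAbove j)) * ψ (MvPolynomial.X j) := by
    intro a
    have h₁ := (hψ _).2 (hQ a)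
    rw [linForm_eq, map_add, map_sum] at h₁
    simp only [map_mul] at h₁
    exact eq_neg_of_add_eq_zero_right h₁
  -- Modulo `Q` the linear forms express column `l₀` through the other columns, so `M = N * G` over
  -- `K` and the rank of `M` is at most that of `N`.
  let G : Matrix (Fin 3) (Fin 4) K := Matrix.of fun j ↦
    l₀.insertNth (-ψ (MvPolynomial.X j)) (Pi.single j 1)
  have hG : M.map φ = N * G := by
    ext a c
    rw [Matrix.mul_apply, Matrix.map_apply]
    refine Fin.succAboveCases l₀ ?_ (fun c ↦ ?_) c
    · rw [hlin, ← Finset.sum_neg_distrib]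
      exact Finset.sum_congr rfl fun j _ ↦ by
        simp only [N, G, Matrix.map_apply, Matrix.submatrix_apply, id, Matrix.of_apply,
          Fin.insertNth_apply_same]
        exact (mul_neg _ _).symm
    · simp [N, G, Matrix.submatrix_apply, Pi.single_apply]
  have h4 : N.rank ≤ 2 → 4 ≤ Q.height := by
    intro hr
    have h₁ := hmin (N.rank + 1) (by omega) (by omega) q inferInstance fun a c ↦ by
      rw [← hφ, RingHom.map_det]
      by_contra hdet
      have h₂ := Matrix.rank_of_isUnit (φ.mapMatrix (M.submatrix a c))
        ((Matrix.isUnit_iff_isUnit_det _).2 (isUnit_iff_ne_zero.2 hdet))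
      have h₃ : φ.mapMatrix (M.submatrix a c) = (N * G).submatrix a c := by
        rw [← hG]
        rfl
      rw [h₃, Fintype.card_fin] at h₂
      have h₄ := (Matrix.rank_submatrix_le (N * G) a c).trans (Matrix.rank_mul_le_left N G)
      omega
    have h₂ : (4 : ℕ∞) + 1 ≤ (q.height + N.rank) + 1 := by
      push_cast at h₁
      rw [add_assoc]
      norm_num
      exact h₁
    exact ((ENat.add_le_add_iff_right (by simp)).1 h₂).trans hht
  refine ⟨?_, fun hdet ↦ h4 ?_⟩
  · by_cases hr : N.rank ≤ 2
    · exact le_trans (by norm_num) (h4 hr)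
    · have : N.rank = 3 := by omega
      rw [this] at hht
      exact le_trans le_add_self hht
  -- If the minor lies in `Q`, the square matrix `N` is singular over `K` and its rank cannot be
  -- `3`.
  · by_contra hr
    have h3 : N.rank = 3 := by omega
    have hN : N.det = 0 := by
      rw [← (hψ _).2 hdet]
      exact (RingHom.map_det φ _).symm
    obtain ⟨v, hv, hNv⟩ := Matrix.exists_mulVec_eq_zero_iff.2 hN
    have h₁ := LinearMap.finrank_range_add_finrank_ker N.mulVecLin
    rw [← Matrix.rank, h3, Module.finrank_fin_fun, Nat.add_eq_left, Submodule.finrank_eq_zero] at h₁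
    exact hv (LinearMap.ker_eq_bot'.1 h₁ v hNv)

/-- In the polynomial ring over a Cohen–Macaulay ring, the ideal of the linear forms has the
expected height, hence no embedded primes, and none of its associated primes contains the minor. -/
theorem mem_span_linForm (hA : IsCohenMacaulayRing A)
    (hmin : ∀ m : ℕ, 1 ≤ m → m ≤ 3 → ∀ q : Ideal A, q.IsPrime →
      (∀ (a : Fin m → Fin 3) (c : Fin m → Fin 4), (M.submatrix a c).det ∈ q) →
        (5 : ℕ∞) ≤ q.height + m)
    {z : MvPolynomial (Fin 3) A}
    (hz : MvPolynomial.C (M.submatrix id l₀.succAbove).det * z ∈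
      Ideal.span (Set.range (linForm M l₀))) :
    z ∈ Ideal.span (Set.range (linForm M l₀)) := by
  have := hA.isNoetherianRing
  by_contra hcon
  set I := Ideal.span (Set.range (linForm M l₀)) with hI
  have hz0 : (Ideal.Quotient.mk I z) ≠ 0 := by rwa [Ne, Ideal.Quotient.eq_zero_iff_mem]
  -- If `z` is nonzero modulo the ideal, some associated prime contains its annihilator, hence the
  -- minor. This prime has height at least `4`, which unmixedness will contradict.
  obtain ⟨Q, hQass, hle⟩ := exists_le_isAssociatedPrime_of_isNoetherianRing
    (MvPolynomial (Fin 3) A) _ hz0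
  obtain ⟨hQ, y, hy⟩ := isAssociatedPrime_iff.1 hQass
  obtain ⟨y, rfl⟩ := Ideal.Quotient.mk_surjective y
  have hQy : ∀ a, a ∈ Q ↔ a * y ∈ I := by
    intro a
    rw [hy, Submodule.mem_colon_singleton, Submodule.mem_bot, ← Ideal.Quotient.eq_zero_iff_mem]
    rfl
  have hdet : MvPolynomial.C (M.submatrix id l₀.succAbove).det ∈ Q := by
    apply hle
    rw [Submodule.mem_colon_singleton, Submodule.mem_bot]
    exact Ideal.Quotient.eq_zero_iff_mem.2 hz
  have hIQ : I ≤ Q := fun a ha ↦ (hQy a).2 (I.mul_mem_right _ ha)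
  have hht : 4 ≤ Q.height := (height_of_linForm_mem M l₀ hmin Q
    fun a ↦ hIQ (Ideal.subset_span ⟨a, rfl⟩)).2 hdet
  let R := Localization.AtPrime Q
  obtain ⟨hRL, hRN, rs, h₁, h₂, h₃⟩ := (hA.mvPolynomial 3).localization Q
  have hdim : ringKrullDim R = rs.length := h₃.symm
  let xs : List R := [algebraMap _ R (linForm M l₀ 0), algebraMap _ R (linForm M l₀ 1),
    algebraMap _ R (linForm M l₀ 2)]
  have hxs : Ideal.ofList xs = I.map (algebraMap _ R) := by
    rw [hI, Ideal.map_span, ← Set.range_comp, Ideal.ofList]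
    congr 1
    ext x
    simp [xs, Fin.exists_fin_succ, eq_comm]
  have hmax : ∀ a, a ∈ Q → algebraMap _ R a ∈ maximalIdeal R := fun a ha ↦
    (IsLocalization.AtPrime.to_map_mem_maximal_iff R Q a).2 ha
  have hlen : (4 : ℕ∞) ≤ rs.length := by
    rw [IsLocalization.AtPrime.ringKrullDim_eq_height Q R] at hdim
    have : Q.height = rs.length := by exact_mod_cast hdim
    rwa [← this]
  have hsmul : (Ideal.ofList xs • ⊤ : Submodule R R) = Ideal.ofList xs := by
    rw [smul_eq_mul, Ideal.mul_top]
  obtain ⟨e, he, hdepth⟩ := DepthGE.quotient_ofList (A := R) (M := R) (d := rs.length)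
    ⟨rs, rfl, h₁, h₂⟩ (by rw [Module.supportDim_self_eq_ringKrullDim, hdim]) xs (fun x hx ↦ by
      have : ∀ a, algebraMap _ R (linForm M l₀ a) ∈ maximalIdeal R := fun a ↦
        hmax _ (hIQ (Ideal.subset_span ⟨a, rfl⟩))
      simp only [xs, List.mem_cons, List.not_mem_nil, or_false] at hx
      rcases hx with rfl | rfl | rfl <;> exact this _) (by
      rw [hsmul, Module.supportDim_quotient_eq_ringKrullDim, ← hdim]
      -- Every prime containing the three forms has height at least `3`, so they cut the dimension
      -- down by `3`; this is what makes them a regular sequence here.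
      refine ringKrullDim_quotient_add_le _ 3 fun p hp hle ↦ ?_
      rw [hxs, Ideal.map_le_iff_le_comap] at hle
      rw [← IsLocalization.height_under Q.primeCompl p]
      have : (p.under (MvPolynomial (Fin 3) A)).IsPrime := inferInstance
      exact (height_of_linForm_mem M l₀ hmin _ fun a ↦ hle (Ideal.subset_span ⟨a, rfl⟩)).1)
  -- The maximal ideal being associated bounds the depth of the quotient by `0`. But this depth is
  -- `dim R - 3`, and `dim R` is at least `4`.
  have hass : maximalIdeal R ∈ associatedPrimes R (R ⧸ (Ideal.ofList xs • ⊤ : Submodule R R)) := by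
    rw [AssociatedPrimes.mem_iff, isAssociatedPrime_iff]
    refine ⟨inferInstance, Submodule.Quotient.mk (algebraMap _ R y), ?_⟩
    ext r
    rw [Submodule.mem_colon_singleton, Submodule.mem_bot, ← Submodule.Quotient.mk_smul,
      Submodule.Quotient.mk_eq_zero, hsmul, hxs, smul_eq_mul]
    constructor
    · intro hr
      obtain ⟨a, s, rfl⟩ := IsLocalization.exists_mk'_eq Q.primeCompl r
      have ha : a ∈ Q := (IsLocalization.AtPrime.mk'_mem_maximal_iff R Q a s).1 hr
      rw [IsLocalization.mk'_eq_mul_mk'_one, mul_right_comm, ← map_mul]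
      exact Ideal.mul_mem_right _ _ (Ideal.mem_map_of_mem _ ((hQy a).1 ha))
    · intro hr
      by_contra hu
      rw [mem_maximalIdeal, mem_nonunits_iff, not_not] at hu
      have hy' : algebraMap _ R y ∈ I.map (algebraMap _ R) :=
        (Ideal.unit_mul_mem_iff_mem _ hu).1 hr
      obtain ⟨m, hm, hmy⟩ := (IsLocalization.algebraMap_mem_map_algebraMap_iff Q.primeCompl R I
        y).1 hy'
      exact hm ((hQy m).2 hmy)
  have h₄ := hdepth.le_ringKrullDim hass
  have h₅ : ringKrullDim (R ⧸ maximalIdeal R) = 0 :=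
    ringKrullDim_eq_zero_of_field (ResidueField R)
  rw [h₅] at h₄
  have h₆ : e = 0 := by
    have : e ≤ 0 := by exact_mod_cast h₄
    omega
  have h₇ : 4 ≤ rs.length := by exact_mod_cast hlen
  have h₈ : xs.length = 3 := rfl
  omega

end Minors
end LinearForms

/-! ### Affine charts of `B × ℙ(V₅)` -/

section AffineCharts

variable {T Y : Scheme.{u}}

theorem toSpecΓ_specMap_fromSpec {U : Y.Opens} (hU : IsAffineOpen U) (g : T ⟶ Y)
    (e : ⊤ ≤ g ⁻¹ᵁ U) : T.toSpecΓ ≫ Spec.map (g.appLE U ⊤ e) ≫ hU.fromSpec = g := by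
  have hr : Set.range g ⊆ Set.range hU.fromSpec := by
    rw [hU.range_fromSpec]
    rintro _ ⟨t, rfl⟩
    exact e trivial
  obtain ⟨l, hl⟩ : ∃ l, l ≫ hU.fromSpec = g :=
    ⟨IsOpenImmersion.lift hU.fromSpec g hr, IsOpenImmersion.lift_fac _ _ _⟩
  subst hl
  have e₀ : ⊤ ≤ hU.fromSpec ⁻¹ᵁ U := hU.fromSpec_preimage_self.ge
  rw [← appLE_comp_appTop _ _ _ e₀, fromSpec_appLE_self, ← Category.assoc,
    toSpecΓ_specMap_appTop]

theorem hom_ext_of_appLE {U : Y.Opens} (hU : IsAffineOpen U) {g g' : T ⟶ Y} (e : ⊤ ≤ g ⁻¹ᵁ U)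
    (e' : ⊤ ≤ g' ⁻¹ᵁ U) (H : g.appLE U ⊤ e = g'.appLE U ⊤ e') : g = g' := by
  rw [← toSpecΓ_specMap_fromSpec hU g e, ← toSpecΓ_specMap_fromSpec hU g' e', H]

theorem specMap_fromSpec_appLE {U : Y.Opens} (hU : IsAffineOpen U) {C : CommRingCat.{u}}
    (φ : Γ(Y, U) ⟶ C) (e : ⊤ ≤ (Spec.map φ ≫ hU.fromSpec) ⁻¹ᵁ U) :
    (Spec.map φ ≫ hU.fromSpec).appLE U ⊤ e = φ ≫ (Scheme.ΓSpecIso C).inv := by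
  have e₀ : ⊤ ≤ hU.fromSpec ⁻¹ᵁ U := hU.fromSpec_preimage_self.ge
  rw [← appLE_comp_appTop _ _ _ e₀, fromSpec_appLE_self, Scheme.ΓSpecIso_inv_naturality]

/-- A criterion for an open subscheme to be affine with a given ring of functions, in terms of a
map in each direction. -/
theorem isAffineOpen_of_inverse {V : Y.Opens} {C : CommRingCat.{u}} (a : C ⟶ Γ(V, ⊤))
    (β : Spec C ⟶ Y) (hβ : ⊤ ≤ β ⁻¹ᵁ V)
    (h₁ : ∀ β' : Spec C ⟶ V, β' ≫ V.ι = β → a ≫ β'.appTop = (Scheme.ΓSpecIso C).inv)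
    (h₂ : V.toScheme.toSpecΓ ≫ Spec.map a ≫ β = V.ι) : IsAffineOpen V ∧ IsIso a := by
  obtain ⟨β', hβ'⟩ : ∃ β' : Spec C ⟶ V, β' ≫ V.ι = β :=
    ⟨IsOpenImmersion.lift V.ι β (by
      rw [Scheme.Opens.range_ι]
      rintro _ ⟨t, rfl⟩
      exact hβ trivial), IsOpenImmersion.lift_fac _ _ _⟩
  have h₃ := h₁ β' hβ'
  let α : V.toScheme ⟶ Spec C := V.toScheme.toSpecΓ ≫ Spec.map a
  have h₄ : α ≫ β' = 𝟙 _ := by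
    rw [← cancel_mono V.ι, Category.assoc, hβ', Category.assoc, h₂, Category.id_comp]
  have h₅ : β' ≫ α = 𝟙 _ := by
    have h₆ : (Scheme.ΓSpecIso C).inv ≫ (β' ≫ α).appTop =
        (Scheme.ΓSpecIso C).inv ≫ (𝟙 (Spec C) : Spec C ⟶ Spec C).appTop := by
      rw [Scheme.Hom.comp_appTop, ← Category.assoc, appTop_toSpecΓ_specMap, h₃]
      simp
    rw [← toSpecΓ_specMap_appTop (β' ≫ α), h₆, toSpecΓ_specMap_appTop]
  have : IsIso α := ⟨β', h₄, h₅⟩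
  refine ⟨IsAffine.of_isIso α, ?_⟩
  refine ⟨β'.appTop ≫ (Scheme.ΓSpecIso C).hom, ?_, ?_⟩
  · rw [← Category.assoc, h₃, Iso.inv_hom_id]
  · have h₆ : (α ≫ β').appTop = 𝟙 _ := by rw [h₄]; exact Scheme.Hom.id_appTop
    rw [← appTop_toSpecΓ_specMap a, Category.assoc, Iso.hom_inv_id_assoc, ← h₆]
    exact (Scheme.Hom.comp_appTop α β').symm

theorem coord_of_mem_tautLine {ι : Type} {𝕜 : Type u} [Field 𝕜] {g : Y ⟶ PP ι 𝕜} {U : Y.Opens}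
    {x : ι → Γ(Y, U)} (hx : x ∈ tautLine g U) {i : ι} (hi : IsUnit (x i)) (h : T ⟶ Y)
    (e : ⊤ ≤ h ⁻¹ᵁ U) : Coord (h ≫ g) i (fun j ↦ (h.appLE U ⊤ e).hom (x j)) :=
  ⟨hi.map _, tautLine_pullback g h e hx⟩

variable {𝕜 : Type u} [Field 𝕜] {B : Scheme.{u}} {s : B ⟶ Spec (.of 𝕜)}

/-- The standard affine open subsets of `B × ℙ(V₅)`. -/
theorem isAffineOpen_chart {W : B.Opens} (hW : IsAffineOpen W) (i : Fin 5) :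
    IsAffineOpen (BxP.toB s ⁻¹ᵁ W ⊓ BxP.toPP s ⁻¹ᵁ PP.chart 𝕜 i) ∧
      Nonempty (MvPolynomial (Fin 4) Γ(B, W) ≃+*
        Γ(BxP s, BxP.toB s ⁻¹ᵁ W ⊓ BxP.toPP s ⁻¹ᵁ PP.chart 𝕜 i)) := by
  set V := BxP.toB s ⁻¹ᵁ W ⊓ BxP.toPP s ⁻¹ᵁ PP.chart 𝕜 i with hV
  have eB : ⊤ ≤ (V.ι ≫ BxP.toB s) ⁻¹ᵁ W := ι_top_le inf_le_left
  obtain ⟨x, hx1, hx⟩ := exists_coord_of_le (BxP.toPP s) (V := V) (i := i) inf_le_right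
  let C : CommRingCat.{u} := .of (MvPolynomial (Fin 4) Γ(B, W))
  let a : C ⟶ Γ(V, ⊤) := CommRingCat.ofHom (MvPolynomial.eval₂Hom
    ((V.ι ≫ BxP.toB s).appLE W ⊤ eB).hom fun l ↦ x (i.succAbove l))
  have haC : ∀ c, a.hom (MvPolynomial.C c) = ((V.ι ≫ BxP.toB s).appLE W ⊤ eB).hom c :=
    MvPolynomial.eval₂Hom_C _ _
  have haX : ∀ l, a.hom (MvPolynomial.X l) = x (i.succAbove l) := MvPolynomial.eval₂Hom_X' _ _
  let b : Spec C ⟶ B := Spec.map (CommRingCat.ofHom MvPolynomial.C) ≫ hW.fromSpec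
  have hb : ⊤ ≤ b ⁻¹ᵁ W := top_le_comp _ hW.fromSpec_preimage_self.ge
  -- The universal normalized vector: `1` at place `i` and the four variables elsewhere. It defines
  -- the inverse of the map given by coordinates.
  let x' : Fin 5 → Γ(Spec C, ⊤) := fun j ↦ (Scheme.ΓSpecIso C).inv.hom
    ((i.insertNth 1 fun l : Fin 4 ↦ (MvPolynomial.X l : MvPolynomial (Fin 4) Γ(B, W)) :
      Fin 5 → MvPolynomial (Fin 4) Γ(B, W)) j)
  have hx'i : x' i = 1 := by simp [x']
  have hx'l : ∀ l, x' (i.succAbove l) = (Scheme.ΓSpecIso C).inv.hom (MvPolynomial.X l) := by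
    simp [x']
  obtain ⟨v, hv, hvx⟩ := exists_coord (b ≫ s) i x' (by rw [hx'i]; exact isUnit_one)
  let β : Spec C ⟶ BxP s := pullback.lift b v hv.symm
  have hβB : β ≫ BxP.toB s = b := pullback.lift_fst _ _ _
  have hβP : β ≫ BxP.toPP s = v := pullback.lift_snd _ _ _
  have hβ : ⊤ ≤ β ⁻¹ᵁ V := by
    intro t _
    have h₁ : t ∈ (β ≫ BxP.toB s) ⁻¹ᵁ W := by rw [hβB]; exact hb trivial
    have h₂ : t ∈ (β ≫ BxP.toPP s) ⁻¹ᵁ PP.chart 𝕜 i := by rw [hβP]; exact hvx.top_le trivial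
    exact ⟨h₁, h₂⟩
  obtain ⟨haff, hiso⟩ := isAffineOpen_of_inverse a β hβ (by
    intro β' hβ'
    ext1
    refine MvPolynomial.ringHom_ext (fun c ↦ ?_) fun l ↦ ?_
    · refine congr(β'.appTop.hom $(haC c)).trans ?_
      have e₁ : ⊤ ≤ (β' ≫ V.ι ≫ BxP.toB s) ⁻¹ᵁ W := top_le_comp _ eB
      refine (appTop_appLE_apply β' (V.ι ≫ BxP.toB s) W eB e₁ c).trans ?_
      have h₁ : β' ≫ V.ι ≫ BxP.toB s = b := by rw [← Category.assoc, hβ', hβB]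
      have h₂ : ∀ (b' : Spec C ⟶ B) (_ : b' = b) (e' : ⊤ ≤ b' ⁻¹ᵁ W),
          b'.appLE W ⊤ e' = b.appLE W ⊤ hb := by rintro _ rfl _; rfl
      rw [h₂ _ h₁, specMap_fromSpec_appLE]
      rfl
    · refine congr(β'.appTop.hom $(haX l)).trans ?_
      have h₁ := hx.comp β'
      have h₂ : β' ≫ V.ι ≫ BxP.toPP s = v := by rw [← Category.assoc, hβ', hβP]
      rw [h₂] at h₁
      have h₃ := h₁.mul_comm hvx.mem i (i.succAbove l)
      rw [hx1, map_one, one_mul, hx'i, mul_one, hx'l] at h₃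
      exact h₃.symm) (by
    let α : V.toScheme ⟶ Spec C := V.toScheme.toSpecΓ ≫ Spec.map a
    have hα : ∀ c, α.appTop.hom ((Scheme.ΓSpecIso C).inv.hom c) = a.hom c := fun c ↦
      congr($(appTop_toSpecΓ_specMap a).hom c)
    have hαB : α ≫ b = V.ι ≫ BxP.toB s := by
      have e₁ : ⊤ ≤ (α ≫ b) ⁻¹ᵁ W := top_le_comp _ hb
      refine hom_ext_of_appLE hW e₁ eB ?_
      ext c
      refine (appTop_appLE_apply α b W hb e₁ c).symm.trans ?_
      rw [specMap_fromSpec_appLE]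
      exact (hα _).trans (haC c)
    rw [← Category.assoc]
    change α ≫ β = V.ι
    apply pullback.hom_ext
    · change (α ≫ β) ≫ BxP.toB s = V.ι ≫ BxP.toB s
      rw [Category.assoc, hβB, hαB]
    · change (α ≫ β) ≫ BxP.toPP s = V.ι ≫ BxP.toPP s
      rw [Category.assoc, hβP]
      have h₁ := hvx.comp α
      have h₂ : (fun j ↦ α.appTop.hom (x' j)) = x := by
        funext j
        refine Fin.succAboveCases i ?_ (fun l ↦ ?_) j
        · rw [hx'i, map_one, hx1]
        · rw [hx'l, hα]
          exact haX l
      rw [h₂] at h₁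
      refine h₁.hom_ext hx ?_
      have h₃ : (V.ι ≫ BxP.toB s) ≫ s = (V.ι ≫ BxP.toPP s) ≫ PP.toSpec (Fin 5) 𝕜 := by
        rw [Category.assoc, Category.assoc, pullback.condition]
      rw [← h₃, Category.assoc, hv, ← Category.assoc, hαB])
  exact ⟨haff, ⟨((asIso a).commRingCatIsoToRingEquiv).trans
    (V.topIso.commRingCatIsoToRingEquiv)⟩⟩

end AffineCharts

/-! ### Cohen–Macaulay charts and heights of minors -/

section CohenMacaulay

variable {𝕜 : Type u} [Field 𝕜] {B : Scheme.{u}} {R : Subbundle B} {s : B ⟶ Spec (.of 𝕜)}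

theorem IsCohenMacaulay.isCohenMacaulayRing (hB : IsCohenMacaulay B) {W : B.Opens}
    (hW : IsAffineOpen W) : IsCohenMacaulayRing Γ(B, W) := by
  have := hB.isLocallyNoetherian
  refine ⟨IsLocallyNoetherian.component_noetherian ⟨W, hW⟩, fun p hp ↦ ?_⟩
  let y : PrimeSpectrum Γ(B, W) := ⟨p, hp⟩
  have hy : hW.fromSpec y ∈ W := by
    have : hW.fromSpec y ∈ Set.range hW.fromSpec := ⟨y, rfl⟩
    rwa [hW.range_fromSpec] at this
  let := TopCat.Presheaf.algebra_section_stalk B.presheaf (⟨_, hy⟩ : W)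
  have hloc : IsLocalization.AtPrime (B.presheaf.stalk (hW.fromSpec y)) y.asIdeal :=
    hW.isLocalization_stalk' y hy
  exact (hB.stalk (hW.fromSpec y)).of_ringEquiv
    (IsLocalization.algEquiv p.primeCompl (B.presheaf.stalk (hW.fromSpec y))
      (Localization.AtPrime p)).toRingEquiv

/-- The codimension of the degeneracy loci in terms of heights of primes containing minors. -/
theorem le_height_of_minors_mem
    (hcodim : ∀ k : ℕ, 1 ≤ k →
      ((k + 1 : ℕ) : WithBot ℕ∞) ≤ codim (degeneracyIdeal R s k).support)
    {W : B.affineOpens} {r : Fin 3 → Pair → Γ(B, W)}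
    (hr : (R.sections W).toSubmodule = Submodule.span Γ(B, W) (Set.range r)) {i : Fin 5}
    {U : (BxP s).Opens} (hU : IsAffineOpen U) (hb : U ≤ BxP.toB s ⁻¹ᵁ W.1)
    {x : Fin 5 → Γ(BxP s, U)} (hx : x ∈ tautLine (BxP.toPP s) U) (hx1 : x i = 1)
    (m : ℕ) (hm1 : 1 ≤ m) (hm3 : m ≤ 3) (q : Ideal Γ(BxP s, U)) (hq : q.IsPrime)
    (hmem : ∀ (a : Fin m → Fin 3) (c : Fin m → Fin 4),
      (Matrix.submatrix (Matrix.of (contractMatrix (fun a ↦ pullForm (BxP.toB s) hb (r a)) x i))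
        a c).det ∈ q) : (5 : ℕ∞) ≤ q.height + m := by
  -- Minors of order `m = 4 - k` define `D_k`, and `5 - m = k + 1` is exactly the assumed
  -- codimension.
  obtain ⟨k, rfl⟩ : ∃ k, m = 4 - k := ⟨4 - m, by omega⟩
  let y : PrimeSpectrum Γ(BxP s, U) := ⟨q, hq⟩
  have hy : hU.fromSpec y ∈ U := by
    have : hU.fromSpec y ∈ Set.range hU.fromSpec := ⟨y, rfl⟩
    rwa [hU.range_fromSpec] at this
  let := TopCat.Presheaf.algebra_section_stalk (BxP s).presheaf (⟨_, hy⟩ : U)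
  have hloc : IsLocalization.AtPrime ((BxP s).presheaf.stalk (hU.fromSpec y)) y.asIdeal :=
    hU.isLocalization_stalk' y hy
  have hdim := IsLocalization.AtPrime.ringKrullDim_eq_height q
    ((BxP s).presheaf.stalk (hU.fromSpec y))
  have hsupp : hU.fromSpec y ∈ (degeneracyIdeal R s k).support := by
    rw [Scheme.IdealSheafData.mem_support_iff_of_mem (U := ⟨U, hU⟩) hy, Scheme.mem_zeroLocus_iff]
    intro f hf hyf
    rw [degeneracyIdeal_ideal k hr hU hb hx hx1] at hf
    have h₁ : f ∈ q := by
      refine (Ideal.span_le.2 ?_) hf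
      rintro _ ⟨ρ, σ, rfl⟩
      choose τ hτ using fun c ↦ Fin.exists_succAbove_eq (σ c).2
      have h₂ := hmem ρ τ
      refine (congrArg (· ∈ q) (congrArg Matrix.det ?_)).mpr h₂
      ext a c
      change _ = contract _ x (i.succAbove (τ c))
      rw [hτ]
      rfl
    have h₃ : y ∈ PrimeSpectrum.basicOpen f := by
      have h₄ := hU.fromSpec_preimage_basicOpen f
      have h₅ : y ∈ hU.fromSpec ⁻¹ᵁ (BxP s).basicOpen f := hyf
      rwa [h₄] at h₅
    exact h₃ h₁
  have h₁ : ((k + 1 : ℕ) : WithBot ℕ∞) ≤ q.height := by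
    rw [← hdim]
    exact (hcodim k (by omega)).trans (iInf₂_le (hU.fromSpec y) hsupp)
  have h₂ : ((k + 1 : ℕ) : ℕ∞) ≤ q.height := by exact_mod_cast h₁
  refine le_trans ?_ (add_le_add_left h₂ _)
  rw [← Nat.cast_add]
  have : k + 1 + (4 - k) = 5 := by omega
  rw [this]
  rfl

end CohenMacaulay

/-! ### Affine charts of `ℙ_ℳ(𝒰)` -/

section PMUChart

/-- The element of `Pair` given by two distinct indices. -/
def pairOf (i l : Fin 5) (h : l ≠ i) : Pair :=
  if h' : i < l then ⟨(i, l), h'⟩ else ⟨(l, i), lt_of_le_of_ne (not_lt.1 h') h⟩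

theorem isUnit_pairOf_iff {A : Type u} [CommRing A] (p : Pair → A) {i l : Fin 5} (h : l ≠ i) :
    IsUnit (p (pairOf i l h)) ↔ IsUnit (skew p i l) := by
  rw [skew, pairOf]
  split_ifs with h₁ h₂
  · rfl
  · exact IsUnit.neg_iff _ |>.symm
  · exact absurd (lt_of_le_of_ne (not_lt.1 h₁) h) h₂

variable {𝕜 : Type u} [Field 𝕜] {B : Scheme.{u}} {R : Subbundle B} {s : B ⟶ Spec (.of 𝕜)}
  {T : Scheme.{u}}

/-- Homogeneous coordinates with `skew p i l = 1`. -/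
theorem exists_coord_pairOf {q : T ⟶ PP Pair 𝕜} {i l : Fin 5} (h : l ≠ i)
    (e : ⊤ ≤ q ⁻¹ᵁ PP.chart 𝕜 (pairOf i l h)) :
    ∃ p, skew p i l = 1 ∧ Coord q (pairOf i l h) p := by
  obtain ⟨p, hp1, hp⟩ := coord_of_top_le q e
  obtain ⟨c, hc⟩ := (isUnit_pairOf_iff p h).1 (by rw [hp1]; exact isUnit_one)
  refine ⟨(↑c⁻¹ : Γ(T, ⊤)) • p, ?_, hp.smul (Units.isUnit _)⟩
  rw [skew_smul, ← hc, Units.inv_mul]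

/-- Homogeneous coordinates normalized at `(i, l)` are unique. -/
theorem Coord.eq_of_skew_eq_one {q : T ⟶ PP Pair 𝕜} {a : Pair} {p p' : Pair → Γ(T, ⊤)}
    (hp : Coord q a p) (hp' : p' ∈ tautLine q ⊤) {i l : Fin 5} (h : skew p i l = 1)
    (h' : skew p' i l = 1) : p' = p := by
  obtain ⟨c, rfl⟩ := hp.exists_smul hp'
  rw [skew_smul, h, mul_one] at h'
  rw [h', one_smul]

theorem appLE_congr_hom {X Y : Scheme.{u}} {f g : X ⟶ Y} (h : f = g) {U : Y.Opens} {V : X.Opens}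
    (e : V ≤ f ⁻¹ᵁ U) (e' : V ≤ g ⁻¹ᵁ U) (c : Γ(Y, U)) :
    (f.appLE U V e).hom c = (g.appLE U V e').hom c := by
  subst h
  rfl

/-- The standard affine open subsets of `ℙ_ℳ(𝒰)`. -/
theorem isAffineOpen_PMU_chart {W : B.affineOpens} {r : Fin 3 → Pair → Γ(B, W)}
    (hr : (R.sections W).toSubmodule = Submodule.span Γ(B, W) (Set.range r)) {i : Fin 5}
    {U : (BxP s).Opens} (hU : IsAffineOpen U) (hb : U ≤ BxP.toB s ⁻¹ᵁ W.1)
    {x : Fin 5 → Γ(BxP s, U)} (hx : x ∈ tautLine (BxP.toPP s) U) (hx1 : x i = 1) (l₀ : Fin 4)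
    {V : (PMU R s).Opens} (hV : V = mapF R s ⁻¹ᵁ U ⊓ PMU.toPair R s ⁻¹ᵁ
      PP.chart 𝕜 (pairOf i (i.succAbove l₀) (i.succAbove_ne l₀))) (hVU : V ≤ mapF R s ⁻¹ᵁ U) :
    IsAffineOpen V ∧ ∃ φ : MvPolynomial (Fin 3) Γ(BxP s, U) →+* Γ(PMU R s, V),
      Function.Surjective φ ∧
      RingHom.ker φ = Ideal.span (Set.range (linForm
        (Matrix.of (contractMatrix (fun a ↦ pullForm (BxP.toB s) hb (r a)) x i)) l₀)) ∧
      ∀ c, φ (MvPolynomial.C c) = ((mapF R s).appLE U V hVU).hom c := by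
  set M : Matrix (Fin 3) (Fin 4) Γ(BxP s, U) :=
    Matrix.of (contractMatrix (fun a ↦ pullForm (BxP.toB s) hb (r a)) x i) with hM
  set I := Ideal.span (Set.range (linForm M l₀)) with hI
  -- coordinates on `V`
  have eU : ⊤ ≤ (V.ι ≫ mapF R s) ⁻¹ᵁ U := ι_top_le hVU
  have eW : ⊤ ≤ (V.ι ≫ mapF R s ≫ BxP.toB s) ⁻¹ᵁ W.1 := fun t ht ↦ hb (eU ht)
  obtain ⟨p, hp1, hp⟩ := exists_coord_pairOf (q := V.ι ≫ PMU.toPair R s) (i.succAbove_ne l₀)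
    (ι_top_le (hV.trans_le inf_le_right))
  let xV : Fin 5 → Γ(V, ⊤) := fun j ↦ ((V.ι ≫ mapF R s).appLE U ⊤ eU).hom (x j)
  have hxV : Coord (V.ι ≫ mapF R s ≫ BxP.toPP s) i xV := by
    have := coord_of_mem_tautLine hx (i := i) (by rw [hx1]; exact isUnit_one) (V.ι ≫ mapF R s) eU
    rwa [Category.assoc] at this
  have hxV1 : xV i = 1 := by simp only [xV, hx1, map_one]
  let uV : Fin 4 → Γ(V, ⊤) := fun l ↦ skew p i (i.succAbove l)
  -- With `p = x ∧ u` normalized by `u_{l₀} = 1`, the variables are sent to the other three entries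
  -- of `u`.
  let ψ : MvPolynomial (Fin 3) Γ(BxP s, U) →+* Γ(V, ⊤) := MvPolynomial.eval₂Hom
    ((V.ι ≫ mapF R s).appLE U ⊤ eU).hom fun j ↦ uV (l₀.succAbove j)
  have hψC : ∀ c, ψ (MvPolynomial.C c) = ((V.ι ≫ mapF R s).appLE U ⊤ eU).hom c :=
    MvPolynomial.eval₂Hom_C _ _
  have hψX : ∀ j, ψ (MvPolynomial.X j) = uV (l₀.succAbove j) := MvPolynomial.eval₂Hom_X' _ _
  have hψv : ∀ l, ψ (affineVec l₀ l) = uV l := by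
    intro l
    refine Fin.succAboveCases l₀ ?_ (fun j ↦ ?_) l
    · rw [affineVec, Fin.insertNth_apply_same, map_one]
      exact hp1.symm
    · rw [affineVec, Fin.insertNth_apply_succAbove]
      exact hψX j
  have hformV : ∀ a, (fun b ↦ ((V.ι ≫ mapF R s).appLE U ⊤ eU).hom (pullForm (BxP.toB s) hb (r a)
      b)) =
      pullForm (V.ι ≫ mapF R s ≫ BxP.toB s) eW (r a) := by
    intro a
    refine (pullForm_comp (BxP.toB s) (V.ι ≫ mapF R s) hb eU
      (by rw [Category.assoc]; exact eW) (r a)).trans ?_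
    exact pullForm_congr (Category.assoc _ _ _) _ _ _
  have hψl : ∀ a, ψ (linForm M l₀ a) = 0 := by
    intro a
    have h₁ := PMU.evalForm_eq_zero hxV hxV1 hp eW
      (r := r a) (by rw [hr]; exact Submodule.subset_span ⟨a, rfl⟩)
    rw [← h₁]
    refine Eq.trans ?_ (evalForm_eq_sum_contractMatrix
      (fun a ↦ pullForm (V.ι ≫ mapF R s ≫ BxP.toB s) eW (r a)) xV (skew_self p i) a).symm
    rw [linForm, map_sum]
    refine Finset.sum_congr rfl fun l _ ↦ ?_
    rw [map_mul, hψv, hψC]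
    congr 1
    refine (map_contractMatrix ((V.ι ≫ mapF R s).appLE U ⊤ eU).hom
      (fun a ↦ pullForm (BxP.toB s) hb (r a)) x i a l).trans ?_
    exact congr(contractMatrix $(funext hformV) xV i a l)
  have hψI : ∀ f ∈ I, ψ f = 0 := by
    intro f hf
    have h₁ : I ≤ RingHom.ker ψ := Ideal.span_le.2 (by rintro _ ⟨a, rfl⟩; exact hψl a)
    exact h₁ hf
  let C : CommRingCat.{u} := .of (MvPolynomial (Fin 3) Γ(BxP s, U) ⧸ I)
  let a : C ⟶ Γ(V, ⊤) := CommRingCat.ofHom (Ideal.Quotient.lift I ψ hψI)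
  have ha : ∀ f, a.hom (Ideal.Quotient.mk I f) = ψ f := fun f ↦ Ideal.Quotient.lift_mk I ψ hψI
  -- the map from the spectrum
  let ζ : MvPolynomial (Fin 3) Γ(BxP s, U) →+* Γ(Spec C, ⊤) :=
    (Scheme.ΓSpecIso C).inv.hom.comp (Ideal.Quotient.mk I)
  let h : Spec C ⟶ BxP s := Spec.map (CommRingCat.ofHom
    ((Ideal.Quotient.mk I).comp MvPolynomial.C)) ≫ hU.fromSpec
  have hh : ⊤ ≤ h ⁻¹ᵁ U := top_le_comp _ hU.fromSpec_preimage_self.ge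
  have hζC : ∀ c, (h.appLE U ⊤ hh).hom c = ζ (MvPolynomial.C c) := fun c ↦ by
    rw [specMap_fromSpec_appLE]
    rfl
  have hhW : ⊤ ≤ (h ≫ BxP.toB s) ⁻¹ᵁ W.1 := fun t ht ↦ hb (hh ht)
  let xC : Fin 5 → Γ(Spec C, ⊤) := fun j ↦ (h.appLE U ⊤ hh).hom (x j)
  have hxC : Coord (h ≫ BxP.toPP s) i xC :=
    coord_of_mem_tautLine hx (i := i) (by rw [hx1]; exact isUnit_one) h hh
  have hxC1 : xC i = 1 := by simp only [xC, hx1, map_one]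
  -- The universal solution of `N u = 0` with `u_{l₀} = 1`; the ideal `I` is what makes the
  -- equations hold.
  let uC : Fin 5 → Γ(Spec C, ⊤) := i.insertNth 0 fun l ↦ ζ (affineVec l₀ l)
  have huCi : uC i = 0 := Fin.insertNth_apply_same _ _ _
  have huCl : ∀ l, uC (i.succAbove l) = ζ (affineVec l₀ l) := Fin.insertNth_apply_succAbove _ _ _
  have hskC : ∀ l, skew (wedgeVec xC uC) i l = uC l := by
    intro l
    rw [skew_wedgeVec, hxC1, huCi]
    ring
  have hskC1 : skew (wedgeVec xC uC) i (i.succAbove l₀) = 1 := by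
    rw [hskC, huCl, affineVec, Fin.insertNth_apply_same, map_one]
  obtain ⟨β, hβ, hβp⟩ := exists_PMU_of_coord (R := R) hxC hhW hr (u := uC)
    (a := pairOf i (i.succAbove l₀) (i.succAbove_ne l₀))
    (by rw [isUnit_pairOf_iff, hskC1]; exact isUnit_one) (by
      intro a
      refine (evalForm_eq_sum_contractMatrix
        (fun a ↦ pullForm (h ≫ BxP.toB s) hhW (r a)) xC huCi a).trans ?_
      have h₁ : ζ (linForm M l₀ a) = 0 := by
        have h₂ : linForm M l₀ a ∈ I := Ideal.subset_span ⟨a, rfl⟩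
        change (Scheme.ΓSpecIso C).inv.hom (Ideal.Quotient.mk I _) = 0
        rw [Ideal.Quotient.eq_zero_iff_mem.2 h₂, map_zero]
      rw [← h₁, linForm, map_sum]
      refine Finset.sum_congr rfl fun l _ ↦ ?_
      rw [huCl, map_mul, ← hζC]
      congr 1
      refine Eq.trans ?_ (map_contractMatrix (h.appLE U ⊤ hh).hom
        (fun a ↦ pullForm (BxP.toB s) hb (r a)) x i a l).symm
      exact congr(contractMatrix $(funext fun a ↦
        (pullForm_comp (BxP.toB s) h hb hh hhW (r a)).symm) xC i a l))
  have hβV : ⊤ ≤ β ⁻¹ᵁ V := by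
    intro t _
    rw [hV]
    have h₁ : t ∈ (β ≫ mapF R s) ⁻¹ᵁ U := by rw [hβ]; exact hh trivial
    exact ⟨h₁, hβp.top_le trivial⟩
  obtain ⟨haff, hiso⟩ := isAffineOpen_of_inverse a β hβV (by
    intro β' hβ'
    have hβ'C : ∀ c, β'.appTop.hom (((V.ι ≫ mapF R s).appLE U ⊤ eU).hom c) =
        ζ (MvPolynomial.C c) := by
      intro c
      have e₁ : ⊤ ≤ (β' ≫ V.ι ≫ mapF R s) ⁻¹ᵁ U := top_le_comp _ eU
      refine (appTop_appLE_apply β' (V.ι ≫ mapF R s) U eU e₁ c).trans ?_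
      have h₁ : β' ≫ V.ι ≫ mapF R s = h := by rw [← Category.assoc, hβ', hβ]
      rw [← hζC]
      exact appLE_congr_hom h₁ _ _ c
    have hβ'p : (fun b ↦ β'.appTop.hom (p b)) = wedgeVec xC uC := by
      have h₁ := hp.comp β'
      have h₂ : β' ≫ V.ι ≫ PMU.toPair R s = β ≫ PMU.toPair R s := by rw [← Category.assoc, hβ']
      rw [h₂] at h₁
      refine hβp.eq_of_skew_eq_one h₁.mem hskC1 ?_
      rw [← map_skew, hp1, map_one]
    have hring : (β'.appTop.hom.comp ψ) = ζ := by
      refine MvPolynomial.ringHom_ext (fun c ↦ ?_) fun j ↦ ?_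
      · exact congr(β'.appTop.hom $(hψC c)).trans (hβ'C c)
      · refine congr(β'.appTop.hom $(hψX j)).trans ?_
        refine (map_skew _ _ _ _).trans ?_
        rw [hβ'p, hskC, huCl, affineVec, Fin.insertNth_apply_succAbove]
    refine CommRingCat.hom_ext (RingHom.ext fun c ↦ ?_)
    obtain ⟨c, rfl⟩ := Ideal.Quotient.mk_surjective c
    exact congr(β'.appTop.hom $(ha c)).trans congr($hring c)) (by
    let α : V.toScheme ⟶ Spec C := V.toScheme.toSpecΓ ≫ Spec.map a
    have hα : ∀ f, α.appTop.hom (ζ f) = ψ f := fun f ↦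
      (congr($(appTop_toSpecΓ_specMap a).hom (Ideal.Quotient.mk I f))).trans (ha f)
    rw [← Category.assoc]
    change α ≫ β = V.ι
    have hαh : α ≫ h = V.ι ≫ mapF R s := by
      have e₁ : ⊤ ≤ (α ≫ h) ⁻¹ᵁ U := top_le_comp _ hh
      refine hom_ext_of_appLE hU e₁ eU ?_
      ext c
      refine (appTop_appLE_apply α h U hh e₁ c).symm.trans ?_
      rw [hζC]
      exact (hα _).trans (hψC c)
    apply PMU.hom_ext
    · rw [Category.assoc, hβ, hαh]
    · have h₁ := hβp.comp α
      rw [← Category.assoc] at h₁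
      have h₂ : (fun b ↦ α.appTop.hom (wedgeVec xC uC b)) = p := by
        rw [PMU.coord_eq_wedgeVec hxV hxV1 hp]
        refine (map_wedgeVec _ _ _).trans ?_
        congr 1
        · funext j
          change α.appTop.hom ((h.appLE U ⊤ hh).hom (x j)) = _
          rw [hζC]
          exact (hα _).trans (hψC _)
        · funext j
          refine Fin.succAboveCases i ?_ (fun l ↦ ?_) j
          · rw [huCi, map_zero, skew_self]
          · rw [huCl]
            exact (hα _).trans (hψv l)
      rw [h₂] at h₁
      refine h₁.hom_ext hp ?_
      have h₃ : (α ≫ β) ≫ mapF R s = V.ι ≫ mapF R s := by rw [Category.assoc, hβ, hαh]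
      refine (Category.assoc _ _ _).trans (Eq.trans ?_ (Category.assoc _ _ _).symm)
      rw [toPair_toSpec]
      exact (Category.assoc _ _ _).symm.trans
        (congr($h₃ ≫ BxP.toB s ≫ s).trans (Category.assoc _ _ _)))
  have hbij := ConcreteCategory.bijective_of_isIso a
  have htop := ConcreteCategory.bijective_of_isIso V.topIso.hom
  refine ⟨haff, V.topIso.hom.hom.comp ψ, fun y ↦ ?_, ?_, fun c ↦ ?_⟩
  · obtain ⟨y, rfl⟩ := htop.2 y
    obtain ⟨y, rfl⟩ := hbij.2 y
    obtain ⟨y, rfl⟩ := Ideal.Quotient.mk_surjective y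
    exact ⟨y, congr(V.topIso.hom.hom $(ha y)).symm⟩
  · ext f
    rw [RingHom.mem_ker, RingHom.comp_apply]
    refine (map_eq_zero_iff V.topIso.hom.hom htop.1).trans ?_
    rw [← ha, ← Ideal.Quotient.eq_zero_iff_mem]
    exact map_eq_zero_iff a.hom hbij.1
  · rw [RingHom.comp_apply, hψC]
    have e₁ : ⊤ ≤ V.ι ⁻¹ᵁ V := V.ι_preimage_self.ge
    rw [← appLE_appLE_apply V.ι (mapF R s) hVU e₁ eU c]
    have h₁ : V.ι.appLE V ⊤ e₁ ≫ V.topIso.hom = 𝟙 _ := by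
      rw [Scheme.Opens.ι_appLE, Scheme.Opens.topIso_hom]
      exact ((PMU R s).presheaf.map_comp _ _).symm.trans ((PMU R s).presheaf.map_id _)
    exact congr($(h₁).hom _)

end PMUChart

/-! ### The inverse image of `D_1` is a Cartier divisor -/

section Cartier

variable {𝕜 : Type u} [Field 𝕜] {B : Scheme.{u}} {R : Subbundle B} {s : B ⟶ Spec (.of 𝕜)}

/-- On the standard charts of `ℙ_ℳ(𝒰)` the ideal of maximal minors is generated by a
nonzerodivisor. -/
theorem map_span_signedMinor {A A' : Type u} [CommRing A] [CommRing A']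
    (hA : IsCohenMacaulayRing A) {N : Fin 3 → Fin 4 → A}
    (hmin : ∀ m : ℕ, 1 ≤ m → m ≤ 3 → ∀ q : Ideal A, q.IsPrime →
      (∀ (a : Fin m → Fin 3) (c : Fin m → Fin 4), ((Matrix.of N).submatrix a c).det ∈ q) →
        (5 : ℕ∞) ≤ q.height + m) (l₀ : Fin 4) (f : A →+* A')
    (φ : MvPolynomial (Fin 3) A →+* A') (hφs : Function.Surjective φ)
    (hφk : RingHom.ker φ = Ideal.span (Set.range (linForm (Matrix.of N) l₀)))
    (hφC : ∀ c, φ (MvPolynomial.C c) = f c) :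
    f (signedMinor N l₀) ∈ nonZeroDivisors A' ∧
      (Ideal.span (Set.range (signedMinor N))).map f = Ideal.span {f (signedMinor N l₀)} := by
  constructor
  · rw [mem_nonZeroDivisors_iff_right]
    intro z hz
    obtain ⟨z, rfl⟩ := hφs z
    rw [← hφC, ← map_mul, ← RingHom.mem_ker, hφk] at hz
    rw [← RingHom.mem_ker, hφk]
    refine mem_span_linForm _ l₀ hA hmin ?_
    have h₁ : MvPolynomial.C ((Matrix.of N).submatrix id l₀.succAbove).det * z =
        (-1) ^ (l₀ : ℕ) * (z * MvPolynomial.C (signedMinor N l₀)) := by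
      rw [signedMinor, map_mul, map_pow, map_neg, map_one, mul_left_comm z, ← mul_assoc,
        ← mul_pow, neg_one_mul, neg_neg, one_pow, one_mul, mul_comm z]
      rfl
    rw [h₁]
    exact Ideal.mul_mem_left _ _ hz
  · rw [Ideal.map_span]
    refine le_antisymm (Ideal.span_le.2 ?_) (Ideal.span_mono ?_)
    · rintro _ ⟨_, ⟨l, rfl⟩, rfl⟩
      have h₁ : ∀ a, ∑ l, f (N a l) * φ (affineVec l₀ l) = 0 := by
        intro a
        have h₂ : φ (linForm (Matrix.of N) l₀ a) = 0 := by
          rw [← RingHom.mem_ker, hφk]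
          exact Ideal.subset_span ⟨a, rfl⟩
        rw [← h₂, linForm, map_sum]
        exact Finset.sum_congr rfl fun l _ ↦ by rw [map_mul, hφC, Matrix.of_apply]
      -- Since the coordinate at `l₀` is `1`, Cramer's rule makes each minor a multiple of the minor
      -- at `l₀`.
      have h₃ := signedMinor_mul_comm h₁ l l₀
      have h₄ : φ (affineVec l₀ l₀) = 1 := by
        rw [affineVec, Fin.insertNth_apply_same, map_one]
      rw [h₄, mul_one] at h₃
      refine Ideal.mem_span_singleton'.2 ⟨φ (affineVec l₀ l), ?_⟩
      rw [mul_comm, map_signedMinor, map_signedMinor, h₃]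
    · rintro _ rfl
      exact ⟨_, ⟨l₀, rfl⟩, rfl⟩

theorem mem_basicOpen_or {X : Scheme.{u}} {V : X.Opens} {f g a b : Γ(X, V)} (h : IsUnit (f * a - g
    * b))
    {x : X} (hx : x ∈ V) : x ∈ X.basicOpen a ∨ x ∈ X.basicOpen b := by
  rw [X.mem_basicOpen _ _ hx, X.mem_basicOpen _ _ hx]
  have h₁ := h.map (X.presheaf.germ V x hx).hom
  rw [map_sub, map_mul, map_mul, sub_eq_add_neg] at h₁
  rcases IsLocalRing.isUnit_or_isUnit_of_isUnit_add h₁ with h₂ | h₂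
  · exact Or.inl (isUnit_of_mul_isUnit_right h₂)
  · exact Or.inr (isUnit_of_mul_isUnit_right ((IsUnit.neg_iff _).1 h₂))

theorem isUnit_ι_basicOpen {X : Scheme.{u}} (f : Γ(X, ⊤)) :
    IsUnit ((X.basicOpen f).ι.appTop.hom f) := by
  rw [appTop_eq_appLE _ le_top, ← map_appLE_apply (X.basicOpen f).ι
    (Scheme.Opens.ι_preimage_self _).ge (X.basicOpen_le f) le_top]
  exact (isUnit_res_basicOpen f).map _

/-- Near `y` some coordinate of `p = x ∧ u` equals `1` and is a combination of two entries of `u`,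
so one entry of `u` is invertible at `y`. Its index is not `i` because `u_i = 0`. -/
theorem exists_mem_chart_pairOf {i : Fin 5} {U : (BxP s).Opens}
    {x : Fin 5 → Γ(BxP s, U)} (hx : x ∈ tautLine (BxP.toPP s) U) (hx1 : x i = 1)
    {y : PMU R s} (hy : y ∈ mapF R s ⁻¹ᵁ U) : ∃ l : Fin 4,
      y ∈ PMU.toPair R s ⁻¹ᵁ PP.chart 𝕜 (pairOf i (i.succAbove l) (i.succAbove_ne l)) := by
  let O := mapF R s ⁻¹ᵁ U
  obtain ⟨V', a, p, hyV', hp1, hp⟩ := exists_local_coord (O.ι ≫ PMU.toPair R s) (⟨y, hy⟩ : O)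
  have e : ⊤ ≤ ((V'.ι ≫ O.ι) ≫ mapF R s) ⁻¹ᵁ U := by
    rw [Category.assoc]
    exact top_le_comp _ (ι_top_le le_rfl)
  have hx' := coord_of_mem_tautLine hx (i := i) (by rw [hx1]; exact isUnit_one)
    ((V'.ι ≫ O.ι) ≫ mapF R s) e
  rw [Category.assoc] at hx'
  rw [← Category.assoc] at hp
  have h₁ := PMU.coord_eq_wedgeVec hx' (by rw [hx1, map_one]) hp
  have h₂ := congrFun h₁ a
  rw [hp1, wedgeVec] at h₂
  have key : ∀ m, (⟨⟨y, hy⟩, hyV'⟩ : V') ∈ V'.toScheme.basicOpen (skew p i m) → ∃ l : Fin 4,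
      y ∈ PMU.toPair R s ⁻¹ᵁ PP.chart 𝕜 (pairOf i (i.succAbove l) (i.succAbove_ne l)) := by
    intro m hm
    have hmi : m ≠ i := by
      rintro rfl
      rw [skew_self, Scheme.basicOpen_zero] at hm
      exact hm
    obtain ⟨l, rfl⟩ := Fin.exists_succAbove_eq hmi
    refine ⟨l, ?_⟩
    let D := V'.toScheme.basicOpen (skew p i (i.succAbove l))
    have h₃ := hp.comp D.ι
    have h₄ : IsUnit (skew (fun b ↦ D.ι.appTop.hom (p b)) i (i.succAbove l)) := by
      rw [← map_skew]
      exact isUnit_ι_basicOpen _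
    have h₅ := (h₃.change ((isUnit_pairOf_iff _ (i.succAbove_ne l)).2 h₄)).top_le
    exact h₅ (x := ⟨_, hm⟩) trivial
  rcases mem_basicOpen_or (X := V'.toScheme) (V := ⊤) (x := ⟨⟨y, hy⟩, hyV'⟩) (h₂ ▸ isUnit_one)
    trivial with h | h
  · exact key _ h
  · exact key _ h

/-- The Cohen–Macaulay and codimension assumptions enter the theorem through this statement alone.
-/
theorem isCartier_comap_mapF (hB : IsCohenMacaulay B)
    (hcodim : ∀ k : ℕ, 1 ≤ k →
      ((k + 1 : ℕ) : WithBot ℕ∞) ≤ codim (degeneracyIdeal R s k).support) :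
    IsCartier ((degeneracyIdeal R s 1).comap (mapF R s)) := by
  intro y
  obtain ⟨W, hyW, r, hr⟩ := exists_frame R (BxP.toB s (mapF R s y))
  obtain ⟨i, hi⟩ := PP.exists_mem_chart (BxP.toPP s (mapF R s y))
  set U := BxP.toB s ⁻¹ᵁ W.1 ⊓ BxP.toPP s ⁻¹ᵁ PP.chart 𝕜 i with hUdef
  obtain ⟨hU, ⟨ε⟩⟩ := isAffineOpen_chart (s := s) W.2 i
  rw [← hUdef] at hU ε
  obtain ⟨x, hx1, hx, -⟩ := exists_coord_section (BxP.toPP s) (V := U) (i := i) inf_le_right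
  have hyU : y ∈ mapF R s ⁻¹ᵁ U := ⟨hyW, hi⟩
  have hb : U ≤ BxP.toB s ⁻¹ᵁ W.1 := inf_le_left
  obtain ⟨l₀, hl₀⟩ := exists_mem_chart_pairOf (R := R) hx hx1 hyU
  let V := mapF R s ⁻¹ᵁ U ⊓ PMU.toPair R s ⁻¹ᵁ
      PP.chart 𝕜 (pairOf i (i.succAbove l₀) (i.succAbove_ne l₀))
  have hVU : V ≤ mapF R s ⁻¹ᵁ U := inf_le_left
  obtain ⟨hV, φ, hφs, hφk, hφC⟩ := isAffineOpen_PMU_chart (R := R) hr hU hb hx hx1 l₀ rfl hVU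
  have hCM : IsCohenMacaulayRing Γ(BxP s, U) :=
    ((hB.isCohenMacaulayRing W.2).mvPolynomial 4).of_ringEquiv ε
  obtain ⟨h₁, h₂⟩ := map_span_signedMinor hCM
    (le_height_of_minors_mem hcodim hr hU hb hx hx1) l₀ ((mapF R s).appLE U V hVU).hom φ hφs hφk hφC
  refine ⟨⟨V, hV⟩, ⟨hyU, hl₀⟩, _, h₁, ?_⟩
  rw [comap_ideal_eq_map _ _ hU hV hVU, degeneracyIdeal_one_ideal hr hU hb hx hx1, h₂]

end Cartier

/-! ### Kernels of matrices of constant rank -/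

section Kernel

open Matrix

variable {A : Type u} [CommRing A]

/-- If the minors of order `r + 1` of a matrix vanish and a minor of order `r` is invertible, then
the matrix is determined by the rows and columns of this minor. -/
theorem eq_mul_inv_mul_of_minors {m n : Type*} {r : ℕ} (N : Matrix m n A) (ρ : Fin r → m)
    (c : Fin r → n) (hu : IsUnit (N.submatrix ρ c).det)
    (hmin : ∀ (ρ' : Fin (r + 1) → m) (c' : Fin (r + 1) → n), (N.submatrix ρ' c').det = 0) :
    N.submatrix id c * (N.submatrix ρ c)⁻¹ * N.submatrix ρ id = N := by
  ext a j
  let _ : Invertible (N.submatrix ρ c) := invertibleOfIsUnitDet _ hu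
  -- Bordering the invertible minor by row `a` and column `j` gives a minor of order `r + 1`; its
  -- vanishing is that of the Schur complement, which is a single entry.
  have h₁ : (fromBlocks (N.submatrix ρ c) (N.submatrix ρ fun _ : Fin 1 ↦ j)
      (N.submatrix (fun _ : Fin 1 ↦ a) c)
      (N.submatrix (fun _ : Fin 1 ↦ a) fun _ : Fin 1 ↦ j)).det = 0 := by
    rw [← hmin (Sum.elim ρ (fun _ ↦ a) ∘ finSumFinEquiv.symm)
      (Sum.elim c (fun _ ↦ j) ∘ finSumFinEquiv.symm), ← det_submatrix_equiv_self
          finSumFinEquiv.symm]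
    congr 1
    ext p q
    simp only [submatrix_apply, Function.comp_apply]
    rcases finSumFinEquiv.symm p with p | p <;> rcases finSumFinEquiv.symm q with q | q <;> rfl
  rw [det_fromBlocks₁₁, hu.mul_right_eq_zero, det_fin_one, Matrix.sub_apply, sub_eq_zero,
    submatrix_apply] at h₁
  rw [h₁, invOf_eq_nonsing_inv]
  rfl

/-- A matrix with four columns and constant rank `r` has a kernel which is free of rank `4 - r` and
a direct summand. -/
theorem exists_kernel_matrices [Nontrivial A] {r r' k : ℕ} (hrk : r + (k + 1) = 4)
    (hr : r' = r + 1) (N : Matrix (Fin 3) (Fin 4) A) (ρ : Fin r → Fin 3) (c : Fin r → Fin 4)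
    (hu : IsUnit (N.submatrix ρ c).det)
    (hmin : ∀ (ρ' : Fin r' → Fin 3) (c' : Fin r' → Fin 4), (N.submatrix ρ' c').det = 0) :
    ∃ (L : Matrix (Fin 4) (Fin (k + 1)) A) (P : Matrix (Fin (k + 1)) (Fin 4) A)
      (G : Matrix (Fin 4) (Fin 3) A), N * L = 0 ∧ P * L = 1 ∧ L * P + G * N = 1 := by
  subst hr
  have hc : Function.Injective c := by
    intro b b' hb
    by_contra hne
    refine hu.ne_zero (det_zero_of_column_eq hne fun a ↦ ?_)
    rw [submatrix_apply, submatrix_apply, hb]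
  obtain ⟨e, he⟩ : ∃ e : Fin r ⊕ Fin (k + 1) ≃ Fin 4, ∀ b, e (Sum.inl b) = c b := by
    classical
    have hcard : Fintype.card ((Set.range c)ᶜ : Set (Fin 4)) = k + 1 := by
      rw [Fintype.card_compl_set, Set.card_range_of_injective hc, Fintype.card_fin,
          Fintype.card_fin]
      omega
    exact ⟨(Equiv.sumCongr (Equiv.ofInjective c hc) (Fintype.equivFinOfCardEq hcard).symm).trans
      (Equiv.Set.sumCompl (Set.range c)), fun b ↦ rfl⟩
  set J := (N.submatrix ρ c)⁻¹ with hJ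
  let D : Matrix (Fin 3) (Fin (k + 1)) A := N.submatrix id (e ∘ Sum.inr)
  let C : Matrix (Fin 3) (Fin r) A := N.submatrix id c
  let Rρ : Matrix (Fin r) (Fin 3) A := (1 : Matrix (Fin 3) (Fin 3) A).submatrix ρ id
  have hR : ∀ {l : Type} (X : Matrix (Fin 3) l A), Rρ * X = X.submatrix ρ id := by
    intro l X
    exact (submatrix_mul_equiv (1 : Matrix (Fin 3) (Fin 3) A) X ρ (Equiv.refl _) id).trans
      (by rw [Matrix.one_mul])
  have hN : N = (fromCols C D).submatrix id e.symm := by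
    ext a j
    obtain ⟨j, rfl⟩ := e.surjective j
    rw [submatrix_apply, Equiv.symm_apply_apply]
    rcases j with j | j
    · rw [he]; rfl
    · rfl
  have hJC : J * (Rρ * C) = 1 := by
    rw [hR]
    exact nonsing_inv_mul _ hu
  -- Every other column is a combination of the columns `c`, with coefficients read off from the
  -- rows `ρ`.
  have hCJ : C * (J * (Rρ * D)) = D := by
    have h₁ := eq_mul_inv_mul_of_minors N ρ c hu hmin
    have h₂ := congrArg (fun X ↦ X.submatrix id (e ∘ Sum.inr)) h₁
    rw [hR, ← Matrix.mul_assoc]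
    exact h₂
  -- After reordering the columns, the kernel is parametrized by the free coordinates outside `c`,
  -- and `P` is the projection to these coordinates.
  refine ⟨(fromRows (-(J * (Rρ * D))) 1).submatrix e.symm id, (fromCols 0 1).submatrix id e.symm,
    (fromRows (J * Rρ) 0).submatrix e.symm id, ?_, ?_, ?_⟩
  · rw [hN, submatrix_mul_equiv, fromCols_mul_fromRows, Matrix.mul_neg, hCJ, Matrix.mul_one,
      neg_add_cancel]
    rfl
  · rw [submatrix_mul_equiv, fromCols_mul_fromRows, Matrix.zero_mul, zero_add, Matrix.mul_one]
    rfl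
  · rw [hN]
    have h₁ := submatrix_mul_equiv (fromRows (-(J * (Rρ * D))) (1 : Matrix (Fin (k + 1)) _ A))
      (fromCols (0 : Matrix (Fin (k + 1)) (Fin r) A) 1) e.symm (Equiv.refl _) e.symm
    have h₂ := submatrix_mul_equiv (fromRows (J * Rρ) (0 : Matrix (Fin (k + 1)) (Fin 3) A))
      (fromCols C D) e.symm (Equiv.refl _) e.symm
    refine (congrArg₂ (· + ·) h₁ h₂).trans ?_
    have h₃ : fromRows (-(J * (Rρ * D))) (1 : Matrix (Fin (k + 1)) _ A) *
        fromCols (0 : Matrix (Fin (k + 1)) (Fin r) A) 1 +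
        fromRows (J * Rρ) (0 : Matrix (Fin (k + 1)) (Fin 3) A) * fromCols C D = 1 := by
      rw [fromRows_mul_fromCols, fromRows_mul_fromCols, fromBlocks_add, Matrix.mul_assoc,
        Matrix.mul_assoc, hJC]
      simp
    exact (congrArg (fun X ↦ X.submatrix e.symm e.symm) h₃).trans (submatrix_one_equiv _)

/-- The bivector `x ∧ u`, where `u` is the vector with coordinates `L γ` and `u_i = 0`. -/
def kernelVec {n : ℕ} (i : Fin 5) (x : Fin 5 → A) (L : Matrix (Fin 4) (Fin n) A) (γ : Fin n → A) :
    Pair → A := wedgeVec x (i.insertNth 0 (L *ᵥ γ) : Fin 5 → A)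

variable {n : ℕ} {i : Fin 5} {x : Fin 5 → A} {L : Matrix (Fin 4) (Fin n) A}
  {P : Matrix (Fin n) (Fin 4) A}

theorem map_kernelVec {A' : Type u} [CommRing A'] (f : A →+* A') (γ : Fin n → A) :
    (fun b ↦ f (kernelVec i x L γ b)) =
      kernelVec i (fun j ↦ f (x j)) (L.map f) (fun j ↦ f (γ j)) := by
  rw [kernelVec, map_wedgeVec, kernelVec]
  congr 1
  funext j
  refine Fin.succAboveCases i ?_ (fun l ↦ ?_) j
  · rw [Fin.insertNth_apply_same, Fin.insertNth_apply_same, map_zero]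
  · rw [Fin.insertNth_apply_succAbove, Fin.insertNth_apply_succAbove, RingHom.map_mulVec]
    rfl

theorem kernelVec_smul (d : A) (γ : Fin n → A) :
    kernelVec i x L (d • γ) = d • kernelVec i x L γ := by
  rw [kernelVec, mulVec_smul, kernelVec, ← wedgeVec_smul]
  congr 1
  funext j
  refine Fin.succAboveCases i ?_ (fun l ↦ ?_) j
  · rw [Pi.smul_apply, Fin.insertNth_apply_same, Fin.insertNth_apply_same, smul_zero]
  · rw [Pi.smul_apply, Fin.insertNth_apply_succAbove, Fin.insertNth_apply_succAbove]
    rfl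

/-- The coordinates of the vector `u` for the bivector `p = x ∧ u` with `u_i = 0`. -/
def affinePart (i : Fin 5) (p : Pair → A) (j : Fin 4) : A := skew p i (i.succAbove j)

theorem affinePart_smul (d : A) (p : Pair → A) : affinePart i (d • p) = d • affinePart i p :=
  funext fun _ ↦ skew_smul _ _ _ _

theorem affinePart_kernelVec (hx : x i = 1) (γ : Fin n → A) :
    affinePart i (kernelVec i x L γ) = L *ᵥ γ := by
  funext j
  rw [affinePart, kernelVec, skew_wedgeVec, hx, Fin.insertNth_apply_same,
    Fin.insertNth_apply_succAbove]
  ring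

theorem mulVec_affinePart_kernelVec (hx : x i = 1) (hPL : P * L = 1) (γ : Fin n → A) :
    P *ᵥ affinePart i (kernelVec i x L γ) = γ := by
  rw [affinePart_kernelVec hx, mulVec_mulVec, hPL, one_mulVec]

/-- The identity `L * P + G * N = 1` makes `L * P` the identity on the kernel of `N`. -/
theorem kernelVec_mulVec_affinePart {N : Matrix (Fin 3) (Fin 4) A} {G : Matrix (Fin 4) (Fin 3) A}
    (h : L * P + G * N = 1) {p : Pair → A} (hp : p = wedgeVec x (skew p i))
    (hN : N *ᵥ affinePart i p = 0) : kernelVec i x L (P *ᵥ affinePart i p) = p := by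
  have h₁ : L *ᵥ (P *ᵥ affinePart i p) = affinePart i p := by
    have h₂ := congrArg (· *ᵥ affinePart i p) h
    simp only [add_mulVec, ← mulVec_mulVec, hN, mulVec_zero, add_zero, one_mulVec] at h₂
    exact h₂
  rw [kernelVec, h₁]
  conv_rhs => rw [hp]
  congr 1
  funext j
  refine Fin.succAboveCases i ?_ (fun l ↦ ?_) j
  · rw [Fin.insertNth_apply_same, skew_self]
  · rw [Fin.insertNth_apply_succAbove]
    rfl

end Kernel

/-! ### Local existence and gluing over open immersions -/

section LocalExistence

variable {T G : Scheme.{u}}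

/-- If functions generate the unit ideal then at each point one of them is invertible. -/
theorem exists_mem_basicOpen {κ : Type*} (t : T) (f : κ → Γ(T, ⊤))
    (H : ∀ I : Ideal Γ(T, ⊤), (∀ l, f l ∈ I) → I = ⊤) : ∃ l, t ∈ T.basicOpen (f l) := by
  by_contra hcon
  push Not at hcon
  let I := (IsLocalRing.maximalIdeal (T.presheaf.stalk t)).comap (T.presheaf.germ ⊤ t trivial).hom
  refine (Ideal.comap_ne_top (T.presheaf.germ ⊤ t trivial).hom
    (IsLocalRing.maximalIdeal.isMaximal _).ne_top : I ≠ ⊤) (H I fun l ↦ ?_)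
  have h := hcon l
  rw [T.mem_basicOpen (U := ⊤) _ _ trivial] at h
  exact (IsLocalRing.mem_maximalIdeal _).2 h

/-- Gluing of morphisms defined locally on `T` by a property which determines them. -/
theorem exists_glue_of_openImmersion (Q : ∀ ⦃T' : Scheme.{u}⦄, (T' ⟶ T) → (T' ⟶ G) → Prop)
    (hcomp : ∀ ⦃T' T'' : Scheme.{u}⦄ (k : T'' ⟶ T') [IsOpenImmersion k] (j : T' ⟶ T) (y : T' ⟶ G),
      Q j y → Q (k ≫ j) (k ≫ y))
    (huniq : ∀ ⦃T' : Scheme.{u}⦄ (j : T' ⟶ T) [IsOpenImmersion j] (y y' : T' ⟶ G),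
      Q j y → Q j y' → y = y')
    (hloc : ∀ t : T, ∃ (T' : Scheme.{u}) (j : T' ⟶ T), IsOpenImmersion j ∧ t ∈ Set.range j ∧
      ∃ y : T' ⟶ G, Q j y) :
    ∃ y : T ⟶ G, ∀ t : T, ∃ V : T.Opens, t ∈ V ∧ Q V.ι (V.ι ≫ y) := by
  refine exists_glue Q hcomp huniq fun t ↦ ?_
  obtain ⟨T', j, hj, ht, y, hy⟩ := hloc t
  refine ⟨j.opensRange, ht, j.isoOpensRange.inv ≫ y, ?_⟩
  have h := hcomp j.isoOpensRange.inv j y hy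
  rwa [Scheme.Hom.isoOpensRange_inv_comp] at h

end LocalExistence

/-! ### Points of `ℙ_ℳ(𝒰)` in a frame of the kernel -/

section KernelFrame

open Matrix

variable {𝕜 : Type u} [Field 𝕜] {B : Scheme.{u}} {R : Subbundle B} {s : B ⟶ Spec (.of 𝕜)}

variable (R) in
/-- A trivialization over `S` of the kernel of `φ`: the columns of `L` are a basis of the kernel, in
the affine coordinates of the quotient of `V₅` by the line spanned by `x`. -/
structure KernelFrame (k : ℕ) {S : Scheme.{u}} (h₀ : S ⟶ BxP s) where
  i : Fin 5
  x : Fin 5 → Γ(S, ⊤)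
  L : Matrix (Fin 4) (Fin (k + 1)) Γ(S, ⊤)
  P : Matrix (Fin (k + 1)) (Fin 4) Γ(S, ⊤)
  x_self : x i = 1
  mul_eq_one : P * L = 1
  exists_hom : ∀ ⦃T : Scheme.{u}⦄ (h : T ⟶ S) (γ : Fin (k + 1) → Γ(T, ⊤)) (a : Pair),
    IsUnit (kernelVec i (fun j ↦ h.appTop.hom (x j)) (L.map h.appTop.hom) γ a) →
    ∃ y : T ⟶ PMU R s, y ≫ mapF R s = h ≫ h₀ ∧ Coord (y ≫ PMU.toPair R s) a
      (kernelVec i (fun j ↦ h.appTop.hom (x j)) (L.map h.appTop.hom) γ)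
  retract : ∀ ⦃T : Scheme.{u}⦄ (h : T ⟶ S) (y : T ⟶ PMU R s), y ≫ mapF R s = h ≫ h₀ →
    ∀ (a : Pair) (p : Pair → Γ(T, ⊤)), Coord (y ≫ PMU.toPair R s) a p →
      kernelVec i (fun j ↦ h.appTop.hom (x j)) (L.map h.appTop.hom)
        (P.map h.appTop.hom *ᵥ affinePart i p) = p

namespace KernelFrame

variable {k : ℕ} {S : Scheme.{u}} {h₀ : S ⟶ BxP s} (F : KernelFrame R k h₀) {T T' : Scheme.{u}}

/-- The bivector with coordinates `γ` in the frame. -/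
def vec (h : T ⟶ S) (γ : Fin (k + 1) → Γ(T, ⊤)) : Pair → Γ(T, ⊤) :=
  kernelVec F.i (fun j ↦ h.appTop.hom (F.x j)) (F.L.map h.appTop.hom) γ

/-- The coordinates in the frame of a bivector. -/
def coef (h : T ⟶ S) (p : Pair → Γ(T, ⊤)) : Fin (k + 1) → Γ(T, ⊤) :=
  F.P.map h.appTop.hom *ᵥ affinePart F.i p

theorem vec_smul (h : T ⟶ S) (d : Γ(T, ⊤)) (γ : Fin (k + 1) → Γ(T, ⊤)) :
    F.vec h (d • γ) = d • F.vec h γ := kernelVec_smul d γ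

theorem coef_smul (h : T ⟶ S) (d : Γ(T, ⊤)) (p : Pair → Γ(T, ⊤)) :
    F.coef h (d • p) = d • F.coef h p := by
  rw [coef, affinePart_smul, mulVec_smul, coef]

theorem coef_vec (h : T ⟶ S) (γ : Fin (k + 1) → Γ(T, ⊤)) : F.coef h (F.vec h γ) = γ := by
  refine mulVec_affinePart_kernelVec ?_ ?_ γ
  · rw [F.x_self, map_one]
  · rw [← Matrix.map_mul, F.mul_eq_one, Matrix.map_one _ (map_zero _) (map_one _)]

theorem map_vec (m : T' ⟶ T) (h : T ⟶ S) (γ : Fin (k + 1) → Γ(T, ⊤)) :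
    (fun b ↦ m.appTop.hom (F.vec h γ b)) = F.vec (m ≫ h) (fun j ↦ m.appTop.hom (γ j)) := by
  refine (map_kernelVec m.appTop.hom γ).trans ?_
  rw [vec, Scheme.Hom.comp_appTop, CommRingCat.hom_comp]
  rfl

theorem vec_mem (h : T ⟶ S) {γ : Fin (k + 1) → Γ(T, ⊤)} {I : Ideal Γ(T, ⊤)} (hγ : ∀ l, γ l ∈ I)
    (b : Pair) : F.vec h γ b ∈ I := by
  have h₁ : ∀ j, (F.i.insertNth 0 (F.L.map h.appTop.hom *ᵥ γ) : Fin 5 → Γ(T, ⊤)) j ∈ I := by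
    intro j
    refine Fin.succAboveCases F.i ?_ (fun l ↦ ?_) j
    · rw [Fin.insertNth_apply_same]
      exact I.zero_mem
    · rw [Fin.insertNth_apply_succAbove]
      rw [mulVec, dotProduct]
      exact sum_mem fun l _ ↦ I.mul_mem_left _ (hγ l)
  exact sub_mem (I.mul_mem_left _ (h₁ _)) (I.mul_mem_left _ (h₁ _))

theorem coef_mem (h : T ⟶ S) {p : Pair → Γ(T, ⊤)} {I : Ideal Γ(T, ⊤)} (hp : ∀ b, p b ∈ I)
    (l : Fin (k + 1)) : F.coef h p l ∈ I := by
  rw [coef, mulVec, dotProduct]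
  refine sum_mem fun j _ ↦ I.mul_mem_left _ ?_
  rw [affinePart, skew]
  split_ifs
  · exact hp _
  · exact I.neg_mem (hp _)
  · exact I.zero_mem

/-- The point `c` of projective space and the point `y` of `ℙ_ℳ(𝒰)` correspond in the frame. -/
structure Compat (h : T ⟶ S) (c : T ⟶ PP (Fin (k + 1)) 𝕜) (y : T ⟶ PMU R s) : Prop where
  comp_mapF : y ≫ mapF R s = h ≫ h₀
  mul_comm : ∀ ⦃T' : Scheme.{u}⦄ (m : T' ⟶ T) (l : Fin (k + 1)) (γ : Fin (k + 1) → Γ(T', ⊤))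
    (a : Pair) (p : Pair → Γ(T', ⊤)), Coord (m ≫ c) l γ → Coord (m ≫ y ≫ PMU.toPair R s) a p →
    ∀ b, p a * F.vec (m ≫ h) γ b = p b * F.vec (m ≫ h) γ a

variable {F} {h : T ⟶ S} {c c' : T ⟶ PP (Fin (k + 1)) 𝕜} {y y' : T ⟶ PMU R s}

theorem Compat.comp (H : F.Compat h c y) (m : T' ⟶ T) : F.Compat (m ≫ h) (m ≫ c) (m ≫ y) := by
  refine ⟨by rw [Category.assoc, H.comp_mapF, Category.assoc], ?_⟩
  intro T'' m' l γ a p hγ hp b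
  rw [← Category.assoc] at hγ hp ⊢
  rw [← Category.assoc m' m y, Category.assoc] at hp
  exact H.mul_comm (m' ≫ m) l γ a p hγ hp b

theorem Compat.of_locally (H : ∀ t : T, ∃ V : T.Opens, t ∈ V ∧
    F.Compat (V.ι ≫ h) (V.ι ≫ c) (V.ι ≫ y)) : F.Compat h c y := by
  refine ⟨hom_ext_of_locally fun t ↦ ?_, ?_⟩
  · obtain ⟨V, ht, hV⟩ := H t
    refine ⟨V, ht, ?_⟩
    have := hV.comp_mapF
    rwa [Category.assoc, Category.assoc] at this
  intro T' m l γ a p hγ hp b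
  apply section_eq_of_locally_top
  intro t
  obtain ⟨V, ht, hV⟩ := H (m t)
  refine ⟨m ⁻¹ᵁ V, ht, ?_⟩
  let n : (m ⁻¹ᵁ V).toScheme ⟶ V := m ∣_ V
  have hn : n ≫ V.ι = (m ⁻¹ᵁ V).ι ≫ m := morphismRestrict_ι m V
  have hn' : ∀ {X : Scheme.{u}} (f : T ⟶ X), n ≫ V.ι ≫ f = (m ⁻¹ᵁ V).ι ≫ m ≫ f := by
    intro X f
    rw [← Category.assoc, hn, Category.assoc]
  have h₁ := hγ.comp (m ⁻¹ᵁ V).ι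
  have h₂ := hp.comp (m ⁻¹ᵁ V).ι
  rw [← hn'] at h₁ h₂
  rw [← Category.assoc V.ι] at h₂
  have h₃ := hV.mul_comm n l _ a _ h₁ h₂ b
  have h₄ := F.map_vec (m ⁻¹ᵁ V).ι (m ≫ h) γ
  rw [← hn'] at h₄
  rw [← h₄] at h₃
  rw [map_mul, map_mul]
  exact h₃

theorem Compat.of_coord (hy : y ≫ mapF R s = h ≫ h₀) {l : Fin (k + 1)} {γ : Fin (k + 1) → Γ(T, ⊤)}
    (hγ : Coord c l γ) {a : Pair} {p : Pair → Γ(T, ⊤)} (hp : Coord (y ≫ PMU.toPair R s) a p)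
    (e : F.vec h γ = p) : F.Compat h c y := by
  refine ⟨hy, ?_⟩
  intro T' m l' γ' a' p' hγ' hp' b
  obtain ⟨d, rfl⟩ := (hγ.comp m).exists_smul hγ'.mem
  obtain ⟨d', rfl⟩ := (hp.comp m).exists_smul hp'.mem
  rw [vec_smul, ← map_vec, e]
  simp only [Pi.smul_apply, smul_eq_mul]
  ring

/-- Proportionality gives `F.vec h γ = d • p`, and taking coefficients gives `γ = d • F.coef h p`;
an invertible entry of `γ` makes `d` a unit. -/
theorem Compat.exists_smul (H : F.Compat h c y) {l : Fin (k + 1)} {γ : Fin (k + 1) → Γ(T, ⊤)}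
    (hγ : Coord c l γ) {a : Pair} {p : Pair → Γ(T, ⊤)} (hp : Coord (y ≫ PMU.toPair R s) a p) :
    ∃ d : Γ(T, ⊤), IsUnit d ∧ F.vec h γ = d • p ∧ γ = d • F.coef h p := by
  have h₁ := H.mul_comm (𝟙 T) l γ a p (by rwa [Category.id_comp]) (by rwa [Category.id_comp])
  rw [Category.id_comp] at h₁
  obtain ⟨d, hd⟩ := hp.exists_smul (hp.mem_of_mul_comm h₁)
  have h₂ : γ = d • F.coef h p := by rw [← coef_smul, ← hd, coef_vec]
  refine ⟨d, ?_, hd, h₂⟩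
  have h₃ := hγ.isUnit
  rw [h₂] at h₃
  exact isUnit_of_mul_isUnit_left h₃

/-- With `eq_left` and the two existence statements below, this shows that `Compat` is the graph of
a bijection between points of `ℙᵏ` and lifts to `ℙ_ℳ(𝒰)`, functorial in the test scheme. -/
theorem Compat.eq_right (H : F.Compat h c y) (H' : F.Compat h c y') : y = y' := by
  apply hom_ext_of_locally
  intro t
  obtain ⟨l, hl⟩ := PP.exists_mem_chart (c t)
  obtain ⟨b, hb⟩ := PP.exists_mem_chart ((y ≫ PMU.toPair R s) t)
  obtain ⟨b', hb'⟩ := PP.exists_mem_chart ((y' ≫ PMU.toPair R s) t)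
  let O : T.Opens := c ⁻¹ᵁ PP.chart 𝕜 l ⊓ ((y ≫ PMU.toPair R s) ⁻¹ᵁ PP.chart 𝕜 b ⊓
    (y' ≫ PMU.toPair R s) ⁻¹ᵁ PP.chart 𝕜 b')
  refine ⟨O, ⟨hl, hb, hb'⟩, ?_⟩
  obtain ⟨γ, -, hγ⟩ := exists_coord_of_le c (V := O) (i := l) inf_le_left
  obtain ⟨p, -, hp⟩ := exists_coord_of_le (y ≫ PMU.toPair R s) (V := O) (i := b)
    (inf_le_right.trans inf_le_left)
  obtain ⟨p', -, hp'⟩ := exists_coord_of_le (y' ≫ PMU.toPair R s) (V := O) (i := b')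
    (inf_le_right.trans inf_le_right)
  rw [← Category.assoc] at hp hp'
  have h₁ := (H.comp O.ι).comp_mapF
  have h₂ := (H'.comp O.ι).comp_mapF
  obtain ⟨d, hd, e, -⟩ := (H.comp O.ι).exists_smul hγ hp
  obtain ⟨d', hd', e', -⟩ := (H'.comp O.ι).exists_smul hγ hp'
  refine PMU.hom_ext (h₁.trans h₂.symm) (hp.hom_ext' hp' ?_ fun j ↦ ?_)
  · rw [Category.assoc (O.ι ≫ y), Category.assoc (O.ι ≫ y'), toPair_toSpec,
      ← Category.assoc (O.ι ≫ y), h₁, ← Category.assoc (O.ι ≫ y'), h₂]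
  · rw [e] at e'
    have e₁ := congrFun e' b
    have e₂ := congrFun e' j
    simp only [Pi.smul_apply, smul_eq_mul] at e₁ e₂
    refine hd'.mul_left_cancel ?_
    linear_combination p j * e₁ - p b * e₂

theorem Compat.eq_left (H : F.Compat h c y) (H' : F.Compat h c' y)
    (hc : c ≫ PP.toSpec _ 𝕜 = c' ≫ PP.toSpec _ 𝕜) : c = c' := by
  apply hom_ext_of_locally
  intro t
  obtain ⟨l, hl⟩ := PP.exists_mem_chart (c t)
  obtain ⟨l', hl'⟩ := PP.exists_mem_chart (c' t)
  obtain ⟨b, hb⟩ := PP.exists_mem_chart ((y ≫ PMU.toPair R s) t)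
  let O : T.Opens := (y ≫ PMU.toPair R s) ⁻¹ᵁ PP.chart 𝕜 b ⊓ (c ⁻¹ᵁ PP.chart 𝕜 l ⊓
    c' ⁻¹ᵁ PP.chart 𝕜 l')
  refine ⟨O, ⟨hb, hl, hl'⟩, ?_⟩
  obtain ⟨p, -, hp⟩ := exists_coord_of_le (y ≫ PMU.toPair R s) (V := O) (i := b) inf_le_left
  obtain ⟨γ, -, hγ⟩ := exists_coord_of_le c (V := O) (i := l) (inf_le_right.trans inf_le_left)
  obtain ⟨γ', -, hγ'⟩ := exists_coord_of_le c' (V := O) (i := l') (inf_le_right.trans inf_le_right)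
  rw [← Category.assoc] at hp
  obtain ⟨d, -, -, e⟩ := (H.comp O.ι).exists_smul hγ hp
  obtain ⟨d', -, -, e'⟩ := (H'.comp O.ι).exists_smul hγ' hp
  refine hγ.hom_ext' hγ' (by rw [Category.assoc, hc, Category.assoc]) fun j ↦ ?_
  rw [e, e']
  simp only [Pi.smul_apply, smul_eq_mul]
  ring

variable (F) in
theorem exists_compat_right (h : T ⟶ S) (c : T ⟶ PP (Fin (k + 1)) 𝕜) : ∃ y, F.Compat h c y := by
  obtain ⟨y, hy⟩ := exists_glue_of_openImmersion (T := T) (G := PMU R s)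
    (fun T' j y ↦ F.Compat (j ≫ h) (j ≫ c) y)
    (fun T' T'' k _ j y H ↦ by
      rw [Category.assoc, Category.assoc]
      exact H.comp k)
    (fun T' j _ y y' H H' ↦ H.eq_right H') (by
      intro t
      obtain ⟨V, l, γ, ht, hγ1, hγ⟩ := exists_local_coord c t
      -- The coefficients `γ` are recovered linearly from the bivector and one of them is `1`, so
      -- its entries generate the unit ideal.
      obtain ⟨b, hb⟩ := exists_mem_basicOpen (⟨t, ht⟩ : V) (F.vec (V.ι ≫ h) γ) (by
        intro I hI
        have h₁ := F.coef_mem (V.ι ≫ h) hI l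
        rw [coef_vec, hγ1] at h₁
        exact (Ideal.eq_top_iff_one I).2 h₁)
      let D := V.toScheme.basicOpen (F.vec (V.ι ≫ h) γ b)
      have hu := isUnit_ι_basicOpen (F.vec (V.ι ≫ h) γ b)
      have e := F.map_vec D.ι (V.ι ≫ h) γ
      rw [congrFun e b] at hu
      obtain ⟨y, hy, hp⟩ := F.exists_hom (D.ι ≫ V.ι ≫ h) _ b hu
      refine ⟨D.toScheme, D.ι ≫ V.ι, inferInstance, ⟨⟨⟨t, ht⟩, hb⟩, rfl⟩, y, ?_⟩
      have hγ' := hγ.comp D.ι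
      rw [← Category.assoc] at hγ' hy
      rw [← Category.assoc] at hp
      refine .of_coord hy hγ' hp rfl)
  exact ⟨y, .of_locally hy⟩

variable (F) in
theorem exists_compat_left (h : T ⟶ S) (y : T ⟶ PMU R s) (hy : y ≫ mapF R s = h ≫ h₀) :
    ∃ c, c ≫ PP.toSpec _ 𝕜 = h ≫ h₀ ≫ BxP.toB s ≫ s ∧ F.Compat h c y := by
  obtain ⟨c, hc⟩ := exists_glue_of_openImmersion (T := T) (G := PP (Fin (k + 1)) 𝕜)
    (fun T' j c ↦ c ≫ PP.toSpec _ 𝕜 = j ≫ h ≫ h₀ ≫ BxP.toB s ≫ s ∧ F.Compat (j ≫ h) c (j ≫ y))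
    (fun T' T'' k _ j y H ↦ by
      rw [Category.assoc, Category.assoc, Category.assoc, H.1]
      exact ⟨rfl, H.2.comp k⟩)
    (fun T' j _ c c' H H' ↦ H.2.eq_left H'.2 (H.1.trans H'.1.symm)) (by
      intro t
      obtain ⟨V, a, p, ht, hp1, hp⟩ := exists_local_coord (y ≫ PMU.toPair R s) t
      rw [← Category.assoc] at hp
      have hyV : (V.ι ≫ y) ≫ mapF R s = (V.ι ≫ h) ≫ h₀ := by
        rw [Category.assoc, hy, Category.assoc]
      have hr : F.vec (V.ι ≫ h) (F.coef (V.ι ≫ h) p) = p := F.retract _ _ hyV a p hp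
      -- Conversely the bivector is recovered linearly from its coefficients and has an entry `1`,
      -- so the coefficients generate the unit ideal.
      obtain ⟨l, hl⟩ := exists_mem_basicOpen (⟨t, ht⟩ : V) (F.coef (V.ι ≫ h) p) (by
        intro I hI
        have h₁ := F.vec_mem (V.ι ≫ h) hI a
        rw [hr, hp1] at h₁
        exact (Ideal.eq_top_iff_one I).2 h₁)
      let D := V.toScheme.basicOpen (F.coef (V.ι ≫ h) p l)
      have hu := isUnit_ι_basicOpen (F.coef (V.ι ≫ h) p l)
      have e := F.map_vec D.ι (V.ι ≫ h) (F.coef (V.ι ≫ h) p)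
      rw [hr] at e
      obtain ⟨c, hc, hγ⟩ := exists_coord ((D.ι ≫ V.ι) ≫ h ≫ h₀ ≫ BxP.toB s ≫ s) l
        (fun j ↦ D.ι.appTop.hom (F.coef (V.ι ≫ h) p j)) hu
      refine ⟨D.toScheme, D.ι ≫ V.ι, inferInstance, ⟨⟨⟨t, ht⟩, hl⟩, rfl⟩, c, hc, ?_⟩
      have hp' := hp.comp D.ι
      rw [← Category.assoc, ← Category.assoc] at hp'
      rw [← Category.assoc] at e
      refine .of_coord ?_ hγ hp' e.symm
      rw [Category.assoc, Category.assoc, hy, Category.assoc, Category.assoc])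
  refine ⟨c, hom_ext_of_locally fun t ↦ ?_, .of_locally fun t ↦ ?_⟩
  · obtain ⟨V, ht, hV, -⟩ := hc t
    exact ⟨V, ht, by rw [← Category.assoc]; exact hV⟩
  · obtain ⟨V, ht, -, hV⟩ := hc t
    exact ⟨V, ht, hV⟩

/-- A frame of the kernel trivializes the base change of `ℙ_ℳ(𝒰)`. -/
theorem exists_iso (F : KernelFrame R k h₀) : ∃ e : pullback (mapF R s) h₀ ≅
    pullback (h₀ ≫ BxP.toB s ≫ s) (PP.toSpec (Fin (k + 1)) 𝕜),
    e.hom ≫ pullback.fst _ _ = pullback.snd _ _ := by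
  obtain ⟨Ψ, hΨ⟩ := F.exists_compat_right (pullback.fst (h₀ ≫ BxP.toB s ≫ s)
    (PP.toSpec (Fin (k + 1)) 𝕜)) (pullback.snd _ _)
  obtain ⟨Φ, hΦ, hΦ'⟩ := F.exists_compat_left (pullback.snd (mapF R s) h₀) (pullback.fst _ _)
    pullback.condition
  let f : pullback (mapF R s) h₀ ⟶ pullback (h₀ ≫ BxP.toB s ≫ s) (PP.toSpec (Fin (k + 1)) 𝕜) :=
    pullback.lift (pullback.snd _ _) Φ hΦ.symm
  let g : pullback (h₀ ≫ BxP.toB s ≫ s) (PP.toSpec (Fin (k + 1)) 𝕜) ⟶ pullback (mapF R s) h₀ :=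
    pullback.lift Ψ (pullback.fst _ _) hΨ.comp_mapF
  have hf₁ : f ≫ pullback.fst _ _ = pullback.snd _ _ := pullback.lift_fst _ _ _
  have hf₂ : f ≫ pullback.snd _ _ = Φ := pullback.lift_snd _ _ _
  have hg₁ : g ≫ pullback.fst _ _ = Ψ := pullback.lift_fst _ _ _
  have hg₂ : g ≫ pullback.snd _ _ = pullback.fst _ _ := pullback.lift_snd _ _ _
  refine ⟨⟨f, g, pullback.hom_ext ?_ ?_, pullback.hom_ext ?_ ?_⟩, hf₁⟩
  · rw [Category.assoc, hg₁, Category.id_comp]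
    -- Both composites are compatible with the same partner as the identity, so they agree with it
    -- by uniqueness.
    have h₁ := hΨ.comp f
    rw [hf₁, hf₂] at h₁
    exact h₁.eq_right hΦ'
  · rw [Category.assoc, hg₂, hf₁, Category.id_comp]
  · rw [Category.assoc, hf₁, hg₂, Category.id_comp]
  · rw [Category.assoc, hf₂, Category.id_comp]
    have h₁ := hΦ'.comp g
    rw [hg₁, hg₂] at h₁
    refine h₁.eq_left hΨ ?_
    rw [Category.assoc, hΦ]
    exact ((Category.assoc _ _ _).symm.trans (congrArg (· ≫ _) hg₂)).trans pullback.condition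

end KernelFrame

end KernelFrame

/-! ### The fibration over the strata -/

section Fibration

open Matrix

variable {𝕜 : Type u} [Field 𝕜] {B : Scheme.{u}} {R : Subbundle B} {s : B ⟶ Spec (.of 𝕜)}

theorem nonempty_kernelFrame {S : Scheme.{u}} {h₀ : S ⟶ BxP s} {k : ℕ} {W : B.affineOpens}
    {r : Fin 3 → Pair → Γ(B, W)}
    (hr : (R.sections W).toSubmodule = Submodule.span Γ(B, W) (Set.range r))
    (e : ⊤ ≤ (h₀ ≫ BxP.toB s) ⁻¹ᵁ W.1) {i : Fin 5} {x : Fin 5 → Γ(S, ⊤)}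
    (hx : Coord (h₀ ≫ BxP.toPP s) i x) (hx1 : x i = 1)
    {L : Matrix (Fin 4) (Fin (k + 1)) Γ(S, ⊤)} {P : Matrix (Fin (k + 1)) (Fin 4) Γ(S, ⊤)}
    {G : Matrix (Fin 4) (Fin 3) Γ(S, ⊤)} {N : Matrix (Fin 3) (Fin 4) Γ(S, ⊤)}
    (hN : N = Matrix.of (contractMatrix (fun a ↦ pullForm (h₀ ≫ BxP.toB s) e (r a)) x i))
    (hNL : N * L = 0) (hPL : P * L = 1) (hLP : L * P + G * N = 1) :
    Nonempty (KernelFrame R k h₀) := by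
  have hx1' : ∀ {T : Scheme.{u}} (h : T ⟶ S), (fun j ↦ h.appTop.hom (x j)) i = 1 := fun h ↦ by
    simp only [hx1, map_one]
  have hN' : ∀ {T : Scheme.{u}} (h : T ⟶ S) {b : T ⟶ B} (_ : b = h ≫ h₀ ≫ BxP.toB s)
      (e' : ⊤ ≤ b ⁻¹ᵁ W.1),
      Matrix.of (contractMatrix (fun a ↦ pullForm b e' (r a)) (fun j ↦ h.appTop.hom (x j)) i) =
        N.map h.appTop.hom := by
    rintro T h b rfl e'
    ext a l
    rw [hN, map_apply, of_apply, of_apply, map_contractMatrix]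
    congr 1
    funext a
    exact (pullForm_comp_top _ h e e' (r a)).symm
  refine ⟨⟨i, x, L, P, hx1, hPL, ?_, ?_⟩⟩
  · intro T h γ a ha
    have hx' := hx.comp h
    have e' : ⊤ ≤ ((h ≫ h₀) ≫ BxP.toB s) ⁻¹ᵁ W.1 := by
      rw [Category.assoc]
      exact top_le_comp h e
    rw [← Category.assoc] at hx'
    refine exists_PMU_of_coord hx' e' hr ha fun c ↦ ?_
    rw [evalForm_eq_sum_contractMatrix (fun a ↦ pullForm ((h ≫ h₀) ≫ BxP.toB s) e' (r a)) _
      (Fin.insertNth_apply_same i _ _)]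
    simp only [Fin.insertNth_apply_succAbove]
    have h₁ : N.map h.appTop.hom *ᵥ (L.map h.appTop.hom *ᵥ γ) = 0 := by
      rw [mulVec_mulVec, ← Matrix.map_mul, hNL, Matrix.map_zero _ (map_zero _), zero_mulVec]
    rw [← hN' h (Category.assoc _ _ _) e'] at h₁
    exact congrFun h₁ c
  · intro T h y hy a p hp
    have hyP : y ≫ mapF R s ≫ BxP.toPP s = h ≫ h₀ ≫ BxP.toPP s := by
      rw [← Category.assoc, hy, Category.assoc]
    have hyB : y ≫ mapF R s ≫ BxP.toB s = h ≫ h₀ ≫ BxP.toB s := by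
      rw [← Category.assoc, hy, Category.assoc]
    have hx' := hx.comp h
    rw [← hyP] at hx'
    have e' : ⊤ ≤ (y ≫ mapF R s ≫ BxP.toB s) ⁻¹ᵁ W.1 := by
      rw [hyB]
      exact top_le_comp h e
    refine kernelVec_mulVec_affinePart (N := N.map h.appTop.hom) (G := G.map h.appTop.hom) ?_
      (PMU.coord_eq_wedgeVec hx' (hx1' h) hp) ?_
    · rw [← Matrix.map_mul, ← Matrix.map_mul, ← Matrix.map_add _ (map_add _), hLP,
        Matrix.map_one _ (map_zero _) (map_one _)]
    · rw [← hN' h hyB e']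
      funext c
      have h₁ := PMU.evalForm_eq_zero hx' (hx1' h) hp e' (r := r c) (by
        rw [hr]; exact Submodule.subset_span ⟨c, rfl⟩)
      rw [evalForm_eq_sum_contractMatrix (fun a ↦ pullForm (y ≫ mapF R s ≫ BxP.toB s) e' (r a)) _
        (skew_self p i)] at h₁
      exact h₁

/-- The ideal of a degeneracy locus in terms of the minors of the matrix of `φ`. -/
theorem degeneracyIdeal_ideal_eq_span_minors (k : ℕ) {W : B.affineOpens}
    {r : Fin 3 → Pair → Γ(B, W)}
    (hr : (R.sections W).toSubmodule = Submodule.span Γ(B, W) (Set.range r)) {i : Fin 5}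
    {V : (BxP s).Opens} (hV : IsAffineOpen V) (hb : V ≤ BxP.toB s ⁻¹ᵁ W.1)
    {x : Fin 5 → Γ(BxP s, V)} (hx : x ∈ tautLine (BxP.toPP s) V) (hx1 : x i = 1) :
    (degeneracyIdeal R s k).ideal ⟨V, hV⟩ =
      Ideal.span {y | ∃ (ρ : Fin (4 - k) → Fin 3) (τ : Fin (4 - k) → Fin 4),
        y = ((Matrix.of (contractMatrix (fun a ↦ pullForm (BxP.toB s) hb (r a)) x i)).submatrix
          ρ τ).det} := by
  rw [degeneracyIdeal_ideal k hr hV hb hx hx1]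
  congr 1
  ext y
  constructor
  · rintro ⟨ρ, σ, rfl⟩
    choose τ hτ using fun c ↦ Fin.exists_succAbove_eq (σ c).2
    refine ⟨ρ, τ, congrArg Matrix.det ?_⟩
    ext a c
    change _ = contract _ x (i.succAbove (τ c))
    rw [hτ]
    rfl
  · rintro ⟨ρ, τ, rfl⟩
    exact ⟨ρ, fun c ↦ ⟨i.succAbove (τ c), i.succAbove_ne _⟩, rfl⟩

/-- Locally on the locus where the corank is `k`, the kernel has a frame. -/
theorem exists_kernelFrame (k : ℕ) (x : Stratum R s k) : ∃ W : (Stratum R s k).Opens, x ∈ W ∧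
    Nonempty (KernelFrame R k (W.ι ≫ Stratum.ι R s k)) := by
  set ι := Stratum.ι R s k with hι
  obtain ⟨W, hW, r, hr⟩ := exists_frame R (BxP.toB s (ι x))
  obtain ⟨i, hi⟩ := PP.exists_mem_chart (BxP.toPP s (ι x))
  obtain ⟨U, hU, hxU, hle⟩ := exists_affine_le
    (U := BxP.toB s ⁻¹ᵁ W.1 ⊓ BxP.toPP s ⁻¹ᵁ PP.chart 𝕜 i) (z := ι x) ⟨hW, hi⟩
  have hb : U ≤ BxP.toB s ⁻¹ᵁ W.1 := hle.trans inf_le_left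
  obtain ⟨v, hv1, hv, -⟩ := exists_coord_section (BxP.toPP s) (V := U) (i := i)
    (hle.trans inf_le_right)
  set N := Matrix.of (contractMatrix (fun a ↦ pullForm (BxP.toB s) hb (r a)) v i) with hN
  -- Outside `D_{k+1}` some minor of order `4 - (k + 1)` is nonzero at `x`, hence invertible on a
  -- neighborhood.
  have hsupp : ι x ∉ (degeneracyIdeal R s (k + 1)).support := by
    have := x.2
    exact this
  rw [Scheme.IdealSheafData.mem_support_iff_of_mem (U := ⟨U, hU⟩) hxU,
    degeneracyIdeal_ideal_eq_span_minors (k + 1) hr hU hb hv hv1, Scheme.zeroLocus_span,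
    Scheme.mem_zeroLocus_iff] at hsupp
  push Not at hsupp
  obtain ⟨_, ⟨ρ, τ, rfl⟩, hρτ⟩ := hsupp
  rw [← hN] at hρτ
  let O : (Stratum R s k).Opens := ι ⁻¹ᵁ (BxP s).basicOpen (N.submatrix ρ τ).det
  have hOU : O ≤ ι ⁻¹ᵁ U := fun y hy ↦ (BxP s).basicOpen_le _ hy
  have eU : ⊤ ≤ (O.ι ≫ ι) ⁻¹ᵁ U := ι_top_le hOU
  let φ := ((O.ι ≫ ι).appLE U ⊤ eU).hom
  have hφu : IsUnit (φ (N.submatrix ρ τ).det) := by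
    have h₁ : ⊤ ≤ (O.ι ≫ ι) ⁻¹ᵁ (BxP s).basicOpen (N.submatrix ρ τ).det := ι_top_le le_rfl
    have h₂ := (isUnit_res_basicOpen (N.submatrix ρ τ).det).map ((O.ι ≫ ι).appLE _ ⊤ h₁).hom
    rwa [map_appLE_apply (O.ι ≫ ι) h₁ ((BxP s).basicOpen_le _) eU] at h₂
  have hφ0 : ∀ (ρ' : Fin (4 - k) → Fin 3) (τ' : Fin (4 - k) → Fin 4),
      φ (N.submatrix ρ' τ').det = 0 := by
    intro ρ' τ'
    have h₁ := (isChartIdeal_ideal (degeneracyIdeal R s k) hU (O.ι ≫ ι) eU).1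
      ⟨O.ι ≫ (stratumOpens R s k).ι, Category.assoc _ _ _⟩
    rw [degeneracyIdeal_ideal_eq_span_minors k hr hU hb hv hv1, Ideal.span_le] at h₁
    exact h₁ ⟨ρ', τ', rfl⟩
  have hxO : x ∈ O := hρτ
  have hnt : Nontrivial Γ(O, ⊤) := by
    have : Nonempty (⊤ : O.toScheme.Opens) := ⟨⟨⟨x, hxO⟩, trivial⟩⟩
    infer_instance
  refine ⟨O, hxO, ?_⟩
  -- For `k ≥ 4` the empty minor `1` would vanish on the nonempty scheme `O`.
  have hk : k < 4 := by
    by_contra hk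
    have : IsEmpty (Fin (4 - k)) := by
      rw [show 4 - k = 0 by omega]
      infer_instance
    have h₁ := hφ0 isEmptyElim isEmptyElim
    rw [det_isEmpty, map_one] at h₁
    exact one_ne_zero h₁
  have hdet : ∀ {n : ℕ} (ρ' : Fin n → Fin 3) (τ' : Fin n → Fin 4),
      ((N.map φ).submatrix ρ' τ').det = φ (N.submatrix ρ' τ').det := by
    intro n ρ' τ'
    rw [RingHom.map_det]
    rfl
  obtain ⟨L, P, G, hNL, hPL, hLP⟩ := exists_kernel_matrices (r := 4 - (k + 1)) (r' := 4 - k) (k :=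
      k)
    (by omega) (by omega) (N.map φ) ρ τ (by rwa [hdet]) (fun ρ' τ' ↦ by rw [hdet, hφ0])
  have eb : ⊤ ≤ ((O.ι ≫ ι) ≫ BxP.toB s) ⁻¹ᵁ W.1 := fun y hy ↦ hb (eU hy)
  refine nonempty_kernelFrame hr eb (coord_of_mem_tautLine hv (i := i) (by
    rw [hv1]; exact isUnit_one) (O.ι ≫ ι) eU) (by rw [hv1, map_one]) ?_ hNL hPL hLP
  ext a l
  rw [map_apply, hN, of_apply, of_apply, map_contractMatrix]
  congr 1
  funext a
  exact pullForm_comp (BxP.toB s) (O.ι ≫ ι) hb eU eb (r a)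

theorem isProjectiveFibration_stratum (k : ℕ) :
    IsProjectiveFibration k (pullback.snd (mapF R s) (Stratum.ι R s k))
      (Stratum.ι R s k ≫ BxP.toB s ≫ s) := by
  intro x
  obtain ⟨W, hx, ⟨F⟩⟩ := exists_kernelFrame k x
  obtain ⟨e, he⟩ := F.exists_iso
  let g := pullback.snd (mapF R s) (Stratum.ι R s k)
  let e₁ := (pullbackRestrictIsoRestrict g W).symm ≪≫
    pullbackLeftPullbackSndIso (mapF R s) (Stratum.ι R s k) W.ι
  have h₁ : e₁.hom ≫ pullback.snd _ _ = g ∣_ W := by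
    refine (Category.assoc _ _ _).trans ?_
    rw [pullbackLeftPullbackSndIso_hom_snd]
    rfl
  let e₂ : pullback ((W.ι ≫ Stratum.ι R s k) ≫ BxP.toB s ≫ s) (PP.toSpec (Fin (k + 1)) 𝕜) ≅
      pullback (W.ι ≫ Stratum.ι R s k ≫ BxP.toB s ≫ s) (PP.toSpec (Fin (k + 1)) 𝕜) :=
    pullback.congrHom (Category.assoc _ _ _) rfl
  have h₂ : e₂.hom ≫ pullback.fst _ _ = pullback.fst _ _ :=
    (pullback.lift_fst _ _ _).trans (Category.comp_id _)
  refine ⟨W, hx, e₁ ≪≫ e ≪≫ e₂, ?_⟩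
  rw [← h₁, ← he, ← h₂]
  simp only [Iso.trans_hom, Category.assoc]

end Fibration

end QuinticFibration

end

open QuinticFibration in
theorem mainTheorem3 {𝕜 : Type u} [Field 𝕜] {B : Scheme.{u}} (s : B ⟶ Spec (.of 𝕜))
    (hB : IsCohenMacaulay B) (R : Subbundle B)
    (hcodim : ∀ k : ℕ, 1 ≤ k →
      ((k + 1 : ℕ) : WithBot ℕ∞) ≤ codim (degeneracyIdeal R s k).support) :
    IsBlowUp (mapF R s) (degeneracyIdeal R s 1) ∧
    ∀ k : ℕ, IsProjectiveFibration k (pullback.snd (mapF R s) (Stratum.ι R s k))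
      (Stratum.ι R s k ≫ BxP.toB s ≫ s) := by
  exact ⟨⟨isCartier_comap_mapF hB hcodim, fun _ g hg ↦ existsUnique_lift_of_cartier g hg⟩,
    fun k ↦ isProjectiveFibration_stratum k⟩
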